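/- Let $a>0$, $N\ge 0$, and let $Q$ range over the potentials on the circle $S^1$ of radius $a$: smooth, $2\pi a$-periodic functions with values in the real symmetric $N\times N$ matrices. Put $D=\partial_x$, $L=-D^2+Q$, $\mathrm{Ad}_Q f=Qf-fQ$. Let $a_k(x,y)$, $k\ge0$, be the heat kernel coefficients of $L$: $a_0=1$ and, for $k\ge1$, $a_k$ is the regular solution of $\bigl(1+\tfrac1k(x-y)\partial_x\bigr)a_k=L_x a_{k-1}$, that is, $a_k(x,y)=k\int_0^1\tau^{k-1}(L a_{k-1})(y+\tau(x-y),y)\,d\tau$. Write $[a_k](x)=a_k(x,x)$, $A_k=\int_{S^1}\mathrm{tr}\,[a_k]\,dx$ and, for $k\ge 0$, $I_k=(-1)^k\frac{(2k)!}{k!(k+1)!}A_{k+1}$. The variational derivative $\delta H/\delta Q$ of a functional $H$ of $Q$ is the smooth periodic symmetric matrix function with $\partial_sH(Q(s))=\int_{S^1}\mathrm{tr}\bigl(\partial_sQ\,\frac{\delta H}{\delta Q}\bigr)dx$ along every smooth one-parameter family $Q(s)$. Let $D^{-1}$ send a function of the form $DW$, with $W$ a differential polynomial in the matrix $Q$ without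 constant term, to $W$ (which is unique), and set $$E=D^3-2QD-2DQ+\mathrm{Ad}_QD+D\,\mathrm{Ad}_Q+\mathrm{Ad}_QD^{-1}\mathrm{Ad}_Q$$ (for $N=1$, $E=D^3-2QD-2DQ$). Define $\{H,G\}_D=\int_{S^1}\mathrm{tr}\,\frac{\delta H}{\delta Q}D\frac{\delta G}{\delta Q}\,dx$ and $\{H,G\}_E=\int_{S^1}\mathrm{tr}\,\frac{\delta H}{\delta Q}E\frac{\delta G}{\delta Q}\,dx$. Then the following hold. 1. The $a_k$ are smooth, satisfy the above recursion, and give the heat kernel expansion: if $U(t;x,y)$ is the heat kernel of $L$ on $S^1$, then as $t\to0^+$, $(4\pi t)^{1/2}U(t;x,x)\sim\sum_{k\ge0}\frac{(-t)^k}{k!}[a_k](x)$ uniformly in $x$, and $(4\pi t)^{1/2}\int_{S^1}\mathrm{tr}\,U(t;x,x)\,dx\sim\sum_{k\ge0}\frac{(-t)^k}{k!}A_k$. 2. $\delta A_0/\delta Q=0$, and $\delta A_k/\delta Q=k[a_{k-1}]$ for $k\ge1$. 3. For every $k\ge0$, $\mathrm{Ad}_Q\frac{\delta I_k}{\delta Q}=DW$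 for a differential polynomial $W$ without constant term, so that $E\frac{\delta I_k}{\delta Q}$ is defined. For $k\ge1$, $\frac{\delta I_k}{\delta Q}$ is a differential polynomial without constant term, $\frac{\delta I_k}{\delta Q}=-2(D^{-1}E)^{k-1}Q$ and $D\frac{\delta I_k}{\delta Q}=E\frac{\delta I_{k-1}}{\delta Q}$. 4. For $n\ge0$, $k\ge1$, $\{I_n,I_k\}_D=\{I_n,I_{k-1}\}_E$; and for all $n,k\ge0$, $\{I_n,I_k\}_D=\{I_n,I_k\}_E=0$. 5. If $Q(s)$ is a smooth family, $s$ in an open set of real numbers, with $\partial_sQ=D\frac{\delta I_k}{\delta Q}$ for some $k\ge0$, then $\partial_sI_n(Q(s))=0$ for all $n\ge0$. -/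

import Mathlib

open Set Filter Topology
open scoped ContDiff Matrix Matrix.Norms.Operator

namespace HeatKdV

noncomputable section

/-- A potential on the circle of radius `a`: a smooth real symmetric `N × N` matrix function,
seen as a `2πa`-periodic function on the line. -/
structure Potential (a : ℝ) (N : ℕ) where
  toFun : ℝ → Matrix (Fin N) (Fin N) ℝ
  smooth : ContDiff ℝ ∞ toFun
  periodic : Function.Periodic toFun (2 * Real.pi * a)
  symm : ∀ x, (toFun x).IsSymm

instance (a : ℝ) (N : ℕ) : CoeFun (Potential a N) (fun _ => ℝ → Matrix (Fin N) (Fin N) ℝ) :=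
  ⟨Potential.toFun⟩

variable {a : ℝ} {N : ℕ}

/-- The operator `L = -D² + Q`. -/
def schrodinger (Q : Potential a N) (u : ℝ → Matrix (Fin N) (Fin N) ℝ) (x : ℝ) :
    Matrix (Fin N) (Fin N) ℝ :=
  -iteratedDeriv 2 u x + Q x * u x

/-! ### Heat kernel and heat kernel coefficients -/

/-- `U t x y` is the heat kernel of `L = -D² + Q` on the circle: it is smooth for `t > 0`, periodic
in both space variables, solves `(∂_t + L_x) U = 0`, and tends to the delta function as `t → 0+`. -/
structure IsHeatKernel (Q : Potential a N) (U : ℝ → ℝ → ℝ → Matrix (Fin N) (Fin N) ℝ) : Prop where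
  smooth : ContDiffOn ℝ ∞ (fun p : ℝ × ℝ × ℝ => U p.1 p.2.1 p.2.2) (Ioi 0 ×ˢ univ)
  periodic_left : ∀ t, 0 < t → ∀ y, Function.Periodic (fun x => U t x y) (2 * Real.pi * a)
  periodic_right : ∀ t, 0 < t → ∀ x, Function.Periodic (fun y => U t x y) (2 * Real.pi * a)
  heat_eq : ∀ t, 0 < t → ∀ x y,
    deriv (fun τ => U τ x y) t + schrodinger Q (fun ξ => U t ξ y) x = 0
  initial : ∀ f : ℝ → Fin N → ℝ, Continuous f → Function.Periodic f (2 * Real.pi * a) →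
    TendstoUniformly (fun t x => ∫ y in (0 : ℝ)..(2 * Real.pi * a), U t x y *ᵥ f y) f (𝓝[>] 0)

/-- The two-point heat kernel coefficients `a_k(x, y)`: `a_0 = 1` and, for `k ≥ 1`, `a_k(·, y)` is
the solution, regular at `x = y`, of `(1 + (1/k) (x - y) ∂_x) a_k = L a_{k-1}`, which is
`a_k(x, y) = k ∫_0^1 τ^(k-1) (L a_{k-1})(y + τ (x - y), y) dτ`. -/
def heatCoeff (Q : Potential a N) : ℕ → ℝ → ℝ → Matrix (Fin N) (Fin N) ℝ
  | 0 => fun _ _ => 1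
  | k + 1 => fun x y => ((k : ℝ) + 1) • ∫ τ in (0 : ℝ)..1,
      τ ^ k • schrodinger Q (fun ξ => heatCoeff Q k ξ y) (y + τ * (x - y))

/-- A matrix function on the circle depending on the potential. -/
abbrev FieldMap (a : ℝ) (N : ℕ) : Type := Potential a N → ℝ → Matrix (Fin N) (Fin N) ℝ

/-- The diagonal values `[a_k]`. -/
def heatDiag (k : ℕ) : FieldMap a N := fun Q x => heatCoeff Q k x x

/-- The global heat invariants `A_k = ∫ tr [a_k]`. -/
def heatInvariant (k : ℕ) (Q : Potential a N) : ℝ :=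
  ∫ x in (0 : ℝ)..(2 * Real.pi * a), (heatDiag k Q x).trace

/-- The rescaled invariants `I_k = (-1)^k (2k)! / (k! (k+1)!) A_{k+1}`. -/
def kdvInvariant (k : ℕ) (Q : Potential a N) : ℝ :=
  (-1) ^ k * ((Nat.factorial (2 * k) : ℝ) / (Nat.factorial k * Nat.factorial (k + 1))) *
    heatInvariant (k + 1) Q

/-! ### Variational derivatives -/

/-- A one-parameter family of potentials, depending smoothly on the parameter in the open set `S`
and on the point of the circle. -/
def IsSmoothFamily (S : Set ℝ) (γ : ℝ → Potential a N) : Prop :=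
  IsOpen S ∧ ContDiffOn ℝ ∞ (fun p : ℝ × ℝ => γ p.1 p.2) (S ×ˢ univ)

/-- `G` is the variational derivative of the functional `H` at `Q`: it is a smooth symmetric matrix
function on the circle, and `∂_s H(Q(s)) = ∫ tr (∂_s Q · G)` along every smooth family
through `Q`. There is at most one such `G`. -/
structure HasVarDeriv (H : Potential a N → ℝ) (Q : Potential a N)
    (G : ℝ → Matrix (Fin N) (Fin N) ℝ) : Prop where
  smooth : ContDiff ℝ ∞ G
  periodic : Function.Periodic G (2 * Real.pi * a)
  symm : ∀ x, (G x).IsSymm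
  hasDerivAt : ∀ (S : Set ℝ) (γ : ℝ → Potential a N), IsSmoothFamily S γ → ∀ s ∈ S, γ s = Q →
    HasDerivAt (fun σ => H (γ σ))
      (∫ x in (0 : ℝ)..(2 * Real.pi * a), (deriv (fun σ => γ σ x) s * G x).trace) s

open Classical in
/-- The variational derivative `δH/δQ`, as a function of `Q` (zero where it does not exist). -/
def varDeriv (H : Potential a N → ℝ) : FieldMap a N := fun Q =>
  if h : ∃ G, HasVarDeriv H Q G then h.choose else 0

/-! ### The operators `D` and `E` and the two brackets -/

/-- Differential polynomials without constant term in the matrix `Q`: sums of real multiples of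
non-empty products of derivatives of `Q`. -/
def diffPoly (a : ℝ) (N : ℕ) : NonUnitalSubalgebra ℝ (FieldMap a N) :=
  NonUnitalAlgebra.adjoin ℝ (Set.range fun j : ℕ => (fun Q x => iteratedDeriv j Q x : FieldMap a N))

/-- The potential itself as a differential polynomial. -/
def potentialField : FieldMap a N := fun Q x => Q x

/-- `D = ∂_x`. -/
def opD (g : FieldMap a N) : FieldMap a N := fun Q x => deriv (g Q) x

/-- Left multiplication by `Q`. -/
def opQ (g : FieldMap a N) : FieldMap a N := fun Q x => Q x * g Q x

/-- The commutator `Ad_Q`. -/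
def adQ (g : FieldMap a N) : FieldMap a N := fun Q x => Q x * g Q x - g Q x * Q x

open Classical in
/-- `D⁻¹`: the differential polynomial without constant term whose derivative is `g` (it is unique
if it exists; the value is zero if `g` is not such a derivative). -/
def opDinv (g : FieldMap a N) : FieldMap a N :=
  if h : ∃ W ∈ diffPoly a N, opD W = g then h.choose else 0

/-- `E = D³ - 2QD - 2DQ + Ad_Q D + D Ad_Q + Ad_Q D⁻¹ Ad_Q`. -/
def opE (g : FieldMap a N) : FieldMap a N :=
  opD (opD (opD g)) - (2 : ℝ) • opQ (opD g) - (2 : ℝ) • opD (opQ g)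
    + adQ (opD g) + opD (adQ g) + adQ (opDinv (adQ g))

/-- `{H, G}_D = ∫ tr (δH/δQ) D (δG/δQ)`. -/
def bracketD (H G : Potential a N → ℝ) (Q : Potential a N) : ℝ :=
  ∫ x in (0 : ℝ)..(2 * Real.pi * a), (varDeriv H Q x * opD (varDeriv G) Q x).trace

/-- `{H, G}_E = ∫ tr (δH/δQ) E (δG/δQ)`. -/
def bracketE (H G : Potential a N → ℝ) (Q : Potential a N) : ℝ :=
  ∫ x in (0 : ℝ)..(2 * Real.pi * a), (varDeriv H Q x * opE (varDeriv G) Q x).trace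

/-- `γ` solves the `k`-th equation `∂_s Q = D δI_k/δQ` of the hierarchy for `s ∈ S`. -/
def IsKdVFlow (k : ℕ) (S : Set ℝ) (γ : ℝ → Potential a N) : Prop :=
  IsSmoothFamily S γ ∧
    ∀ s ∈ S, ∀ x, deriv (fun σ => γ σ x) s = opD (varDeriv (kdvInvariant k)) (γ s) x

end

end HeatKdV

/-! The algebraic claims all come from the normalised coefficients b_k = a_k/k!. Write d = ∂_x, D =
∂_x + ∂_y and z = x - y. The recursion reads (k+1) b_{k+1} + z d b_{k+1} = (-d² + Q(x)) b_k. The b_k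
also satisfy the adjoint equations in y (`normCoeff_adjoint`): the defect of those equations solves
the same transport equations, whose regular homogeneous solutions vanish. On the diagonal, put γ_k =
[b_k] and let φ_k be the diagonal value of (∂_x - ∂_y) b_k. The two families of equations then give
Dφ_k = [Q, γ_k] (`dOne_skewDiag`) and (2k+1) Dγ_{k+1} = -(1/2)(D³γ_k - ... + [Q, φ_k])
(`dOne_diag_succ`). Thus φ_k is D⁻¹ Ad_Q γ_k and the second relation is the recursion by E, up to
factors absorbed in I_k. D⁻¹ is unambiguous because a local field with zero derivative that vanishes
at Q = 0 is zero: cut the potential off to join its value at Q to its value at 0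
(`eq_zero_of_regD_eq_zero`).

The formula for δA_k/δQ is obtained without spectral theory. Suitably rescaled, γ_k and φ_k are
entries of a power series n of 2 × 2 matrices, formally the resolvent of L on the diagonal. It
satisfies the Lax equation X Dn = [v, n] (`X_mul_psMap_resolvent`), and n² = 1/4 because n² - 1/4
solves the same linear equation and vanishes at Q = 0 (`resolvent_sq`). These two identities alone
imply that tr(θv Sn) - tr(Sv θn) - tr(v Sn) is a total derivative for any variation S and the Euler
operator θ = X d/dX (`trace_variation`). Read coefficientwise, this says tr ∂_sγ_{k+1} = tr(∂_sQ
γ_k) + Dw (`trace_deriv_diag`), and integration over the circle gives the variational derivative.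

Involution is the Lenard–Magri argument. D and E are skew under the integrated trace and D δI_{k+1}
= E δI_k, so indices can be moved from one argument of the bracket to the other until δI_0 = 1 is
reached, which D kills (`circleTrace_kdvField_shift`, `circleTrace_kdvField`). Conservation along
the flows is the vanishing of the D-bracket.

The heat expansion compares an arbitrary heat kernel with a parametrix: Gaussian times cutoff times
the truncated series, with defect O(τ^K). The kernel is smeared in y against a nonnegative φ, giving
a solution u with initial value φ. Its L¹ norm is at most a constant times ∫φ, by a Kato type
inequality (`integral_sqrt_le`). Duhamel's formula bounds the difference of u and the smeared
parametrix by C t^{K+1} ∫φ (`norm_sub_integral_parametrix_le`), and letting φ concentrate gives the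
pointwise bound (`norm_le_of_integral_le`). -/

namespace HeatKdV

noncomputable section

/-! ### Integrals depending on parameters -/

section Parametric

variable {H : Type} [NormedAddCommGroup H] [NormedSpace ℝ H] [ProperSpace H]
variable {V : Type} [NormedAddCommGroup V] [NormedSpace ℝ V]

/-- In a proper space the derivative is bounded on a closed ball times the interval, so a constant
dominates. The parameter set `O` is a general open set because later uses have times restricted to
an open half line or interval. -/
theorem hasFDerivAt_intervalIntegral_param {F : H → ℝ → V} {F' : H → ℝ → H →L[ℝ] V} {O : Set H}
    (hO : IsOpen O) {p₀ : H} (hp₀ : p₀ ∈ O) (α β : ℝ)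
    (hF : ∀ p ∈ O, Continuous (F p))
    (hF' : ContinuousOn (fun q : H × ℝ => F' q.1 q.2) (O ×ˢ univ))
    (hd : ∀ p ∈ O, ∀ τ, HasFDerivAt (fun p => F p τ) (F' p τ) p) :
    HasFDerivAt (fun p => ∫ τ in α..β, F p τ) (∫ τ in α..β, F' p₀ τ) p₀ := by
  obtain ⟨r, hr, hball⟩ := Metric.nhds_basis_closedBall.mem_iff.1 (hO.mem_nhds hp₀)
  have hK : IsCompact (Metric.closedBall p₀ r ×ˢ uIcc α β) :=
    (isCompact_closedBall p₀ r).prod isCompact_uIcc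
  obtain ⟨C, hC⟩ := hK.exists_bound_of_continuousOn
    (hF'.mono (prod_mono hball (subset_univ _)))
  have hc : Continuous (F' p₀) := by
    refine continuous_iff_continuousAt.2 fun τ => ?_
    have h1 : ContinuousAt (fun q : H × ℝ => F' q.1 q.2) (p₀, τ) :=
      hF'.continuousAt ((hO.prod isOpen_univ).mem_nhds ⟨hp₀, mem_univ _⟩)
    exact ContinuousAt.comp (f := fun τ : ℝ => (p₀, τ)) h1 (by fun_prop)
  refine intervalIntegral.hasFDerivAt_integral_of_dominated_of_fderiv_le
    (s := Metric.closedBall p₀ r) (bound := fun _ => C)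
    (Metric.closedBall_mem_nhds _ hr) ?_ ((hF p₀ hp₀).intervalIntegrable _ _)
    hc.aestronglyMeasurable ?_ (by simp) ?_
  · filter_upwards [Metric.closedBall_mem_nhds p₀ hr] with p hp
    exact (hF p (hball hp)).aestronglyMeasurable
  · exact Eventually.of_forall fun τ hτ p hp => hC (p, τ) ⟨hp, uIoc_subset_uIcc hτ⟩
  · exact Eventually.of_forall fun τ _ p hp => hd p (hball hp) τ

theorem hasDerivAt_intervalIntegral_param {F F' : ℝ → ℝ → V} {O : Set ℝ}
    (hO : IsOpen O) {x₀ : ℝ} (hx₀ : x₀ ∈ O) (α β : ℝ)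
    (hF : ∀ x ∈ O, Continuous (F x))
    (hF' : ContinuousOn (fun q : ℝ × ℝ => F' q.1 q.2) (O ×ˢ univ))
    (hd : ∀ x ∈ O, ∀ τ, HasDerivAt (fun x => F x τ) (F' x τ) x) :
    HasDerivAt (fun x => ∫ τ in α..β, F x τ) (∫ τ in α..β, F' x₀ τ) x₀ := by
  have hL : Continuous fun v : V => ContinuousLinearMap.toSpanSingleton ℝ v := by
    have h := (ContinuousLinearMap.smulRightL ℝ ℝ V (1 : ℝ →L[ℝ] ℝ)).continuous
    refine h.congr fun v => ?_
    ext
    simp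
  have h := hasFDerivAt_intervalIntegral_param
    (F' := fun x τ => ContinuousLinearMap.toSpanSingleton ℝ (F' x τ))
    hO hx₀ α β hF (hL.comp_continuousOn hF') (fun x hx τ => (hd x hx τ).hasFDerivAt)
  have h2 := h.hasDerivAt
  rw [ContinuousLinearMap.intervalIntegral_apply] at h2
  · simpa using h2
  · refine Continuous.intervalIntegrable (hL.comp ?_) _ _
    refine continuous_iff_continuousAt.2 fun τ => ?_
    have h1 : ContinuousAt (fun q : ℝ × ℝ => F' q.1 q.2) (x₀, τ) :=
      hF'.continuousAt ((hO.prod isOpen_univ).mem_nhds ⟨hx₀, mem_univ _⟩)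
    exact ContinuousAt.comp (f := fun τ : ℝ => (x₀, τ)) h1 (by fun_prop)

theorem contDiff_intervalIntegral_param {F : H × ℝ → V} (hF : ContDiff ℝ ∞ F) (α β : ℝ) :
    ContDiff ℝ ∞ (fun p : H => ∫ τ in α..β, F (p, τ)) := by
  -- The derivative is again a parametric integral, but with values in a space of linear maps; the
  -- induction on the order must therefore vary `V`.
  have key : ∀ (n : ℕ) (V : Type) [NormedAddCommGroup V] [NormedSpace ℝ V] (F : H × ℝ → V),
      ContDiff ℝ ∞ F → ContDiff ℝ n (fun p : H => ∫ τ in α..β, F (p, τ)) := by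
    intro n
    induction n with
    | zero =>
      intro V _ _ F hF
      refine contDiff_zero.2 ?_
      exact intervalIntegral.continuous_parametric_intervalIntegral_of_continuous'
        (f := fun p τ => F (p, τ)) (by exact hF.continuous) α β
    | succ n ih =>
      intro V _ _ F hF
      have hF' : ContDiff ℝ ∞ (fun q : H × ℝ =>
          (fderiv ℝ F q).comp (ContinuousLinearMap.inl ℝ H ℝ)) :=
        (hF.fderiv_right (by simp)).clm_comp contDiff_const
      have hd : ∀ p, HasFDerivAt (fun p : H => ∫ τ in α..β, F (p, τ))
          (∫ τ in α..β, (fderiv ℝ F (p, τ)).comp (ContinuousLinearMap.inl ℝ H ℝ)) p := by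
        intro p
        refine hasFDerivAt_intervalIntegral_param (F := fun p τ => F (p, τ))
          (F' := fun p τ => (fderiv ℝ F (p, τ)).comp (ContinuousLinearMap.inl ℝ H ℝ))
          isOpen_univ (mem_univ p) α β (fun p _ => hF.continuous.comp (by fun_prop))
          hF'.continuous.continuousOn (fun p _ τ => ?_)
        have h1 : HasFDerivAt F (fderiv ℝ F (p, τ)) (p, τ) :=
          (hF.differentiable (by simp) _).hasFDerivAt
        exact h1.comp p (hasFDerivAt_prodMk_left p τ)
      rw [Nat.cast_succ, contDiff_succ_iff_fderiv]
      refine ⟨fun p => (hd p).differentiableAt, by simp, ?_⟩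
      rw [show fderiv ℝ (fun p : H => ∫ τ in α..β, F (p, τ)) = fun p =>
        ∫ τ in α..β, (fderiv ℝ F (p, τ)).comp (ContinuousLinearMap.inl ℝ H ℝ) from
          funext fun p => (hd p).fderiv]
      exact ih _ _ hF'
  exact contDiff_infty.2 fun n => key n V F hF

end Parametric

end

noncomputable section

/-! ### Algebras of smooth functions with values in a normed algebra -/

section SmoothAlg

variable (H : Type) [NormedAddCommGroup H] [NormedSpace ℝ H]
  (𝔸 : Type) [NormedRing 𝔸] [NormedAlgebra ℝ 𝔸]

/-- The algebra of smooth functions with values in a normed algebra on `H`. -/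
def smoothAlg : Subalgebra ℝ (H → 𝔸) where
  carrier := {f | ContDiff ℝ ∞ f}
  mul_mem' {f g} hf hg := by
    have hf' : ContDiff ℝ ∞ f := hf
    exact hf'.mul hg
  add_mem' {f g} hf hg := by
    have hf' : ContDiff ℝ ∞ f := hf
    exact hf'.add hg
  algebraMap_mem' r := by
    change ContDiff ℝ ∞ fun _ : H => algebraMap ℝ 𝔸 r
    exact contDiff_const

variable {H 𝔸}

theorem smoothAlg_contDiff (f : smoothAlg H 𝔸) : ContDiff ℝ ∞ f.1 := f.2

theorem smoothAlg_hasFDerivAt (f : smoothAlg H 𝔸) (p : H) :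
    HasFDerivAt f.1 (fderiv ℝ f.1 p) p :=
  ((smoothAlg_contDiff f).differentiable (by simp) p).hasFDerivAt

/-- The directional derivative, as an additive operator on smooth functions with values in a normed algebra. -/
def dirDeriv (v : H) : smoothAlg H 𝔸 →ₗ[ℝ] smoothAlg H 𝔸 where
  toFun f := ⟨fun p => fderiv ℝ f.1 p v,
    ((smoothAlg_contDiff f).fderiv_right (m := ∞) (by simp)).clm_apply contDiff_const⟩
  map_add' f g := Subtype.ext <| funext fun p => by
    change fderiv ℝ (f.1 + g.1) p v = fderiv ℝ f.1 p v + fderiv ℝ g.1 p v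
    rw [((smoothAlg_hasFDerivAt f p).add (smoothAlg_hasFDerivAt g p)).fderiv]
    rfl
  map_smul' c f := Subtype.ext <| funext fun p => by
    change fderiv ℝ (c • f.1) p v = c • fderiv ℝ f.1 p v
    rw [((smoothAlg_hasFDerivAt f p).const_smul c).fderiv]
    rfl

theorem dirDeriv_apply (v : H) (f : smoothAlg H 𝔸) (p : H) :
    (dirDeriv v f).1 p = fderiv ℝ f.1 p v := rfl

theorem dirDeriv_mul (v : H) (f g : smoothAlg H 𝔸) :
    dirDeriv v (f * g) = dirDeriv v f * g + f * dirDeriv v g :=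
  Subtype.ext <| funext fun p => by
    change fderiv ℝ (f.1 * g.1) p v = fderiv ℝ f.1 p v * g.1 p + f.1 p * fderiv ℝ g.1 p v
    rw [((smoothAlg_hasFDerivAt f p).mul' (smoothAlg_hasFDerivAt g p)).fderiv]
    simp [add_comm]

theorem dirDeriv_comm (v w : H) (f : smoothAlg H 𝔸) :
    dirDeriv v (dirDeriv w f) = dirDeriv w (dirDeriv v f) :=
  Subtype.ext <| funext fun p => by
    have hd : DifferentiableAt ℝ (fderiv ℝ f.1) p :=
      ((smoothAlg_contDiff f).fderiv_right (m := ∞) (by simp)).differentiable (by simp) p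
    have h : ∀ w u : H, fderiv ℝ (fun p => fderiv ℝ f.1 p w) p u
        = fderiv ℝ (fderiv ℝ f.1) p u w := by
      intro w u
      rw [(hd.hasFDerivAt.clm_apply (hasFDerivAt_const w p)).fderiv]
      simp
    change fderiv ℝ (fun p => fderiv ℝ f.1 p w) p v = fderiv ℝ (fun p => fderiv ℝ f.1 p v) p w
    rw [h, h]
    exact ((smoothAlg_contDiff f).contDiffAt.isSymmSndFDerivAt
      (by
        rw [minSmoothness_of_isRCLikeNormedField]
        exact WithTop.coe_le_coe.2 le_top)) v w

theorem smoothAlg_hasDerivAt_comp (f : smoothAlg H 𝔸) {c : ℝ → H} {c' : H} {s : ℝ}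
    (hc : HasDerivAt c c' s) :
    HasDerivAt (fun s => f.1 (c s)) ((dirDeriv c' f).1 (c s)) s :=
  (smoothAlg_hasFDerivAt f (c s)).comp_hasDerivAt s hc

end SmoothAlg

variable {𝔸 : Type} [NormedRing 𝔸] [NormedAlgebra ℝ 𝔸]

theorem hasDerivAt_slice_fst (f : smoothAlg (ℝ × ℝ) 𝔸) (x y : ℝ) :
    HasDerivAt (fun ξ => f.1 (ξ, y)) ((dirDeriv (1, 0) f).1 (x, y)) x :=
  smoothAlg_hasDerivAt_comp f ((hasDerivAt_id x).prodMk (hasDerivAt_const x y))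

theorem hasDerivAt_slice_snd (f : smoothAlg (ℝ × ℝ) 𝔸) (x y : ℝ) :
    HasDerivAt (fun η => f.1 (x, η)) ((dirDeriv (0, 1) f).1 (x, y)) y :=
  smoothAlg_hasDerivAt_comp f ((hasDerivAt_const y x).prodMk (hasDerivAt_id y))

theorem iteratedDeriv_slice_fst (f : smoothAlg (ℝ × ℝ) 𝔸) (j : ℕ) (x y : ℝ) :
    iteratedDeriv j (fun ξ => f.1 (ξ, y)) x = ((dirDeriv (1, 0))^[j] f).1 (x, y) := by
  induction j generalizing f with
  | zero => simp
  | succ j ih =>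
    rw [iteratedDeriv_succ', Function.iterate_succ_apply, ← ih]
    congr 1
    exact funext fun ξ => (hasDerivAt_slice_fst f ξ y).deriv

/-- A smooth function of one variable, as a function of the first of two variables. -/
def pullFst (q : smoothAlg ℝ 𝔸) : smoothAlg (ℝ × ℝ) 𝔸 :=
  ⟨fun p => q.1 p.1, (smoothAlg_contDiff q).comp contDiff_fst⟩

/-- A smooth function of one variable, as a function of the second of two variables. -/
def pullSnd (q : smoothAlg ℝ 𝔸) : smoothAlg (ℝ × ℝ) 𝔸 :=
  ⟨fun p => q.1 p.2, (smoothAlg_contDiff q).comp contDiff_snd⟩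

/-! ### Two-point heat kernel coefficients and their transport equation -/

/-- The heat kernel coefficients of `-D² + q`, for `q` with values in a normed algebra. -/
def coeffGen (q : ℝ → 𝔸) : ℕ → ℝ → ℝ → 𝔸
  | 0 => fun _ _ => 1
  | k + 1 => fun x y => ((k : ℝ) + 1) • ∫ τ in (0 : ℝ)..1,
      τ ^ k • (fun z => -iteratedDeriv 2 (fun ξ => coeffGen q k ξ y) z + q z * coeffGen q k z y)
        (y + τ * (x - y))

/-- The operator `-∂_x² + q(x)` on smooth functions of two variables. -/
def schrodingerFst (q : smoothAlg ℝ 𝔸) (f : smoothAlg (ℝ × ℝ) 𝔸) : smoothAlg (ℝ × ℝ) 𝔸 :=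
  -dirDeriv (1, 0) (dirDeriv (1, 0) f) + pullFst q * f

theorem schrodinger_slice (q : smoothAlg ℝ 𝔸) (f : smoothAlg (ℝ × ℝ) 𝔸) (x y : ℝ) :
    -iteratedDeriv 2 (fun ξ => f.1 (ξ, y)) x + q.1 x * f.1 (x, y)
      = (schrodingerFst q f).1 (x, y) := by
  rw [iteratedDeriv_slice_fst]
  rfl

theorem coeffGen_contDiff (q : smoothAlg ℝ 𝔸) (k : ℕ) :
    ContDiff ℝ ∞ (fun p : ℝ × ℝ => coeffGen q.1 k p.1 p.2) := by
  induction k with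
  | zero => exact contDiff_const
  | succ k ih =>
    set f : smoothAlg (ℝ × ℝ) 𝔸 := ⟨fun p => coeffGen q.1 k p.1 p.2, ih⟩ with hf
    have h : ContDiff ℝ ∞ (fun r : (ℝ × ℝ) × ℝ =>
        r.2 ^ k • (schrodingerFst q f).1 (r.1.2 + r.2 * (r.1.1 - r.1.2), r.1.2)) := by
      have h1 : ContDiff ℝ ∞ fun r : (ℝ × ℝ) × ℝ => r.2 ^ k := by fun_prop
      have h2 : ContDiff ℝ ∞ fun r : (ℝ × ℝ) × ℝ =>
          (r.1.2 + r.2 * (r.1.1 - r.1.2), r.1.2) := by fun_prop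
      exact h1.smul ((smoothAlg_contDiff (schrodingerFst q f)).comp h2)
    refine (congrArg (ContDiff ℝ ∞) (funext fun p => ?_)).mpr
      ((contDiff_intervalIntegral_param h 0 1).const_smul ((k : ℝ) + 1))
    simp only [coeffGen]
    congr 1
    refine intervalIntegral.integral_congr fun τ _ => ?_
    simp only [← schrodinger_slice, hf]

/-- The heat kernel coefficients, as smooth functions of two variables. -/
def heatEl (q : smoothAlg ℝ 𝔸) (k : ℕ) : smoothAlg (ℝ × ℝ) 𝔸 :=
  ⟨fun p => coeffGen q.1 k p.1 p.2, coeffGen_contDiff q k⟩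

theorem coeffGen_succ (q : smoothAlg ℝ 𝔸) (k : ℕ) (x y : ℝ) :
    coeffGen q.1 (k + 1) x y = ((k : ℝ) + 1) • ∫ τ in (0 : ℝ)..1,
      τ ^ k • (schrodingerFst q (heatEl q k)).1 (y + τ * (x - y), y) := by
  simp only [coeffGen, ← schrodinger_slice]
  rfl

/-- Differentiating under the integral brings down a factor τ, and (k+1) τ^k g + (x-y) τ^{k+1} ∂_x g
is the τ-derivative of τ^{k+1} g along the segment from y to x. The fundamental theorem of calculus
leaves the value at τ = 1. -/
theorem coeffGen_transport [CompleteSpace 𝔸] (q : smoothAlg ℝ 𝔸) (k : ℕ) (x y : ℝ) :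
    coeffGen q.1 (k + 1) x y
          + ((x - y) / ((k : ℝ) + 1)) • deriv (fun ξ => coeffGen q.1 (k + 1) ξ y) x
        = (schrodingerFst q (heatEl q k)).1 (x, y) := by
  set g := schrodingerFst q (heatEl q k) with hg
  set g' := dirDeriv (1, 0) g with hg'
  have hk : ((k : ℝ) + 1) ≠ 0 := by positivity
  have hgc : Continuous g.1 := (smoothAlg_contDiff g).continuous
  have hgc' : Continuous g'.1 := (smoothAlg_contDiff g').continuous
  have hder : HasDerivAt (fun ξ => coeffGen q.1 (k + 1) ξ y)
      (((k : ℝ) + 1) • ∫ τ in (0 : ℝ)..1, τ ^ k • τ • g'.1 (y + τ * (x - y), y)) x := by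
    simp only [coeffGen_succ, ← hg]
    refine HasDerivAt.fun_const_smul _ (
      hasDerivAt_intervalIntegral_param
      (F := fun x τ => τ ^ k • g.1 (y + τ * (x - y), y))
      (F' := fun x τ => τ ^ k • τ • g'.1 (y + τ * (x - y), y))
      isOpen_univ (mem_univ x) 0 1 (fun x _ => by fun_prop) (by fun_prop) fun x _ τ => ?_)
    refine HasDerivAt.fun_const_smul _ ?_
    have h1 := hasDerivAt_slice_fst g (y + τ * (x - y)) y
    have h2 : HasDerivAt (fun x => y + τ * (x - y)) τ x := by
      simpa using (((hasDerivAt_id x).sub_const y).const_mul τ).const_add y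
    exact HasDerivAt.scomp x h1 h2
  have hftc : ∫ τ in (0 : ℝ)..1, (((k : ℝ) + 1) • τ ^ k • g.1 (y + τ * (x - y), y)
      + (x - y) • τ ^ k • τ • g'.1 (y + τ * (x - y), y)) = g.1 (x, y) := by
    have hd : ∀ τ ∈ uIcc (0 : ℝ) 1, HasDerivAt
        (fun τ : ℝ => τ ^ (k + 1) • g.1 (y + τ * (x - y), y))
        (((k : ℝ) + 1) • τ ^ k • g.1 (y + τ * (x - y), y)
          + (x - y) • τ ^ k • τ • g'.1 (y + τ * (x - y), y)) τ := by
      intro τ _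
      have h1 := hasDerivAt_slice_fst g (y + τ * (x - y)) y
      have h2 : HasDerivAt (fun τ => y + τ * (x - y)) (x - y) τ := by
        simpa using ((hasDerivAt_id τ).mul_const (x - y)).const_add y
      have h3 := (hasDerivAt_pow (k + 1) τ).smul (HasDerivAt.scomp τ h1 h2)
      refine h3.congr_deriv ?_
      simp only [Function.comp_apply, add_tsub_cancel_right, ← hg']
      rw [add_comm, smul_smul, smul_smul, smul_smul, smul_smul]
      congr 2
      · push_cast; ring
      · ring
    rw [intervalIntegral.integral_eq_sub_of_hasDerivAt hd
      (Continuous.intervalIntegrable (by fun_prop) _ _)]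
    simp
  rw [hder.deriv, coeffGen_succ, ← hg, smul_smul, div_mul_cancel₀ _ hk,
    ← intervalIntegral.integral_smul, ← intervalIntegral.integral_smul,
    ← intervalIntegral.integral_add (Continuous.intervalIntegrable (by fun_prop) _ _)
      (Continuous.intervalIntegrable (by fun_prop) _ _), hftc]

end

noncomputable section

/-! ### The adjoint equation for the heat kernel coefficients -/

/-- If `b` solves the transport equations `(k + 1 + z d) b (k + 1) = (-d² + q) b k`, then the defects
`e k` of the equations for the adjoint operator solve the same transport equations. -/
theorem adjoint_defect_transport {R : Type*} [Ring R] [Algebra ℝ R] (D d : R →ₗ[ℝ] R)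
    (hD : ∀ f g, D (f * g) = D f * g + f * D g) (hd : ∀ f g, d (f * g) = d f * g + f * d g)
    (hDd : ∀ f, d (D f) = D (d f)) (z q r : R) (hz : ∀ f, f * z = z * f)
    (hdz : d z = 1) (hDz : D z = 0) (hq : D q = d q) (hr : d r = 0) (b e : ℕ → R)
    (hb : ∀ k : ℕ, ((k : ℝ) + 1) • b (k + 1) + z * d (b (k + 1)) = -d (d (b k)) + q * b k)
    (he : ∀ k, e k = D (D (b k)) - (2 : ℝ) • D (d (b k)) + q * b k - b k * r
      - z * D (b (k + 1))) (k : ℕ) :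
    ((k : ℝ) + 1) • e (k + 1) + z * d (e (k + 1)) = -d (d (e k)) + q * e k := by
  have hq2 : D (d q) = d (d q) := by rw [← hDd, hq]
  have hz' : ∀ f g, f * (z * g) = z * (f * g) := fun f g => by rw [← mul_assoc, hz, mul_assoc]
  have h0 := hb k
  have h1 := congrArg (fun f => D (D f)) (hb k)
  have h2 := congrArg (fun f => D (d f)) (hb k)
  have h3 := congrArg (fun f => q * f) (hb k)
  have h4 := congrArg (fun f => f * r) (hb k)
  have h5 := congrArg (fun f => z * D f) (hb (k + 1))
  rw [he, he]
  simp only [map_add, map_sub, map_neg, map_smul, hD, hd, hDd, hdz, hDz, hq, hr, hq2,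
    mul_add, mul_sub, add_mul, mul_neg, neg_mul, smul_mul_assoc, mul_smul_comm, mul_assoc,
    zero_mul, mul_zero, one_mul, add_zero, zero_add, hz'] at h1 h2 h3 h4 h5 ⊢
  push_cast at h5 ⊢
  -- The operator D² - 2Dd + q· - ·r is applied to the k-th equation and z D to the next one, as in
  -- the definition of the defect. The cross terms from differentiating the product with q are
  -- exactly those of -d²(q b).
  linear_combination (norm := module) h1 - (2 : ℝ) • h2 + h3 - h4 - h5

/-- A smooth solution of `(c + (x - y) ∂_x) u = 0` with `c ≠ 0`, or `c = 0` and vanishing at `x = y`,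
is zero. -/
theorem eq_zero_of_transport {V : Type} [NormedAddCommGroup V] [NormedSpace ℝ V] (k : ℕ) (y : ℝ)
    {u u' : ℝ → V} (hu : ∀ x, HasDerivAt u (u' x) x) (hc : Continuous u')
    (h : ∀ x, (k : ℝ) • u x + (x - y) • u' x = 0) (hy : k = 0 → u y = 0) (x : ℝ) : u x = 0 := by
  rcases Nat.eq_zero_or_pos k with rfl | hk
  · have h1 : u' = 0 := by
      refine Continuous.ext_on (dense_compl_singleton y) hc continuous_const fun x hx => ?_
      have h2 : (x - y) • u' x = 0 := by simpa using h x
      exact (smul_eq_zero.1 h2).resolve_left (sub_ne_zero.2 hx)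
    have h3 := is_const_of_deriv_eq_zero (f := u) (fun x => (hu x).differentiableAt)
      (fun x => by rw [(hu x).deriv, h1]; rfl) x y
    rw [h3, hy rfl]
  · obtain ⟨m, rfl⟩ := Nat.exists_eq_succ_of_ne_zero hk.ne'
    -- The equation says that (x-y)^c u is constant, and this product vanishes at y since c ≥ 1.
    have hw : ∀ x, HasDerivAt (fun x => (x - y) ^ (m + 1) • u x) 0 x := by
      intro x
      have h1 : HasDerivAt (fun x => (x - y) ^ (m + 1)) (((m : ℝ) + 1) * (x - y) ^ m) x := by
        simpa using ((hasDerivAt_id x).sub_const y).fun_pow (m + 1)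
      refine (h1.smul (hu x)).congr_deriv ?_
      have h2 := congrArg (fun v => (x - y) ^ m • v) (h x)
      simp only [smul_add, smul_zero] at h2
      rw [← h2]
      push_cast
      module
    have h3 := is_const_of_deriv_eq_zero (f := fun x => (x - y) ^ (m + 1) • u x)
      (fun x => (hw x).differentiableAt) (fun x => (hw x).deriv) x y
    by_cases hxy : x = y
    · have h4 := h x
      rw [hxy, sub_self, zero_smul, add_zero] at h4
      rw [hxy]
      exact (smul_eq_zero.1 h4).resolve_left (by positivity)
    · have h4 : (x - y) ^ (m + 1) • u x = 0 := by simpa using h3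
      exact (smul_eq_zero.1 h4).resolve_left (pow_ne_zero _ (sub_ne_zero.2 hxy))

variable {𝔸 : Type} [NormedRing 𝔸] [NormedAlgebra ℝ 𝔸]

/-- The function `x - y`. -/
def diffEl : smoothAlg (ℝ × ℝ) 𝔸 :=
  ⟨fun p => algebraMap ℝ 𝔸 (p.1 - p.2), by
    change ContDiff ℝ ∞ fun p : ℝ × ℝ => algebraMap ℝ 𝔸 (p.1 - p.2)
    simp only [Algebra.algebraMap_eq_smul_one]
    fun_prop⟩

theorem diffEl_mul_apply (f : smoothAlg (ℝ × ℝ) 𝔸) (p : ℝ × ℝ) :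
    (diffEl * f).1 p = (p.1 - p.2) • f.1 p :=
  (Algebra.smul_def (p.1 - p.2) (f.1 p)).symm

theorem mul_diffEl (f : smoothAlg (ℝ × ℝ) 𝔸) : f * diffEl = diffEl * f :=
  Subtype.ext <| funext fun p => (Algebra.commutes (p.1 - p.2) (f.1 p)).symm

theorem fderiv_diffEl (p v : ℝ × ℝ) :
    (dirDeriv v (diffEl : smoothAlg (ℝ × ℝ) 𝔸)).1 p = (v.1 - v.2) • (1 : 𝔸) := by
  have h : HasFDerivAt (fun p : ℝ × ℝ => (p.1 - p.2) • (1 : 𝔸))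
      ((ContinuousLinearMap.fst ℝ ℝ ℝ - ContinuousLinearMap.snd ℝ ℝ ℝ).smulRight (1 : 𝔸)) p :=
    (hasFDerivAt_fst.sub hasFDerivAt_snd).smul_const (1 : 𝔸)
  have h1 : (diffEl : smoothAlg (ℝ × ℝ) 𝔸).1 = fun p : ℝ × ℝ => (p.1 - p.2) • (1 : 𝔸) :=
    funext fun p => Algebra.algebraMap_eq_smul_one _
  rw [dirDeriv_apply, h1, h.fderiv]
  simp

/-- The derivative `∂_x` in two variables. -/
abbrev dX : smoothAlg (ℝ × ℝ) 𝔸 →ₗ[ℝ] smoothAlg (ℝ × ℝ) 𝔸 := dirDeriv (1, 0)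

/-- The derivative `∂_x + ∂_y` in two variables. -/
abbrev dDiag : smoothAlg (ℝ × ℝ) 𝔸 →ₗ[ℝ] smoothAlg (ℝ × ℝ) 𝔸 := dirDeriv (1, 1)

/-- The derivative of a smooth function of one variable. -/
abbrev dOne : smoothAlg ℝ 𝔸 →ₗ[ℝ] smoothAlg ℝ 𝔸 := dirDeriv 1

theorem smoothAlg_hasDerivAt (f : smoothAlg ℝ 𝔸) (x : ℝ) :
    HasDerivAt f.1 ((dOne f).1 x) x :=
  smoothAlg_hasDerivAt_comp f (hasDerivAt_id x)

theorem dX_diffEl : dX (diffEl : smoothAlg (ℝ × ℝ) 𝔸) = 1 :=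
  Subtype.ext <| funext fun p => by rw [fderiv_diffEl]; simp

theorem dDiag_diffEl : dDiag (diffEl : smoothAlg (ℝ × ℝ) 𝔸) = 0 :=
  Subtype.ext <| funext fun p => by rw [fderiv_diffEl]; simp

theorem dirDeriv_pullFst (q : smoothAlg ℝ 𝔸) (v : ℝ × ℝ) :
    dirDeriv v (pullFst q) = v.1 • pullFst (dOne q) :=
  Subtype.ext <| funext fun p => by
    have h : HasFDerivAt (fun p : ℝ × ℝ => q.1 p.1) _ p :=
      (smoothAlg_hasFDerivAt q p.1).comp p hasFDerivAt_fst
    change fderiv ℝ (fun p : ℝ × ℝ => q.1 p.1) p v = v.1 • fderiv ℝ q.1 p.1 1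
    rw [h.fderiv, ← map_smul]
    simp

theorem dirDeriv_pullSnd (q : smoothAlg ℝ 𝔸) (v : ℝ × ℝ) :
    dirDeriv v (pullSnd q) = v.2 • pullSnd (dOne q) :=
  Subtype.ext <| funext fun p => by
    have h : HasFDerivAt (fun p : ℝ × ℝ => q.1 p.2) _ p :=
      (smoothAlg_hasFDerivAt q p.2).comp p hasFDerivAt_snd
    change fderiv ℝ (fun p : ℝ × ℝ => q.1 p.2) p v = v.2 • fderiv ℝ q.1 p.2 1
    rw [h.fderiv, ← map_smul]
    simp

/-- The normalised heat kernel coefficients `a_k / k!`. -/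
def normCoeff (q : smoothAlg ℝ 𝔸) (k : ℕ) : smoothAlg (ℝ × ℝ) 𝔸 :=
  ((Nat.factorial k : ℝ)⁻¹) • heatEl q k

theorem normCoeff_zero (q : smoothAlg ℝ 𝔸) : normCoeff q 0 = 1 := by
  simp only [normCoeff, Nat.factorial_zero, Nat.cast_one, inv_one, one_smul]
  rfl

/-- Division by k! removes the denominator from the recursion, leaving an identity in the algebra of
smooth functions that can be differentiated formally. -/
theorem normCoeff_transport [CompleteSpace 𝔸] (q : smoothAlg ℝ 𝔸) (k : ℕ) :
    ((k : ℝ) + 1) • normCoeff q (k + 1) + diffEl * dX (normCoeff q (k + 1))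
      = -dX (dX (normCoeff q k)) + pullFst q * normCoeff q k := by
  have hk : ((k : ℝ) + 1) ≠ 0 := by positivity
  have h : heatEl q (k + 1) + ((k : ℝ) + 1)⁻¹ • (diffEl * dX (heatEl q (k + 1)))
      = -dX (dX (heatEl q k)) + pullFst q * heatEl q k := by
    refine Subtype.ext <| funext fun p => ?_
    refine Eq.trans ?_ (coeffGen_transport q k p.1 p.2)
    change (heatEl q (k + 1)).1 p + ((k : ℝ) + 1)⁻¹ • (diffEl * dX (heatEl q (k + 1))).1 p = _
    rw [diffEl_mul_apply, smul_smul, div_eq_inv_mul,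
      show deriv (fun ξ => coeffGen q.1 (k + 1) ξ p.2) p.1 = (dX (heatEl q (k + 1))).1 p from
        (hasDerivAt_slice_fst (heatEl q (k + 1)) p.1 p.2).deriv]
    rfl
  have hf : (Nat.factorial (k + 1) : ℝ)⁻¹ = (Nat.factorial k : ℝ)⁻¹ * ((k : ℝ) + 1)⁻¹ := by
    rw [Nat.factorial_succ]; push_cast; rw [mul_inv, mul_comm]
  have h2 := congrArg (fun f => (Nat.factorial k : ℝ)⁻¹ • f) h
  simp only [normCoeff, map_smul, mul_smul_comm, hf]
  simp only [smul_add, smul_neg] at h2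
  rw [← h2, smul_smul, smul_smul]
  congr 2
  field_simp

/-- The adjoint equation: the defect of the adjoint transport equation vanishes. -/
theorem normCoeff_adjoint [CompleteSpace 𝔸] (q : smoothAlg ℝ 𝔸) (k : ℕ) :
    dDiag (dDiag (normCoeff q k)) - (2 : ℝ) • dDiag (dX (normCoeff q k))
      + pullFst q * normCoeff q k - normCoeff q k * pullSnd q
      - diffEl * dDiag (normCoeff q (k + 1)) = 0 := by
  set e : ℕ → smoothAlg (ℝ × ℝ) 𝔸 := fun k =>
    dDiag (dDiag (normCoeff q k)) - (2 : ℝ) • dDiag (dX (normCoeff q k))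
      + pullFst q * normCoeff q k - normCoeff q k * pullSnd q
      - diffEl * dDiag (normCoeff q (k + 1)) with he
  have hd1 : ∀ v : ℝ × ℝ, dirDeriv v (1 : smoothAlg (ℝ × ℝ) 𝔸) = 0 := fun v => by
    simpa using dirDeriv_mul v (1 : smoothAlg (ℝ × ℝ) 𝔸) 1
  have hzero : ∀ k : ℕ, ((k : ℝ) • e k + diffEl * dX (e k) = 0) → (k = 0 → ∀ y, (e k).1 (y, y) = 0) →
      e k = 0 := by
    intro k h hy
    refine Subtype.ext <| funext fun p => ?_
    refine eq_zero_of_transport k p.2 (u := fun x => (e k).1 (x, p.2))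
      (u' := fun x => (dX (e k)).1 (x, p.2)) (fun x => hasDerivAt_slice_fst _ _ _)
      ((smoothAlg_contDiff (dX (e k))).continuous.comp (by fun_prop)) (fun x => ?_)
      (fun hk => hy hk p.2) p.1
    have := congrFun (congrArg Subtype.val h) (x, p.2)
    rw [← diffEl_mul_apply (dX (e k)) (x, p.2)]
    exact this
  change e k = 0
  induction k with
  | zero =>
    -- At order zero b_0 = 1, so the defect is q(x) - q(y) - z D b_1. It vanishes on the diagonal,
    -- and its x-derivative vanishes by D applied to the first transport equation.
    have h0 : e 0 = pullFst q - pullSnd q - diffEl * dDiag (normCoeff q 1) := by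
      simp only [he, normCoeff_zero, hd1, map_zero, smul_zero, mul_one, one_mul, zero_add, sub_zero]
    have h1 := normCoeff_transport q 0
    simp only [normCoeff_zero, hd1, map_zero, neg_zero, zero_add, mul_one, Nat.cast_zero,
      one_smul] at h1
    refine hzero 0 ?_ fun _ y => ?_
    · have h2 := congrArg dDiag h1
      simp only [map_add, dirDeriv_mul, dDiag_diffEl, zero_mul, zero_add, dirDeriv_pullFst,
        one_smul] at h2
      rw [h0]
      simp only [map_sub, dirDeriv_mul, dX_diffEl, one_mul, dirDeriv_pullFst, dirDeriv_pullSnd,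
        one_smul, zero_smul, sub_zero, Nat.cast_zero, zero_add]
      rw [← h2, dirDeriv_comm (1, 0) (1, 1)]
      simp
    · rw [h0]
      change q.1 y - q.1 y - (diffEl * dDiag (normCoeff q 1)).1 (y, y) = 0
      rw [diffEl_mul_apply]
      simp
  | succ k ih =>
    refine hzero (k + 1) ?_ (by simp)
    have hq : dDiag (pullFst q) = dX (pullFst q) := by simp only [dirDeriv_pullFst]
    have hr : dX (pullSnd q) = 0 := by simp only [dirDeriv_pullSnd, zero_smul]
    have he' : ∀ k, e k = dDiag (dDiag (normCoeff q k)) - (2 : ℝ) • dDiag (dX (normCoeff q k))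
      + pullFst q * normCoeff q k - normCoeff q k * pullSnd q
      - diffEl * dDiag (normCoeff q (k + 1)) := fun k => by rw [he]
    clear_value e
    have h := adjoint_defect_transport (R := smoothAlg (ℝ × ℝ) 𝔸) dDiag dX (dirDeriv_mul _) (dirDeriv_mul _)
      (dirDeriv_comm _ _) diffEl (pullFst q) (pullSnd q) mul_diffEl dX_diffEl dDiag_diffEl
      hq hr (normCoeff q) e
      (normCoeff_transport q) he' k
    rw [ih] at h
    push_cast
    simpa using h

end

noncomputable section

/-! ### Relations between the diagonal values -/

section Diagonal

variable {𝔸 : Type} [NormedRing 𝔸] [NormedAlgebra ℝ 𝔸]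

/-- Restriction to the diagonal. -/
def diagEl : smoothAlg (ℝ × ℝ) 𝔸 →ₐ[ℝ] smoothAlg ℝ 𝔸 where
  toFun f := ⟨fun x => f.1 (x, x), (smoothAlg_contDiff f).comp (contDiff_id.prodMk contDiff_id)⟩
  map_one' := rfl
  map_mul' _ _ := rfl
  map_zero' := rfl
  map_add' _ _ := rfl
  commutes' _ := rfl

theorem dOne_diagEl (f : smoothAlg (ℝ × ℝ) 𝔸) : dOne (diagEl f) = diagEl (dDiag f) :=
  Subtype.ext <| funext fun x => by
    have h := smoothAlg_hasDerivAt_comp f ((hasDerivAt_id x).prodMk (hasDerivAt_id x))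
    exact (smoothAlg_hasDerivAt (diagEl f) x).unique h

theorem diagEl_diffEl_mul (f : smoothAlg (ℝ × ℝ) 𝔸) : diagEl (diffEl * f) = 0 :=
  Subtype.ext <| funext fun x => by
    change (diffEl * f).1 (x, x) = 0
    rw [diffEl_mul_apply]
    simp

theorem diagEl_pullFst (q : smoothAlg ℝ 𝔸) : diagEl (pullFst q) = q := rfl

theorem diagEl_pullSnd (q : smoothAlg ℝ 𝔸) : diagEl (pullSnd q) = q := rfl

variable [CompleteSpace 𝔸]

/-- The diagonal value of `(∂_x - ∂_y) a_k / k!`. -/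
def skewDiag (q : smoothAlg ℝ 𝔸) (k : ℕ) : smoothAlg ℝ 𝔸 :=
  (2 : ℝ) • diagEl (dX (normCoeff q k)) - dOne (diagEl (normCoeff q k))

/-- On the diagonal z = 0 and both potentials coincide, so the adjoint equation becomes D(2d b_k - D
b_k) = [q, b_k]; moreover 2d - D = ∂_x - ∂_y. -/
theorem dOne_skewDiag (q : smoothAlg ℝ 𝔸) (k : ℕ) :
    dOne (skewDiag q k) = q * diagEl (normCoeff q k) - diagEl (normCoeff q k) * q := by
  have h := congrArg diagEl (normCoeff_adjoint q k)
  simp only [map_add, map_sub, map_mul, map_smul, map_zero, diagEl_pullFst, diagEl_pullSnd,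
    ← dOne_diagEl] at h
  have h2 : diagEl diffEl * dOne (diagEl (normCoeff q (k + 1))) = 0 := by
    rw [dOne_diagEl, ← map_mul, diagEl_diffEl_mul]
  simp only [h2, sub_zero] at h
  simp only [skewDiag, map_sub, map_smul]
  linear_combination (norm := module) -h

/-- On the diagonal the transport equation expresses d²b_k through γ_{k+1}. The x-derivative of the
adjoint equation involves D(d²b_k) and Dγ_{k+1}. Eliminating d²b_k, and first derivatives by means
of `dOne_skewDiag`, leaves a relation in γ_k and φ_k alone. -/
theorem dOne_diag_succ (q : smoothAlg ℝ 𝔸) (k : ℕ) :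
    (2 * (k : ℝ) + 1) • dOne (diagEl (normCoeff q (k + 1)))
      = (-(1 / 2) : ℝ) • (dOne (dOne (dOne (diagEl (normCoeff q k))))
        - dOne (q * diagEl (normCoeff q k)) - dOne (diagEl (normCoeff q k) * q)
        - q * dOne (diagEl (normCoeff q k)) - dOne (diagEl (normCoeff q k)) * q
        + q * skewDiag q k - skewDiag q k * q) := by
  have hz : ∀ f : smoothAlg (ℝ × ℝ) 𝔸, diagEl diffEl * diagEl f = 0 := fun f => by
    rw [← map_mul, diagEl_diffEl_mul]
  have hq : dX (pullFst q) = pullFst (dOne q) := by rw [dirDeriv_pullFst, one_smul]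
  have hr : dX (pullSnd q) = 0 := by rw [dirDeriv_pullSnd, zero_smul]
  have hc : ∀ f : smoothAlg (ℝ × ℝ) 𝔸, dX (dDiag f) = dDiag (dX f) := dirDeriv_comm _ _
  have hX := congrArg diagEl (normCoeff_transport q k)
  have hE := congrArg (fun f => diagEl (dX f)) (normCoeff_adjoint q k)
  simp only [map_add, map_sub, map_neg, map_mul, map_smul, map_zero, diagEl_pullFst,
    diagEl_pullSnd, dirDeriv_mul, dX_diffEl, hz, hq, hr, hc, add_zero, mul_zero,
    one_mul, ← dOne_diagEl] at hX hE
  have hS := congrArg dOne (dOne_skewDiag q k)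
  have hz' : diagEl diffEl * dOne (diagEl (dX (normCoeff q (k + 1)))) = 0 := by
    rw [dOne_diagEl, hz]
  have hX' := congrArg dOne hX
  rw [hz'] at hE
  simp only [skewDiag, map_add, map_sub, map_neg, map_smul, dirDeriv_mul, mul_sub, sub_mul,
    smul_mul_assoc, mul_smul_comm] at hS hX' ⊢
  linear_combination (norm := module) (2 : ℝ) • hX' + hE - (1 / 2 : ℝ) • hS

end Diagonal

end

noncomputable section

/-! ### Differential polynomials -/

/-- Real `N × N` matrices. -/
abbrev Mat (N : ℕ) : Type := Matrix (Fin N) (Fin N) ℝ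

instance (N : ℕ) : CompleteSpace (Mat N) := FiniteDimensional.complete ℝ _

variable {a : ℝ} {N : ℕ}

/-- A potential as an element of the algebra of smooth functions. -/
def potEl (Q : Potential a N) : smoothAlg ℝ (Mat N) := ⟨Q, Q.smooth⟩

theorem heatCoeff_eq (Q : Potential a N) (k : ℕ) : heatCoeff Q k = coeffGen (potEl Q).1 k := by
  induction k with
  | zero => rfl
  | succ k ih =>
    funext x y
    simp only [heatCoeff, coeffGen, ih]
    rfl

theorem deriv_coe (f : smoothAlg ℝ (Mat N)) (x : ℝ) : deriv f.1 x = (dOne f).1 x :=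
  (smoothAlg_hasDerivAt f x).deriv

theorem dOne_iterate (f : smoothAlg ℝ (Mat N)) (j : ℕ) :
    (dOne^[j] f).1 = iteratedDeriv j f.1 := by
  induction j generalizing f with
  | zero => exact iteratedDeriv_zero.symm
  | succ j ih =>
    have h : deriv f.1 = (dOne f).1 := funext (deriv_coe f)
    rw [Function.iterate_succ_apply, ih, ← h]
    exact iteratedDeriv_succ'.symm

/-- The normalised diagonal values `[a_k] / k!`, as fields. -/
def diagField (k : ℕ) : FieldMap a N := fun Q => (diagEl (normCoeff (potEl Q) k)).1

/-- The diagonal values of `(∂_x - ∂_y) a_k / k!`, as fields. -/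
def skewField (k : ℕ) : FieldMap a N := fun Q => (skewDiag (potEl Q) k).1

theorem heatDiag_eq (k : ℕ) :
    (heatDiag k : FieldMap a N) = (Nat.factorial k : ℝ) • diagField k := by
  funext Q x
  have hk : (Nat.factorial k : ℝ) ≠ 0 := by positivity
  change heatCoeff Q k x x =
    (Nat.factorial k : ℝ) • ((Nat.factorial k : ℝ)⁻¹ • coeffGen (potEl Q).1 k x x)
  rw [smul_inv_smul₀ hk, heatCoeff_eq]

/-- Functions of two variables depending on the potential, all of whose `x`-derivatives are
differential polynomials on the diagonal. -/
def IsJetPoly (F : Potential a N → smoothAlg (ℝ × ℝ) (Mat N)) : Prop :=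
  ∀ j : ℕ, (fun Q => (diagEl (dX^[j] (F Q))).1 : FieldMap a N) ∈ diffPoly a N

theorem IsJetPoly.dX {F : Potential a N → smoothAlg (ℝ × ℝ) (Mat N)} (hF : IsJetPoly F) :
    IsJetPoly fun Q => dX (F Q) := fun j => hF (j + 1)

theorem IsJetPoly.add {F G : Potential a N → smoothAlg (ℝ × ℝ) (Mat N)} (hF : IsJetPoly F)
    (hG : IsJetPoly G) : IsJetPoly fun Q => F Q + G Q := fun j => by
  have h := add_mem (hF j) (hG j)
  simp only [iterate_map_add]
  exact h

theorem IsJetPoly.neg {F : Potential a N → smoothAlg (ℝ × ℝ) (Mat N)} (hF : IsJetPoly F) :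
    IsJetPoly fun Q => -F Q := fun j => by
  have h := neg_mem (hF j)
  simp only [iterate_map_neg]
  exact h

theorem IsJetPoly.mul {F G : Potential a N → smoothAlg (ℝ × ℝ) (Mat N)} (hF : IsJetPoly F)
    (hG : IsJetPoly G) : IsJetPoly fun Q => F Q * G Q := fun j => by
  induction j generalizing F G with
  | zero => exact mul_mem (hF 0) (hG 0)
  | succ j ih =>
    have h := add_mem (ih hF.dX hG) (ih hF hG.dX)
    simp only [Function.iterate_succ_apply, dirDeriv_mul, iterate_map_add]
    exact h

theorem isJetPoly_pullFst : IsJetPoly fun Q : Potential a N => pullFst (potEl Q) := fun j => by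
  have h : ∀ (j : ℕ) (q : smoothAlg ℝ (Mat N)), diagEl (dX^[j] (pullFst q)) = dOne^[j] q := by
    intro j
    induction j with
    | zero => exact fun q => rfl
    | succ j ih =>
      intro q
      simp only [Function.iterate_succ_apply, dirDeriv_pullFst, one_smul, ih]
  simp only [h, dOne_iterate]
  exact NonUnitalAlgebra.subset_adjoin ℝ ⟨j, rfl⟩

/-- Differentiating j times turns cF + z dF into (c+j) d^jF + z d^{j+1}F. On the diagonal the last
term drops out and c + j > 0 can be divided out, so no integration is needed to find the jets of F.
-/
theorem IsJetPoly.of_transport {F G : Potential a N → smoothAlg (ℝ × ℝ) (Mat N)} (c : ℝ)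
    (hc : 0 < c) (hG : IsJetPoly G) (h : ∀ Q, c • F Q + diffEl * HeatKdV.dX (F Q) = G Q) :
    IsJetPoly F := fun j => by
  have hj : ∀ (j : ℕ) (f : smoothAlg (ℝ × ℝ) (Mat N)), HeatKdV.dX^[j] (c • f + diffEl * HeatKdV.dX f)
      = (c + j) • HeatKdV.dX^[j] f + diffEl * HeatKdV.dX^[j + 1] f := by
    intro j
    induction j with
    | zero => simp
    | succ j ih =>
      intro f
      rw [Function.iterate_succ_apply', ih]
      simp only [map_add, map_smul, dirDeriv_mul, dX_diffEl, one_mul, ← Function.iterate_succ_apply']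
      push_cast
      module
  have hcj : c + j ≠ 0 := by positivity
  have h2 := SMulMemClass.smul_mem (c + j)⁻¹ (hG j)
  refine (congrArg (· ∈ diffPoly a N) ?_).mpr h2
  funext Q
  have h3 : diagEl (HeatKdV.dX^[j] (G Q)) = (c + j) • diagEl (HeatKdV.dX^[j] (F Q)) := by
    rw [← h, hj, map_add, diagEl_diffEl_mul, add_zero, map_smul]
  change (diagEl (HeatKdV.dX^[j] (F Q))).1 = ((c + j)⁻¹ • diagEl (HeatKdV.dX^[j] (G Q))).1
  rw [h3, inv_smul_smul₀ hcj]

/-- The index starts at 1 because b_0 = 1 is a constant term. Carrying all x-derivatives along makes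
the induction close, since each step differentiates twice. -/
theorem isJetPoly_normCoeff (k : ℕ) :
    IsJetPoly fun Q : Potential a N => normCoeff (potEl Q) (k + 1) := by
  refine IsJetPoly.of_transport (k + 1) (by positivity) ?_
    fun Q => normCoeff_transport (potEl Q) k
  induction k with
  | zero =>
    have hd1 : dX (1 : smoothAlg (ℝ × ℝ) (Mat N)) = 0 := by
      simpa using dirDeriv_mul (1, 0) (1 : smoothAlg (ℝ × ℝ) (Mat N)) 1
    simp only [normCoeff_zero, hd1, map_zero, neg_zero, zero_add, mul_one]
    exact isJetPoly_pullFst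
  | succ k ih =>
    have h : IsJetPoly fun Q : Potential a N => normCoeff (potEl Q) (k + 1) :=
      IsJetPoly.of_transport (k + 1) (by positivity) ih
        fun Q => normCoeff_transport (potEl Q) k
    exact h.dX.dX.neg.add (isJetPoly_pullFst.mul h)

/-! ### Regular fields -/

variable (a N) in
/-- Fields that depend smoothly on the point and on parameters in the potential, are periodic,
and depend only on the germ of the potential at the given point. -/
def regularFields : Subalgebra ℝ (FieldMap a N) where
  carrier := {g | (∀ γ : ℝ → Potential a N,
      ContDiff ℝ ∞ (fun p : ℝ × ℝ => γ p.1 p.2) →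
        (fun p : ℝ × ℝ => g (γ p.1) p.2) ∈ smoothAlg (ℝ × ℝ) (Mat N)) ∧
    (∀ Q, Function.Periodic (g Q) (2 * Real.pi * a)) ∧
    ∀ (Q Q' : Potential a N) x, Q.toFun =ᶠ[𝓝 x] Q'.toFun → g Q x = g Q' x}
  mul_mem' hf hg := ⟨fun γ hγ => mul_mem (hf.1 γ hγ) (hg.1 γ hγ),
    fun Q => (hf.2.1 Q).mul (hg.2.1 Q),
    fun Q Q' x h => congrArg₂ (· * ·) (hf.2.2 Q Q' x h) (hg.2.2 Q Q' x h)⟩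
  add_mem' hf hg := ⟨fun γ hγ => add_mem (hf.1 γ hγ) (hg.1 γ hγ),
    fun Q => (hf.2.1 Q).add (hg.2.1 Q),
    fun Q Q' x h => congrArg₂ (· + ·) (hf.2.2 Q Q' x h) (hg.2.2 Q Q' x h)⟩
  algebraMap_mem' r := ⟨fun _ _ => (smoothAlg (ℝ × ℝ) (Mat N)).algebraMap_mem r,
    fun _ _ => rfl, fun _ _ _ _ => rfl⟩

/-- The restriction of a regular field to a smooth family of potentials. -/
def evalFamily (γ : ℝ → Potential a N) (hγ : ContDiff ℝ ∞ (fun p : ℝ × ℝ => γ p.1 p.2)) :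
    regularFields a N →ₐ[ℝ] smoothAlg (ℝ × ℝ) (Mat N) where
  toFun g := ⟨fun p => g.1 (γ p.1) p.2, g.2.1 γ hγ⟩
  map_one' := rfl
  map_mul' _ _ := rfl
  map_zero' := rfl
  map_add' _ _ := rfl
  commutes' _ := rfl

/-- The value of a regular field at a potential. -/
def evalPot (Q : Potential a N) : regularFields a N →ₐ[ℝ] smoothAlg ℝ (Mat N) where
  toFun g := ⟨g.1 Q, by
    have h : ContDiff ℝ ∞ (fun p : ℝ × ℝ => Q p.2) := Q.smooth.comp contDiff_snd
    exact (smoothAlg_contDiff (evalFamily (fun _ => Q) h g)).comp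
      ((contDiff_const (c := (0 : ℝ))).prodMk contDiff_id)⟩
  map_one' := rfl
  map_mul' _ _ := rfl
  map_zero' := rfl
  map_add' _ _ := rfl
  commutes' _ := rfl

theorem opD_apply_eq (g : regularFields a N) (Q : Potential a N) :
    opD g.1 Q = (dOne (evalPot Q g)).1 := funext fun x => deriv_coe (evalPot Q g) x

theorem opD_evalFamily (g : regularFields a N) (γ : ℝ → Potential a N)
    (hγ : ContDiff ℝ ∞ (fun p : ℝ × ℝ => γ p.1 p.2)) (p : ℝ × ℝ) :
    opD g.1 (γ p.1) p.2 = (dirDeriv (0, 1) (evalFamily γ hγ g)).1 p := by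
  rw [opD_apply_eq]
  exact (smoothAlg_hasDerivAt (evalPot (γ p.1) g) p.2).unique
    (hasDerivAt_slice_snd (evalFamily γ hγ g) p.1 p.2)

theorem opD_mem (g : regularFields a N) : opD g.1 ∈ regularFields a N := by
  refine ⟨fun γ hγ => ?_, fun Q x => ?_, fun Q Q' x h => ?_⟩
  · have h : (fun p : ℝ × ℝ => opD g.1 (γ p.1) p.2) = (dirDeriv (0, 1) (evalFamily γ hγ g)).1 :=
      funext (opD_evalFamily g γ hγ)
    rw [h]
    exact Subtype.property _
  · have h1 := smoothAlg_hasDerivAt (evalPot Q g) (x + 2 * Real.pi * a)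
    have h2 := h1.comp_add_const x (2 * Real.pi * a)
    have h3 : (fun x => (evalPot Q g).1 (x + 2 * Real.pi * a)) = (evalPot Q g).1 :=
      funext fun x => g.2.2.1 Q x
    rw [h3] at h2
    rw [opD_apply_eq]
    exact h2.unique (smoothAlg_hasDerivAt (evalPot Q g) x)
  · have h1 : g.1 Q =ᶠ[𝓝 x] g.1 Q' :=
      h.eventuallyEq_nhds.mono fun y hy => g.2.2.2 Q Q' y hy
    have h2 := (smoothAlg_hasDerivAt (evalPot Q' g) x).congr_of_eventuallyEq h1
    rw [opD_apply_eq, opD_apply_eq]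
    exact (smoothAlg_hasDerivAt (evalPot Q g) x).unique h2

/-- The operator `D` on regular fields. -/
def regD : regularFields a N →ₗ[ℝ] regularFields a N where
  toFun g := ⟨opD g.1, opD_mem g⟩
  map_add' f g := Subtype.ext <| funext fun Q => by
    change opD (f + g).1 Q = opD f.1 Q + opD g.1 Q
    simp only [opD_apply_eq, map_add]
    rfl
  map_smul' c g := Subtype.ext <| funext fun Q => by
    change opD (c • g).1 Q = c • opD g.1 Q
    simp only [opD_apply_eq, map_smul]
    rfl

theorem regD_mul (f g : regularFields a N) : regD (f * g) = regD f * g + f * regD g :=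
  Subtype.ext <| funext fun Q => by
    change opD (f * g).1 Q = opD f.1 Q * g.1 Q + f.1 Q * opD g.1 Q
    simp only [opD_apply_eq, map_mul, dirDeriv_mul]
    rfl

theorem evalPot_regD (Q : Potential a N) (g : regularFields a N) :
    evalPot Q (regD g) = dOne (evalPot Q g) := Subtype.ext (opD_apply_eq g Q)

theorem evalFamily_regD (γ : ℝ → Potential a N)
    (hγ : ContDiff ℝ ∞ (fun p : ℝ × ℝ => γ p.1 p.2)) (g : regularFields a N) :
    evalFamily γ hγ (regD g) = dirDeriv (0, 1) (evalFamily γ hγ g) :=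
  Subtype.ext (funext (opD_evalFamily g γ hγ))

theorem regularFields_ext {f g : regularFields a N} (h : ∀ Q, evalPot Q f = evalPot Q g) : f = g :=
  Subtype.ext <| funext fun Q => congrArg Subtype.val (h Q)

theorem potentialField_mem : (potentialField : FieldMap a N) ∈ regularFields a N :=
  ⟨fun _ hγ => hγ, fun Q => Q.periodic, fun _ _ _ h => h.self_of_nhds⟩

/-- The potential, as a regular field. -/
def regQ : regularFields a N := ⟨potentialField, potentialField_mem⟩

theorem diffPoly_le (g : FieldMap a N) (hg : g ∈ diffPoly a N) : g ∈ regularFields a N := by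
  have h : diffPoly a N ≤ (regularFields a N).toNonUnitalSubalgebra := by
    refine NonUnitalAlgebra.adjoin_le ?_
    rintro _ ⟨j, rfl⟩
    have h1 : (fun Q x => iteratedDeriv j Q x : FieldMap a N) = (regD^[j] regQ).1 := by
      funext Q
      have h2 : ∀ (j : ℕ) (g : regularFields a N), evalPot Q (regD^[j] g) = dOne^[j] (evalPot Q g) := by
        intro j
        induction j with
        | zero => exact fun g => rfl
        | succ j ih =>
          intro g
          rw [Function.iterate_succ_apply, ih, evalPot_regD, Function.iterate_succ_apply]
      exact ((congrArg Subtype.val (h2 j regQ)).trans (dOne_iterate _ j)).symm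
    change (fun Q x => iteratedDeriv j Q x : FieldMap a N) ∈ regularFields a N
    rw [h1]
    exact (regD^[j] regQ).2
  exact h hg

theorem opD_mem_diffPoly (g : FieldMap a N) (hg : g ∈ diffPoly a N) : opD g ∈ diffPoly a N := by
  -- Linearity and the Leibniz rule for D are available on regular fields, so membership there is
  -- carried through the induction.
  suffices h : ∀ g ∈ diffPoly a N, ∃ hg' : g ∈ regularFields a N,
      (regD ⟨g, hg'⟩).1 ∈ diffPoly a N from (h g hg).2
  intro g hg
  induction hg using NonUnitalAlgebra.adjoin_induction with
  | mem x hx =>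
    refine ⟨diffPoly_le _ (NonUnitalAlgebra.subset_adjoin ℝ hx), ?_⟩
    obtain ⟨j, rfl⟩ := hx
    refine NonUnitalAlgebra.subset_adjoin ℝ ⟨j + 1, ?_⟩
    funext Q x
    exact congrFun iteratedDeriv_succ x
  | add x y hx hy ihx ihy =>
    obtain ⟨h1, h2⟩ := ihx
    obtain ⟨h3, h4⟩ := ihy
    refine ⟨add_mem h1 h3, ?_⟩
    have h := add_mem h2 h4
    rw [← AddMemClass.coe_add, ← map_add] at h
    exact h
  | zero => exact ⟨zero_mem _, by
      have h : (⟨0, zero_mem _⟩ : regularFields a N) = 0 := rfl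
      rw [h, map_zero]; exact zero_mem _⟩
  | mul x y hx hy ihx ihy =>
    obtain ⟨h1, h2⟩ := ihx
    obtain ⟨h3, h4⟩ := ihy
    refine ⟨mul_mem h1 h3, ?_⟩
    have h : regD ⟨x * y, mul_mem h1 h3⟩ = _ := regD_mul ⟨x, h1⟩ ⟨y, h3⟩
    rw [h]
    exact add_mem (mul_mem h2 hy) (mul_mem hx h4)
  | smul r x hx ihx =>
    obtain ⟨h1, h2⟩ := ihx
    refine ⟨SMulMemClass.smul_mem r h1, ?_⟩
    have h : regD ⟨r • x, SMulMemClass.smul_mem r h1⟩ = _ := map_smul regD r ⟨x, h1⟩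
    rw [h]
    exact SMulMemClass.smul_mem r h2

/-- The zero potential. -/
def zeroPot : Potential a N where
  toFun _ := 0
  smooth := contDiff_const
  periodic _ := rfl
  symm _ := Matrix.isSymm_zero

/-- The absence of a constant term enters here: the value at the zero potential fixes the constant
of integration in D⁻¹. -/
theorem diffPoly_zeroPot (g : FieldMap a N) (hg : g ∈ diffPoly a N) : g zeroPot = 0 := by
  induction hg using NonUnitalAlgebra.adjoin_induction with
  | mem x hx =>
    obtain ⟨j, rfl⟩ := hx
    have h := dOne_iterate (potEl (zeroPot : Potential a N)) j
    have h0 : potEl (zeroPot : Potential a N) = 0 := rfl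
    rw [h0, iterate_map_zero] at h
    exact h.symm
  | add x y hx hy ihx ihy => change x zeroPot + y zeroPot = 0; rw [ihx, ihy, add_zero]
  | zero => rfl
  | mul x y hx hy ihx ihy => change x zeroPot * y zeroPot = 0; rw [ihx, zero_mul]
  | smul r x hx ihx => change r • x zeroPot = 0; rw [ihx, smul_zero]

end

noncomputable section

variable {a : ℝ} {N : ℕ}

/-! ### Injectivity of `D` -/

/-- The product of a potential with a smooth periodic function. -/
def smulPot (χ : ℝ → ℝ) (hχ : ContDiff ℝ ∞ χ) (hp : Function.Periodic χ (2 * Real.pi * a))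
    (Q : Potential a N) : Potential a N where
  toFun x := χ x • Q x
  smooth := hχ.smul Q.smooth
  periodic x := by
    change χ (x + 2 * Real.pi * a) • Q (x + 2 * Real.pi * a) = χ x • Q x
    rw [hp x, Q.periodic x]
  symm x := (Q.symm x).smul (χ x)

/-- A regular field that vanishes at the zero potential is zero if its derivative is. -/
theorem eq_zero_of_regD_eq_zero (ha : 0 < a) (W : regularFields a N) (hW : regD W = 0)
    (h0 : evalPot zeroPot W = 0) : W = 0 := by
  have hconst : ∀ (Q : Potential a N) x y, W.1 Q x = W.1 Q y := by
    intro Q x y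
    have h1 : ∀ x, HasDerivAt (evalPot Q W).1 0 x := fun x => by
      have h2 := smoothAlg_hasDerivAt (evalPot Q W) x
      rw [← evalPot_regD, hW, map_zero] at h2
      exact h2
    exact is_const_of_deriv_eq_zero (fun x => (h1 x).differentiableAt) (fun x => (h1 x).deriv) x y
  -- The argument 1/2 + cos(x/a) exceeds 1 near 0 and is negative near πa, so χ is 1 near 0 and 0
  -- near the opposite point of the circle.
  set χ : ℝ → ℝ := fun x => Real.smoothTransition (1 / 2 + Real.cos (x / a)) with hχ
  have hχs : ContDiff ℝ ∞ χ := Real.smoothTransition.contDiff.comp (by fun_prop)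
  have hχp : Function.Periodic χ (2 * Real.pi * a) := fun x => by
    simp only [hχ]
    rw [add_div, mul_div_assoc, div_self ha.ne', mul_one, Real.cos_add_two_pi]
  have hc : Continuous fun x : ℝ => 1 / 2 + Real.cos (x / a) := by fun_prop
  have h1 : ∀ᶠ x in 𝓝 (0 : ℝ), χ x = 1 := by
    have : ∀ᶠ x in 𝓝 (0 : ℝ), 1 < 1 / 2 + Real.cos (x / a) :=
      hc.continuousAt.eventually_const_lt (by norm_num)
    exact this.mono fun x hx => Real.smoothTransition.one_of_one_le hx.le
  have h2 : ∀ᶠ x in 𝓝 (Real.pi * a), χ x = 0 := by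
    have : ∀ᶠ x in 𝓝 (Real.pi * a), 1 / 2 + Real.cos (x / a) < 0 :=
      hc.continuousAt.eventually_lt_const (by
        change 1 / 2 + Real.cos (Real.pi * a / a) < 0
        rw [mul_div_assoc, div_self ha.ne', mul_one, Real.cos_pi]; norm_num)
    exact this.mono fun x hx => Real.smoothTransition.zero_of_nonpos hx.le
  refine Subtype.ext <| funext fun Q => funext fun x => ?_
  -- Locality: χQ has the germ of Q at 0 and of the zero potential at πa. As `W` is constant on the
  -- circle for each potential, its value at Q equals its value at zero.
  have e1 : W.1 Q 0 = W.1 (smulPot χ hχs hχp Q) 0 :=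
    W.2.2.2 _ _ _ (h1.mono fun y hy => by
      change Q y = χ y • Q y
      rw [hy, one_smul])
  have e2 : W.1 (smulPot χ hχs hχp Q) (Real.pi * a) = W.1 zeroPot (Real.pi * a) :=
    W.2.2.2 _ _ _ (h2.mono fun y hy => by
      change χ y • Q y = 0
      rw [hy, zero_smul])
  rw [hconst Q x 0, e1, hconst _ 0 (Real.pi * a), e2]
  exact congrFun (congrArg Subtype.val h0) _

theorem evalPot_zeroPot_of_mem (W : regularFields a N) (hW : W.1 ∈ diffPoly a N) :
    evalPot zeroPot W = 0 := Subtype.ext (diffPoly_zeroPot W.1 hW)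

/-- Two differential polynomials with the same derivative differ by a regular field that D kills and
that vanishes at the zero potential, hence by zero; the choice made in `opDinv` is therefore
irrelevant. -/
theorem opDinv_eq (ha : 0 < a) {g W : FieldMap a N} (hW : W ∈ diffPoly a N) (h : opD W = g) :
    opDinv g = W := by
  have hex : ∃ W ∈ diffPoly a N, opD W = g := ⟨W, hW, h⟩
  have h1 : opDinv g = hex.choose := dif_pos hex
  obtain ⟨h2, h3⟩ := hex.choose_spec
  rw [h1]
  set W' := hex.choose
  have h4 := eq_zero_of_regD_eq_zero ha (⟨W', diffPoly_le _ h2⟩ - ⟨W, diffPoly_le _ hW⟩)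
    (by
      rw [map_sub, sub_eq_zero]
      exact Subtype.ext (h3.trans h.symm))
    (by
      rw [map_sub, evalPot_zeroPot_of_mem _ h2, evalPot_zeroPot_of_mem _ hW, sub_zero])
  exact congrArg Subtype.val (sub_eq_zero.1 h4)

/-! ### The diagonal values as regular fields -/

theorem diagField_zero : (diagField 0 : FieldMap a N) = 1 := by
  funext Q
  simp only [diagField, normCoeff_zero]
  rfl

theorem diagField_succ_mem (k : ℕ) : (diagField (k + 1) : FieldMap a N) ∈ diffPoly a N :=
  isJetPoly_normCoeff k 0

theorem diagField_mem (k : ℕ) : (diagField k : FieldMap a N) ∈ regularFields a N := by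
  cases k with
  | zero => rw [diagField_zero]; exact one_mem _
  | succ k => exact diffPoly_le _ (diagField_succ_mem k)

/-- The normalised diagonal values, as regular fields. -/
def regDiag (k : ℕ) : regularFields a N := ⟨diagField k, diagField_mem k⟩

theorem regDiag_zero : (regDiag 0 : regularFields a N) = 1 := Subtype.ext diagField_zero

theorem skewField_mem (k : ℕ) : (skewField k : FieldMap a N) ∈ diffPoly a N := by
  cases k with
  | zero =>
    have h : (skewField 0 : FieldMap a N) = 0 := by
      funext Q
      have hd1 : dX (1 : smoothAlg (ℝ × ℝ) (Mat N)) = 0 := by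
        simpa using dirDeriv_mul (1, 0) (1 : smoothAlg (ℝ × ℝ) (Mat N)) 1
      have hd2 : dOne (1 : smoothAlg ℝ (Mat N)) = 0 := by
        simpa using dirDeriv_mul 1 (1 : smoothAlg ℝ (Mat N)) 1
      simp only [skewField, skewDiag, normCoeff_zero, hd1, map_zero, map_one, hd2, smul_zero,
        sub_zero]
      rfl
    rw [h]
    exact zero_mem _
  | succ k =>
    have h1 := isJetPoly_normCoeff (a := a) (N := N) k 1
    have h2 := opD_mem_diffPoly _ (diagField_succ_mem (a := a) (N := N) k)
    have h3 : (skewField (k + 1) : FieldMap a N)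
        = (2 : ℝ) • (fun Q => (diagEl (dX^[1] (normCoeff (potEl Q) (k + 1)))).1)
          - opD (diagField (k + 1)) := by
      funext Q
      change _ = _ - opD (regDiag (k + 1)).1 Q
      rw [opD_apply_eq]
      rfl
    rw [h3]
    exact sub_mem (SMulMemClass.smul_mem _ h1) h2

/-- The diagonal values of `(∂_x - ∂_y) a_k / k!`, as regular fields. -/
def regSkew (k : ℕ) : regularFields a N := ⟨skewField k, diffPoly_le _ (skewField_mem k)⟩

theorem regD_regSkew (k : ℕ) :
    regD (regSkew k : regularFields a N) = regQ * regDiag k - regDiag k * regQ :=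
  regularFields_ext fun Q => by
    rw [evalPot_regD]
    exact dOne_skewDiag (potEl Q) k

/-- The operator `E` applied to `g`, in terms of `ψ = D⁻¹ Ad_Q g`. -/
def regE (g ψ : regularFields a N) : regularFields a N :=
  regD (regD (regD g)) - regD (regQ * g) - regD (g * regQ) - regQ * regD g - regD g * regQ
    + regQ * ψ - ψ * regQ

theorem regD_regDiag_succ (k : ℕ) :
    (2 * (k : ℝ) + 1) • regD (regDiag (k + 1) : regularFields a N)
      = (-(1 / 2) : ℝ) • regE (regDiag k) (regSkew k) :=
  regularFields_ext fun Q => by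
    simp only [regE, map_smul, map_add, map_sub, map_mul, evalPot_regD]
    exact dOne_diag_succ (potEl Q) k

/-- The terms of E involving Q and one D combine to -D(Qg) - D(gQ) - Q Dg - (Dg)Q, the symmetrised
form in which the recursion was found. -/
theorem opE_eq (ha : 0 < a) (g ψ : regularFields a N) (hψ : ψ.1 ∈ diffPoly a N)
    (h : regD ψ = regQ * g - g * regQ) : opE g.1 = (regE g ψ).1 := by
  have h1 : opDinv (adQ g.1) = ψ.1 := opDinv_eq ha hψ (congrArg Subtype.val h)
  rw [opE, h1]
  have h2 : regE g ψ = regD (regD (regD g)) - (2 : ℝ) • (regQ * regD g)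
      - (2 : ℝ) • regD (regQ * g) + (regQ * regD g - regD g * regQ)
      + regD (regQ * g - g * regQ) + (regQ * ψ - ψ * regQ) := by
    simp only [regE, map_sub]
    module
  rw [h2]
  rfl

/-! ### Symmetry of the diagonal values -/

/-- Transposition as a continuous linear map. -/
def transposeCLM (N : ℕ) : Mat N →L[ℝ] Mat N :=
  LinearMap.toContinuousLinearMap (Matrix.transposeLinearEquiv (Fin N) (Fin N) ℝ ℝ).toLinearMap

/-- Transposition of regular fields. -/
def regT : regularFields a N →ₗ[ℝ] regularFields a N where
  toFun g := ⟨fun Q x => (g.1 Q x)ᵀ, fun γ hγ =>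
      (transposeCLM N).contDiff.comp (smoothAlg_contDiff (evalFamily γ hγ g)),
    fun Q x => congrArg Matrix.transpose (g.2.2.1 Q x),
    fun Q Q' x h => congrArg Matrix.transpose (g.2.2.2 Q Q' x h)⟩
  map_add' _ _ := rfl
  map_smul' _ _ := rfl

theorem regT_mul (f g : regularFields a N) : regT (f * g) = regT g * regT f :=
  Subtype.ext <| funext fun Q => funext fun x => Matrix.transpose_mul (f.1 Q x) (g.1 Q x)

theorem regT_regD (g : regularFields a N) : regT (regD g) = regD (regT g) :=
  regularFields_ext fun Q => Subtype.ext <| funext fun x => by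
    have h1 := (transposeCLM N).hasFDerivAt.comp_hasDerivAt x
      (smoothAlg_hasDerivAt (evalPot Q g) x)
    have h2 := smoothAlg_hasDerivAt (evalPot Q (regT g)) x
    rw [evalPot_regD, ← h1.unique h2, ← evalPot_regD]
    rfl

theorem regT_regQ : regT (regQ : regularFields a N) = regQ :=
  Subtype.ext <| funext fun Q => funext fun x => Q.symm x

theorem evalPot_zeroPot_regT (g : regularFields a N) (h : evalPot zeroPot g = 0) :
    evalPot zeroPot (regT g) = 0 := Subtype.ext <| funext fun x => by
  have h1 : g.1 zeroPot x = 0 := congrFun (congrArg Subtype.val h) x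
  change (g.1 zeroPot x)ᵀ = 0
  rw [h1, Matrix.transpose_zero]

/-- Transposition changes the sign of the commutator of two symmetric matrices, so the sum of the
field and its transpose has zero derivative and vanishes at Q = 0. -/
theorem regT_regSkew_of (ha : 0 < a) (k : ℕ)
    (h : regT (regDiag k : regularFields a N) = regDiag k) :
    regT (regSkew k : regularFields a N) = -regSkew k := by
  have h0 := evalPot_zeroPot_of_mem (regSkew k : regularFields a N) (skewField_mem k)
  have h1 := eq_zero_of_regD_eq_zero ha (regT (regSkew k : regularFields a N) + regSkew k) (by
      rw [map_add, ← regT_regD, regD_regSkew, map_sub, regT_mul, regT_mul, regT_regQ, h]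
      abel)
    (by rw [map_add, evalPot_zeroPot_regT _ h0, h0, add_zero])
  exact eq_neg_of_add_eq_zero_left h1

/-- The heat kernel is not needed for symmetry: the right side of the recursion is symmetric when
γ_k is symmetric and φ_k antisymmetric, and injectivity of D passes this on to γ_{k+1}. -/
theorem regT_regDiag (ha : 0 < a) (k : ℕ) : regT (regDiag k : regularFields a N) = regDiag k := by
  induction k with
  | zero =>
    rw [regDiag_zero]
    exact Subtype.ext <| funext fun Q => funext fun x => Matrix.transpose_one
  | succ k ih =>
    have h0 := evalPot_zeroPot_of_mem (regDiag (k + 1) : regularFields a N) (diagField_succ_mem k)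
    have hE : regT (regE (regDiag k) (regSkew k) : regularFields a N)
        = regE (regDiag k) (regSkew k) := by
      have hn1 : regQ * -regSkew k = -(regQ * regSkew k : regularFields a N) :=
        mul_neg (regQ : regularFields a N) (regSkew k)
      have hn2 : -regSkew k * regQ = -(regSkew k * regQ : regularFields a N) :=
        neg_mul (regSkew k : regularFields a N) regQ
      simp only [regE, map_add, map_sub, regT_regD, regT_mul, regT_regQ, ih,
        regT_regSkew_of ha k ih, hn1, hn2]
      abel
    have hk : (2 * (k : ℝ) + 1) ≠ 0 := by positivity
    have h1 := eq_zero_of_regD_eq_zero ha (regT (regDiag (k + 1) : regularFields a N)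
      - regDiag (k + 1)) (by
        refine (smul_eq_zero.1 (?_ : (2 * (k : ℝ) + 1) •
          regD (regT (regDiag (k + 1) : regularFields a N) - regDiag (k + 1)) = 0)).resolve_left hk
        rw [map_sub, smul_sub, ← regT_regD, ← map_smul, regD_regDiag_succ, map_smul, hE, sub_self])
      (by rw [map_sub, evalPot_zeroPot_regT _ h0, h0, sub_zero])
    exact sub_eq_zero.1 h1

theorem heatDiag_isSymm (ha : 0 < a) (k : ℕ) (Q : Potential a N) (x : ℝ) :
    (heatDiag k Q x).IsSymm := by
  rw [heatDiag_eq]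
  have h : (diagField k Q x)ᵀ = diagField k Q x :=
    congrFun (congrFun (congrArg Subtype.val (regT_regDiag (a := a) (N := N) ha k)) Q) x
  change ((Nat.factorial k : ℝ) • diagField k Q x)ᵀ = (Nat.factorial k : ℝ) • diagField k Q x
  rw [Matrix.transpose_smul, h]

end

noncomputable section

/-! ### Formal series of resolvents -/

section Series

variable {R : Type*} [Ring R] [Algebra ℝ R]

/-- The coefficientwise extension of a linear operator to power series. -/
def psMap (δ : R →ₗ[ℝ] R) : PowerSeries R →ₗ[ℝ] PowerSeries R where
  toFun f := PowerSeries.mk fun n => δ (PowerSeries.coeff n f)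
  map_add' f g := by ext n; simp
  map_smul' c f := by ext n; simp

theorem coeff_psMap (δ : R →ₗ[ℝ] R) (n : ℕ) (f : PowerSeries R) :
    PowerSeries.coeff n (psMap δ f) = δ (PowerSeries.coeff n f) := by simp [psMap]

theorem psMap_mul (δ : R →ₗ[ℝ] R) (hδ : ∀ f g, δ (f * g) = δ f * g + f * δ g)
    (f g : PowerSeries R) : psMap δ (f * g) = psMap δ f * g + f * psMap δ g := by
  ext n
  simp only [coeff_psMap, PowerSeries.coeff_mul, map_add, map_sum, hδ, Finset.sum_add_distrib]

theorem psMap_comm (δ ε : R →ₗ[ℝ] R) (h : ∀ f, δ (ε f) = ε (δ f)) (f : PowerSeries R) :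
    psMap δ (psMap ε f) = psMap ε (psMap δ f) := by
  ext n
  simp only [coeff_psMap, h]

variable (R) in
/-- The Euler operator `X d/dX` on power series. -/
def psEuler : PowerSeries R →ₗ[ℝ] PowerSeries R where
  toFun f := PowerSeries.mk fun n => (n : ℝ) • PowerSeries.coeff n f
  map_add' f g := by ext n; simp
  map_smul' c f := by ext n; simp [smul_comm (n : ℝ) c]

theorem coeff_psEuler (n : ℕ) (f : PowerSeries R) :
    PowerSeries.coeff n (psEuler R f) = (n : ℝ) • PowerSeries.coeff n f := by
  simp [psEuler]

theorem psEuler_mul (f g : PowerSeries R) :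
    psEuler R (f * g) = psEuler R f * g + f * psEuler R g := by
  ext n
  simp only [coeff_psEuler, PowerSeries.coeff_mul, map_add, Finset.smul_sum,
    ← Finset.sum_add_distrib]
  refine Finset.sum_congr rfl fun p hp => ?_
  rw [← Finset.HasAntidiagonal.mem_antidiagonal.1 hp]
  push_cast
  rw [add_smul, smul_mul_assoc, mul_smul_comm]

theorem psEuler_psMap (δ : R →ₗ[ℝ] R) (f : PowerSeries R) :
    psMap δ (psEuler R f) = psEuler R (psMap δ f) := by
  ext n
  simp only [coeff_psMap, coeff_psEuler, map_smul]

end Series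

/-- The variation of the trace of a resolvent, in an abstract form: if `κ D n = [v, n]` and
`n² = 1/4`, then `tr (θv Sn) - tr (Sv θn) - tr (v Sn)` is a total derivative. -/
theorem trace_variation {A B : Type*} [Ring A] [Algebra ℝ A] [AddCommGroup B] [Module ℝ B]
    (D S θ : A →ₗ[ℝ] A) (hD : ∀ f g, D (f * g) = D f * g + f * D g)
    (hS : ∀ f g, S (f * g) = S f * g + f * S g) (hθ : ∀ f g, θ (f * g) = θ f * g + f * θ g)
    (hDS : ∀ f, D (S f) = S (D f)) (hDθ : ∀ f, D (θ f) = θ (D f)) (T : A →ₗ[ℝ] B)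
    (hT : ∀ f g, T (f * g) = T (g * f)) (κ n v : A) (hκ : ∀ f, f * κ = κ * f)
    (hSκ : S κ = 0) (hθκ : θ κ = κ) (hn : κ * D n = v * n - n * v)
    (hnn : n * n = (1 / 4 : ℝ) • (1 : A)) :
    T (κ * D (n * (S n * θ n - θ n * S n)))
      = T (θ v * S n) - T (S v * θ n) - T (v * S n) := by
  -- A derivation applied to n² = 1/4 shows that n anticommutes with its own derivatives.
  have hδ1 : ∀ δ : A →ₗ[ℝ] A, (∀ f g, δ (f * g) = δ f * g + f * δ g) → n * δ n = -(δ n * n) := by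
    intro δ hδ
    have h1 : δ 1 = 0 := by simpa using hδ 1 1
    have h2 := congrArg δ hnn
    rw [hδ, map_smul, h1, smul_zero] at h2
    exact eq_neg_of_add_eq_zero_right h2
  have a1 := hδ1 S hS
  have a2 := hδ1 θ hθ
  have e1 : κ * D (S n) = S v * n - n * S v + v * S n - S n * v := by
    have h := congrArg S hn
    rw [hS, hSκ, zero_mul, zero_add, map_sub, hS, hS, ← hDS] at h
    rw [h]; abel
  -- Since θκ = κ, differentiating the Lax equation by θ leaves the extra term -κ Dn; this is the
  -- source of the asymmetric term tr(v Sn).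
  have e2 : κ * D (θ n) = θ v * n - n * θ v + v * θ n - θ n * v - κ * D n := by
    have h := congrArg θ hn
    rw [hθ, hθκ, map_sub, hθ, hθ, ← hDθ] at h
    rw [eq_sub_iff_add_eq', h]; abel
  have hκ' : ∀ f g, κ * (f * g) = f * (κ * g) := fun f g => by
    rw [← mul_assoc, ← mul_assoc, hκ]
  have e3 : κ * D (n * (S n * θ n - θ n * S n))
      = (v * (n * (S n * θ n - θ n * S n)) - (n * (S n * θ n - θ n * S n)) * v)
        + (n * S v * n * θ n - n * n * S v * θ n)
        + (n * S n * θ v * n - n * S n * n * θ v)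
        - (n * θ v * n * S n - n * n * θ v * S n)
        - (n * θ n * S v * n - n * θ n * n * S v)
        - (n * S n * v * n - n * S n * n * v) + (n * v * n * S n - n * n * v * S n) := by
    have h : κ * D (n * (S n * θ n - θ n * S n))
        = κ * D n * (S n * θ n - θ n * S n) + n * (κ * D (S n) * θ n + S n * (κ * D (θ n))
          - κ * D (θ n) * S n - θ n * (κ * D (S n))) := by
      simp only [hD, map_sub, mul_add, mul_sub, hκ' n, hκ' (S n) (D (θ n)),
        hκ' (θ n) (D (S n)), mul_assoc]
      abel
    rw [h, e1, e2, hn]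
    noncomm_ring
  have c1 : ∀ w u, T (w * u * n) = T (n * w * u) := fun w u => by rw [hT, ← mul_assoc]
  have hq : ∀ w u, T (n * n * w * u) = (1 / 4 : ℝ) • T (w * u) := fun w u => by
    rw [hnn, smul_mul_assoc, one_mul, smul_mul_assoc, map_smul]
  -- Under the trace every word contains n twice. Cyclicity and, where needed, anticommutation bring
  -- the two together, and n² = 1/4 reduces the word to ± one quarter of a pairing.
  have b1 : ∀ w u, n * u = -(u * n) → T (n * w * n * u) = -(1 / 4 : ℝ) • T (w * u) := by
    intro w u hu
    rw [mul_assoc (n * w), hu, mul_neg, map_neg, ← mul_assoc, c1, ← mul_assoc, hq, neg_smul]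
  have b2 : ∀ w u, T (n * u * w * n) = (1 / 4 : ℝ) • T (w * u) := by
    intro w u
    rw [c1, ← mul_assoc, hq, hT]
  have b3 : ∀ w u, n * u = -(u * n) → T (n * u * n * w) = -(1 / 4 : ℝ) • T (w * u) := by
    intro w u hu
    have h : n * u * n = -(n * n * u) := by
      rw [mul_assoc, mul_assoc, hu, mul_neg, neg_neg]
    rw [h, neg_mul, map_neg, hq, neg_smul, hT]
  rw [e3]
  simp only [map_add, map_sub, hq, b1 _ _ a1, b1 _ _ a2, b2, b3 _ _ a1, b3 _ _ a2]
  rw [hT v]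
  module

/-! ### The Lax equation of the formal resolvent matrix -/

section Lax

variable {R : Type*} [Ring R] [Algebra ℝ R]

/-- The entrywise extension of a linear operator to `2 × 2` matrices. -/
def matMap (δ : R →ₗ[ℝ] R) : Matrix (Fin 2) (Fin 2) R →ₗ[ℝ] Matrix (Fin 2) (Fin 2) R :=
  δ.mapMatrix

theorem matMap_of (δ : R →ₗ[ℝ] R) (p q r s : R) :
    matMap δ !![p, q; r, s] = !![δ p, δ q; δ r, δ s] := by
  ext i j
  fin_cases i <;> fin_cases j <;> rfl

theorem matMap_mul (δ : R →ₗ[ℝ] R) (hδ : ∀ f g, δ (f * g) = δ f * g + f * δ g)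
    (f g : Matrix (Fin 2) (Fin 2) R) : matMap δ (f * g) = matMap δ f * g + f * matMap δ g := by
  ext i j
  simp only [matMap, LinearMap.mapMatrix_apply, Matrix.map_apply, Matrix.mul_apply,
    Matrix.add_apply, map_sum, hδ, Finset.sum_add_distrib]

variable (R) in
/-- The constant part of the Lax matrix. -/
def laxZero : Matrix (Fin 2) (Fin 2) R := !![0, 1; 1, 0]

/-- The part of the Lax matrix containing the potential. -/
def laxTwo (q : R) : Matrix (Fin 2) (Fin 2) R := !![0, 0; q, 0]

/-- The rescaled Lax matrix. -/
def laxSeries (q : R) : PowerSeries (Matrix (Fin 2) (Fin 2) R) :=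
  PowerSeries.C (laxZero R) + PowerSeries.C (laxTwo q) * PowerSeries.X ^ 2

/-- The lower left entries of the coefficients of the resolvent matrix. -/
def lowerCoeff (D : R →ₗ[ℝ] R) (q : R) (γ : ℕ → R) : ℕ → R
  | 0 => γ 0
  | k + 1 => γ (k + 1) + (1 / 2 : ℝ) • (q * γ k + γ k * q - D (D (γ k)))

/-- The coefficients of even order of the resolvent matrix. -/
def evenCoeff (D : R →ₗ[ℝ] R) (q : R) (γ : ℕ → R) (k : ℕ) : Matrix (Fin 2) (Fin 2) R :=
  !![0, γ k; lowerCoeff D q γ k, 0]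

/-- The coefficients of odd order of the resolvent matrix. -/
def oddCoeff (D : R →ₗ[ℝ] R) (γ φ : ℕ → R) (k : ℕ) : Matrix (Fin 2) (Fin 2) R :=
  !![(1 / 2 : ℝ) • (φ k - D (γ k)), 0; 0, (1 / 2 : ℝ) • (φ k + D (γ k))]

/-- The rescaled resolvent matrix. -/
def resolvent (D : R →ₗ[ℝ] R) (q : R) (γ φ : ℕ → R) : PowerSeries (Matrix (Fin 2) (Fin 2) R) :=
  PowerSeries.mk fun j => if Even j then evenCoeff D q γ (j / 2) else oddCoeff D γ φ (j / 2)

theorem coeff_resolvent_even (D : R →ₗ[ℝ] R) (q : R) (γ φ : ℕ → R) (k : ℕ) :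
    PowerSeries.coeff (2 * k) (resolvent D q γ φ) = evenCoeff D q γ k := by
  simp [resolvent]

theorem coeff_resolvent_odd (D : R →ₗ[ℝ] R) (q : R) (γ φ : ℕ → R) (k : ℕ) :
    PowerSeries.coeff (2 * k + 1) (resolvent D q γ φ) = oddCoeff D γ φ k := by
  have h : (2 * k + 1) / 2 = k := by omega
  simp [resolvent, h]

theorem coeff_laxSeries_mul {R : Type*} [Ring R] (q : R)
    (f : PowerSeries (Matrix (Fin 2) (Fin 2) R)) (j : ℕ) :
    PowerSeries.coeff (j + 2) (laxSeries q * f)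
      = laxZero R * PowerSeries.coeff (j + 2) f + laxTwo q * PowerSeries.coeff j f := by
  rw [laxSeries, add_mul, map_add, PowerSeries.coeff_C_mul, mul_assoc, PowerSeries.coeff_C_mul,
    PowerSeries.coeff_X_pow_mul]

theorem coeff_mul_laxSeries {R : Type*} [Ring R] (q : R)
    (f : PowerSeries (Matrix (Fin 2) (Fin 2) R)) (j : ℕ) :
    PowerSeries.coeff (j + 2) (f * laxSeries q)
      = PowerSeries.coeff (j + 2) f * laxZero R + PowerSeries.coeff j f * laxTwo q := by
  rw [laxSeries, mul_add, map_add, PowerSeries.coeff_mul_C, ← mul_assoc,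
    PowerSeries.coeff_mul_X_pow, PowerSeries.coeff_mul_C]

theorem coeff_laxSeries_mul_of_lt {R : Type*} [Ring R] (q : R)
    (f : PowerSeries (Matrix (Fin 2) (Fin 2) R)) {j : ℕ}
    (hj : j < 2) : PowerSeries.coeff j (laxSeries q * f) = laxZero R * PowerSeries.coeff j f := by
  rw [laxSeries, add_mul, map_add, PowerSeries.coeff_C_mul, mul_assoc, PowerSeries.coeff_C_mul,
    PowerSeries.coeff_X_pow_mul', if_neg (by omega), mul_zero, add_zero]

theorem coeff_mul_laxSeries_of_lt {R : Type*} [Ring R] (q : R)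
    (f : PowerSeries (Matrix (Fin 2) (Fin 2) R)) {j : ℕ}
    (hj : j < 2) : PowerSeries.coeff j (f * laxSeries q) = PowerSeries.coeff j f * laxZero R := by
  rw [laxSeries, mul_add, map_add, PowerSeries.coeff_mul_C, ← mul_assoc,
    PowerSeries.coeff_mul_X_pow', if_neg (by omega), add_zero]

/-- The relations between the diagonal of a resolvent and its skew derivative. -/
structure IsResolventDiag (D : R →ₗ[ℝ] R) (q : R) (γ φ : ℕ → R) : Prop where
  zero : D (γ 0) = 0
  skew : ∀ k, D (φ k) = q * γ k - γ k * q
  succ : ∀ k, (4 : ℝ) • D (γ (k + 1)) = D (D (D (γ k))) - D (q * γ k) - D (γ k * q)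
    - q * D (γ k) - D (γ k) * q + q * φ k - φ k * q

/-- With spectral parameter λ = -1/X², the equation y'' = (q - λ)y for the vector (y, X y') has
matrix `laxSeries`. Comparing coefficients, the even orders use the commutator relation for φ_k and
the definition of `lowerCoeff`; the lower left entry at odd orders is the recursion for γ_{k+1}. -/
theorem X_mul_psMap_resolvent {D : R →ₗ[ℝ] R}
    (hD : ∀ f g, D (f * g) = D f * g + f * D g) {q : R} {γ φ : ℕ → R}
    (h : IsResolventDiag D q γ φ) :
    PowerSeries.X * psMap (matMap D) (resolvent D q γ φ)
      = laxSeries q * resolvent D q γ φ - resolvent D q γ φ * laxSeries q := by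
  have hsk := h.skew
  have hsu := h.succ
  ext1 j
  rw [map_sub]
  obtain ⟨k, rfl | rfl⟩ := j.even_or_odd'
  · cases k with
    | zero =>
      rw [mul_zero, PowerSeries.coeff_zero_X_mul, coeff_laxSeries_mul_of_lt _ _ (by norm_num),
        coeff_mul_laxSeries_of_lt _ _ (by norm_num)]
      have h0 := coeff_resolvent_even D q γ φ 0
      rw [mul_zero] at h0
      rw [h0]
      ext i j
      fin_cases i <;> fin_cases j <;> simp [laxZero, evenCoeff, lowerCoeff]
    | succ k =>
      have e1 : 2 * (k + 1) = 2 * k + 2 := by ring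
      rw [e1, coeff_laxSeries_mul, coeff_mul_laxSeries, ← e1, coeff_resolvent_even,
        coeff_resolvent_even, e1, PowerSeries.coeff_succ_X_mul, coeff_psMap, coeff_resolvent_odd]
      have hk := hsk k
      ext i j
      fin_cases i <;> fin_cases j <;>
        simp [laxZero, laxTwo, evenCoeff, oddCoeff, lowerCoeff, matMap_of, hk] <;> module
  · rw [PowerSeries.coeff_succ_X_mul, coeff_psMap, coeff_resolvent_even]
    cases k with
    | zero =>
      rw [mul_zero, zero_add, coeff_laxSeries_mul_of_lt _ _ (by norm_num),
        coeff_mul_laxSeries_of_lt _ _ (by norm_num)]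
      have h0 := coeff_resolvent_odd D q γ φ 0
      rw [mul_zero, zero_add] at h0
      rw [h0]
      have hz := h.zero
      ext i j
      fin_cases i <;> fin_cases j <;>
        simp [laxZero, evenCoeff, oddCoeff, lowerCoeff, matMap_of, hz]
    | succ k =>
      have e1 : 2 * (k + 1) + 1 = 2 * k + 1 + 2 := by ring
      rw [e1, coeff_laxSeries_mul, coeff_mul_laxSeries, ← e1, coeff_resolvent_odd,
        coeff_resolvent_odd]
      have hk := hsu k
      ext i j
      fin_cases i <;> fin_cases j <;>
        simp only [laxZero, laxTwo, evenCoeff, oddCoeff, lowerCoeff, matMap_of, map_zero,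
          map_add, map_sub, map_smul, hD, Matrix.mul_fin_two, Matrix.add_apply, Matrix.sub_apply,
          mul_add, mul_sub, add_mul, sub_mul, smul_mul_assoc, mul_smul_comm] at hk ⊢
      · simp
      · simp; module
      · simp
        linear_combination (norm := module) (1 / 2 : ℝ) • hk
      · simp

end Lax

end

noncomputable section

/-! ### The square of the resolvent matrix and its variation -/

section Lax

variable {R : Type*} [Ring R] [Algebra ℝ R]

theorem matMap_comm (δ ε : R →ₗ[ℝ] R) (h : ∀ f, δ (ε f) = ε (δ f))
    (m : Matrix (Fin 2) (Fin 2) R) : matMap δ (matMap ε m) = matMap ε (matMap δ m) :=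
  Matrix.ext fun i j => h (m i j)

theorem laxZero_mul {R : Type*} [Ring R] (m : Matrix (Fin 2) (Fin 2) R) :
    laxZero R * m = !![m 1 0, m 1 1; m 0 0, m 0 1] := by
  ext i j
  fin_cases i <;> fin_cases j <;> simp [laxZero, Matrix.mul_apply, Fin.sum_univ_two]

theorem mul_laxZero {R : Type*} [Ring R] (m : Matrix (Fin 2) (Fin 2) R) :
    m * laxZero R = !![m 0 1, m 0 0; m 1 1, m 1 0] := by
  ext i j
  fin_cases i <;> fin_cases j <;> simp [laxZero, Matrix.mul_apply, Fin.sum_univ_two]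

/-- A solution of the Lax equation whose coefficients are determined by their derivatives is zero,
if its constant term is. -/
theorem eq_zero_of_lax (D : R →ₗ[ℝ] R) {R' : Type*} [AddCommGroup R'] [Module ℝ R']
    (ε : R →ₗ[ℝ] R') (hinj : ∀ r, D r = 0 → ε r = 0 → r = 0) (q : R)
    (f : PowerSeries (Matrix (Fin 2) (Fin 2) R))
    (hf : PowerSeries.X * psMap (matMap D) f = laxSeries q * f - f * laxSeries q)
    (h0 : PowerSeries.coeff 0 f = 0) (hε : ∀ j i l, ε (PowerSeries.coeff j f i l) = 0) :
    f = 0 := by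
  have hlow : ∀ j < 2, ∀ m, j = m + 1 → matMap D (PowerSeries.coeff m f)
      = laxZero R * PowerSeries.coeff j f - PowerSeries.coeff j f * laxZero R := by
    rintro j hj m rfl
    have h := congrArg (PowerSeries.coeff (m + 1)) hf
    rwa [map_sub, coeff_laxSeries_mul_of_lt _ _ hj, coeff_mul_laxSeries_of_lt _ _ hj,
      PowerSeries.coeff_succ_X_mul, coeff_psMap] at h
  have hhigh : ∀ j, matMap D (PowerSeries.coeff (j + 1) f)
      = laxZero R * PowerSeries.coeff (j + 2) f + laxTwo q * PowerSeries.coeff j f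
        - (PowerSeries.coeff (j + 2) f * laxZero R + PowerSeries.coeff j f * laxTwo q) := by
    intro j
    have h := congrArg (PowerSeries.coeff (j + 1 + 1)) hf
    rwa [map_sub, PowerSeries.coeff_succ_X_mul, coeff_psMap, coeff_laxSeries_mul,
      coeff_mul_laxSeries] at h
  -- The potential couples orders j and j + 2, so two consecutive vanishing coefficients are
  -- carried.
  have key : ∀ j, PowerSeries.coeff j f = 0 ∧ PowerSeries.coeff (j + 1) f = 0 := by
    intro j
    induction j with
    | zero =>
      refine ⟨h0, ?_⟩
      have h1 := hlow 1 (by norm_num) 0 rfl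
      have h2 := hhigh 0
      rw [h0, map_zero] at h1
      rw [h0, mul_zero, zero_mul, add_zero, add_zero] at h2
      exact step (PowerSeries.coeff 1 f) (PowerSeries.coeff 2 f) h1 h2 (hε 1)
    | succ j ih =>
      refine ⟨ih.2, ?_⟩
      have h1 := hhigh j
      have h2 := hhigh (j + 1)
      rw [ih.1, ih.2, mul_zero, zero_mul, add_zero, add_zero, map_zero] at h1
      rw [ih.2, mul_zero, zero_mul, add_zero, add_zero] at h2
      exact step _ _ h1 h2 (hε _)
  ext1 j
  rw [(key j).1, map_zero]
where
  step (m m' : Matrix (Fin 2) (Fin 2) R) (h1 : 0 = laxZero R * m - m * laxZero R)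
      (h2 : matMap D m = laxZero R * m' - m' * laxZero R) (hε : ∀ i l, ε (m i l) = 0) : m = 0 := by
    have hhalf : ∀ r s : R, r = s → r = -s → r = 0 := by
      intro r s h3 h4
      have h5 : (2 : ℝ) • r = 0 := by
        rw [two_smul]; nth_rewrite 1 [h4]; rw [h3]; abel
      exact (smul_eq_zero.1 h5).resolve_left two_ne_zero
    have a00 := congrFun (congrFun h1 0) 0
    have a01 := congrFun (congrFun h1 0) 1
    have b00 := congrFun (congrFun h2 0) 0
    have b01 := congrFun (congrFun h2 0) 1
    have b10 := congrFun (congrFun h2 1) 0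
    have b11 := congrFun (congrFun h2 1) 1
    simp [laxZero_mul, mul_laxZero, matMap] at a00 a01 b00 b01 b10 b11
    -- Commuting with `laxZero` forces m = [[α, β], [β, α]]. A commutator with `laxZero` has
    -- opposite entries along either diagonal, so Dα and Dβ equal their own negatives.
    have c1 : m 1 0 = m 0 1 := (sub_eq_zero.1 a00.symm)
    have c2 : m 1 1 = m 0 0 := (sub_eq_zero.1 a01.symm)
    have d0 : D (m 0 0) = 0 :=
      hhalf _ (D (m 1 1)) (by rw [c2]) (by rw [b00, b11]; abel)
    have d1 : D (m 0 1) = 0 :=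
      hhalf _ (D (m 1 0)) (by rw [c1]) (by rw [b01, b10]; abel)
    have e0 := hinj _ d0 (hε 0 0)
    have e1 := hinj _ d1 (hε 0 1)
    ext i l
    fin_cases i <;> fin_cases l <;> simp [e0, e1, c1, c2]

theorem half_laxZero_sq (P : Type*) [Ring P] [Algebra ℝ P] :
    ((1 / 2 : ℝ) • laxZero P) * ((1 / 2 : ℝ) • laxZero P)
      = (1 / 4 : ℝ) • (1 : Matrix (Fin 2) (Fin 2) P) := by
  ext i l
  fin_cases i <;> fin_cases l <;> simp [laxZero, smul_smul] <;> norm_num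

/-- Both n² and 1 satisfy the Lax equation, which is linear, and so does n² - 1/4. Its constant term
vanishes because γ_0 = 1/2, and ε, evaluation at the zero potential, sends n to half of `laxZero`,
whose square is 1/4. The rigidity statement `eq_zero_of_lax` then applies. -/
theorem resolvent_sq {D : R →ₗ[ℝ] R} (hD : ∀ f g, D (f * g) = D f * g + f * D g)
    {R' : Type*} [Ring R'] [Algebra ℝ R'] (D' : R' →ₗ[ℝ] R') (ε : R →ₐ[ℝ] R')
    (hεD : ∀ r, ε (D r) = D' (ε r)) (hinj : ∀ r, D r = 0 → ε r = 0 → r = 0) {q : R} {γ φ : ℕ → R}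
    (h : IsResolventDiag D q γ φ) (hq : ε q = 0) (hγ0 : γ 0 = (1 / 2 : ℝ) • (1 : R))
    (hγ : ∀ k, ε (γ (k + 1)) = 0) (hφ : ∀ k, ε (φ k) = 0) :
    resolvent D q γ φ * resolvent D q γ φ = (1 / 4 : ℝ) • 1 := by
  have hlax := X_mul_psMap_resolvent hD h
  have hD1 : D 1 = 0 := by simpa using hD 1 1
  have hM := psMap_mul (matMap D) (matMap_mul D hD)
  have hM1 : psMap (matMap D) 1 = 0 := by simpa using hM 1 1
  have h0 : PowerSeries.coeff 0 (resolvent D q γ φ) = evenCoeff D q γ 0 := by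
    simpa using coeff_resolvent_even D q γ φ 0
  have hev0 : evenCoeff D q γ 0 = (1 / 2 : ℝ) • laxZero R := by
    ext i l
    fin_cases i <;> fin_cases l <;> simp [evenCoeff, lowerCoeff, laxZero, hγ0]
  have hεDγ : ∀ k, ε (D (γ k)) = 0 := by
    intro k
    cases k with
    | zero => rw [h.zero, map_zero]
    | succ k => rw [hεD, hγ, map_zero]
  set εM : Matrix (Fin 2) (Fin 2) R →+* Matrix (Fin 2) (Fin 2) R' := (ε : R →+* R').mapMatrix
    with hεM
  have hmap : PowerSeries.map εM (resolvent D q γ φ)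
      = PowerSeries.C ((1 / 2 : ℝ) • laxZero R') := by
    ext1 j
    rw [PowerSeries.coeff_map, PowerSeries.coeff_C]
    obtain ⟨k, rfl | rfl⟩ := j.even_or_odd'
    · rw [coeff_resolvent_even]
      cases k with
      | zero =>
        rw [hev0]
        ext i l
        fin_cases i <;> fin_cases l <;> simp [laxZero, hεM]
      | succ k =>
        ext i l
        fin_cases i <;> fin_cases l <;> simp [evenCoeff, lowerCoeff, hγ, hq, hεD (D (γ k)), hεDγ, hεM]
    · rw [coeff_resolvent_odd]
      ext i l
      fin_cases i <;> fin_cases l <;> simp [oddCoeff, hφ, hεDγ, hεM]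
  refine sub_eq_zero.1 (eq_zero_of_lax D ε.toLinearMap hinj q _ ?_ ?_ ?_)
  · have hXc : ∀ f : PowerSeries (Matrix (Fin 2) (Fin 2) R),
        PowerSeries.X * (resolvent D q γ φ * f) = resolvent D q γ φ * (PowerSeries.X * f) :=
      fun f => by rw [← mul_assoc, ← mul_assoc, PowerSeries.X_mul]
    rw [map_sub, map_smul, hM1, smul_zero, sub_zero, hM, mul_add, ← mul_assoc, hXc, hlax,
      mul_sub (laxSeries q), sub_mul _ _ (laxSeries q), mul_smul_comm, smul_mul_assoc, mul_one,
      one_mul]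
    noncomm_ring
  · rw [map_sub, PowerSeries.coeff_mul]
    simp only [Finset.Nat.antidiagonal_zero, Finset.sum_singleton, h0, hev0]
    rw [half_laxZero_sq]
    simp
  · intro j i l
    have h2 : PowerSeries.map εM
        (resolvent D q γ φ * resolvent D q γ φ - (1 / 4 : ℝ) • 1) = 0 := by
      have h3 : PowerSeries.map εM ((1 / 4 : ℝ) • 1)
          = (1 / 4 : ℝ) • 1 := by
        ext j i l
        by_cases hj : j = 0 <;> by_cases hil : i = l <;>
          simp [PowerSeries.coeff_one, hεM, hj, hil]
      rw [map_sub, map_mul, hmap, h3, ← map_mul, half_laxZero_sq]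
      ext j i l
      simp [PowerSeries.coeff_one, PowerSeries.coeff_C]
    have h4 := congrArg (PowerSeries.coeff j) h2
    rw [PowerSeries.coeff_map] at h4
    exact congrFun (congrFun h4 i) l

/-- The trace of the derivative of the diagonal of a resolvent along a deformation `S`. -/
theorem resolvent_variation {D S : R →ₗ[ℝ] R} (hD : ∀ f g, D (f * g) = D f * g + f * D g)
    (hS : ∀ f g, S (f * g) = S f * g + f * S g) (hDS : ∀ f, D (S f) = S (D f))
    {B : Type*} [AddCommGroup B] [Module ℝ B] (t : R →ₗ[ℝ] B) (ht : ∀ f g, t (f * g) = t (g * f))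
    {q : R} {γ φ : ℕ → R} (h : IsResolventDiag D q γ φ)
    (hsq : resolvent D q γ φ * resolvent D q γ φ = (1 / 4 : ℝ) • 1) (k : ℕ) :
    ∃ w : R, (2 : ℝ) • t (S (γ (k + 1))) + (2 * (k : ℝ) + 1) • t (S q * γ k) = t (D w) := by
  -- The abstract trace is t of the 2 × 2 matrix trace, taken in every order at once; it is cyclic
  -- because t is.
  set T : PowerSeries (Matrix (Fin 2) (Fin 2) R) →ₗ[ℝ] (ℕ → B) :=
    { toFun := fun f j => t (PowerSeries.coeff j f 0 0 + PowerSeries.coeff j f 1 1)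
      map_add' := fun f g => funext fun j => by
        simp only [map_add, Matrix.add_apply, Pi.add_apply]; abel
      map_smul' := fun c f => funext fun j => by simp } with hT
  have hTa : ∀ f j, T f j = t (PowerSeries.coeff j f 0 0 + PowerSeries.coeff j f 1 1) :=
    fun _ _ => rfl
  have hm : ∀ m m' : Matrix (Fin 2) (Fin 2) R,
      t ((m * m') 0 0 + (m * m') 1 1) = t ((m' * m) 0 0 + (m' * m) 1 1) := by
    intro m m'
    simp only [Matrix.mul_apply, Fin.sum_univ_two, map_add]
    rw [ht (m 0 0), ht (m 0 1), ht (m 1 0), ht (m 1 1)]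
    abel
  have hTm : ∀ f g, T (f * g) = T (g * f) := by
    intro f g
    funext j
    have h1 : ∀ f g : PowerSeries (Matrix (Fin 2) (Fin 2) R), T (f * g) j
        = ∑ p ∈ Finset.HasAntidiagonal.antidiagonal j, t ((PowerSeries.coeff p.1 f * PowerSeries.coeff p.2 g) 0 0
          + (PowerSeries.coeff p.1 f * PowerSeries.coeff p.2 g) 1 1) := by
      intro f g
      rw [hTa, PowerSeries.coeff_mul, Matrix.sum_apply, Matrix.sum_apply,
        ← Finset.sum_add_distrib, map_sum]
    rw [h1, h1, ← Finset.Nat.sum_antidiagonal_swap]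
    exact Finset.sum_congr rfl fun p _ => hm _ _
  have hX1 : psMap (matMap S) PowerSeries.X = 0 := by
    have hS1 : matMap S 1 = 0 := by simpa using matMap_mul S hS 1 1
    ext1 j
    rw [coeff_psMap, PowerSeries.coeff_X]
    split_ifs <;> simp [hS1]
  have hX2 : psEuler (Matrix (Fin 2) (Fin 2) R) PowerSeries.X = PowerSeries.X := by
    ext1 j
    rw [coeff_psEuler, PowerSeries.coeff_X]
    split_ifs with hj <;> simp [hj]
  set n := resolvent D q γ φ with hn
  have hid := trace_variation (psMap (matMap D)) (psMap (matMap S)) (psEuler _)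
    (psMap_mul _ (matMap_mul D hD)) (psMap_mul _ (matMap_mul S hS)) psEuler_mul
    (psMap_comm _ _ (matMap_comm _ _ hDS)) (psEuler_psMap _) T hTm PowerSeries.X n (laxSeries q)
    (fun f => PowerSeries.X_mul.symm) hX1 hX2 (X_mul_psMap_resolvent hD h) hsq
  set W := n * (psMap (matMap S) n * psEuler _ n - psEuler _ n * psMap (matMap S) n)
  -- Order 2k+2 is the one where γ_{k+1} first meets γ_k. The Euler operator contributes the factor
  -- 2k on n_{2k} and 2 on the potential part of v, whence the 2k+1 of the result.
  have hk := congrFun hid (2 * k + 1 + 1)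
  have hSv : psMap (matMap S) (laxSeries q)
      = PowerSeries.C (laxTwo (S q)) * PowerSeries.X ^ 2 := by
    have hS1 : S 1 = 0 := by simpa using hS 1 1
    ext1 j
    rw [coeff_psMap, laxSeries, map_add, map_add, PowerSeries.coeff_C_mul, PowerSeries.coeff_C_mul,
      PowerSeries.coeff_C, PowerSeries.coeff_X_pow]
    have hz : (!![0, 0; 0, 0] : Matrix (Fin 2) (Fin 2) R) = 0 := by
      ext i l
      fin_cases i <;> fin_cases l <;> rfl
    split_ifs <;> simp [laxZero, laxTwo, matMap_of, hS1, hz]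
  have hθv : psEuler _ (laxSeries q)
      = PowerSeries.C ((2 : ℝ) • laxTwo q) * PowerSeries.X ^ 2 := by
    ext1 j
    rw [coeff_psEuler, laxSeries, map_add, PowerSeries.coeff_C_mul, PowerSeries.coeff_C_mul,
      PowerSeries.coeff_C, PowerSeries.coeff_X_pow]
    rcases eq_or_ne j 0 with rfl | h0
    · simp
    · by_cases h2 : j = 2 <;> simp [h0, h2]
  have hCX : ∀ (m : Matrix (Fin 2) (Fin 2) R) (f : PowerSeries (Matrix (Fin 2) (Fin 2) R)),
      PowerSeries.coeff (2 * k + 1 + 1) (PowerSeries.C m * PowerSeries.X ^ 2 * f)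
        = m * PowerSeries.coeff (2 * k) f := by
    intro m f
    rw [mul_assoc, PowerSeries.coeff_C_mul, show 2 * k + 1 + 1 = 2 * k + 2 from rfl,
      PowerSeries.coeff_X_pow_mul]
  have hev : ∀ k, matMap S (evenCoeff D q γ k) = !![0, S (γ k); S (lowerCoeff D q γ k), 0] := by
    intro k
    rw [evenCoeff, matMap_of, map_zero]
  rw [Pi.sub_apply, Pi.sub_apply, hTa, hTa, hTa, hTa, hSv, hθv, hCX, hCX, coeff_laxSeries_mul,
    PowerSeries.coeff_succ_X_mul, coeff_psMap, coeff_psMap, coeff_psMap, coeff_psEuler,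
    coeff_resolvent_even, hev, show 2 * k + 2 = 2 * (k + 1) by ring,
    coeff_resolvent_even, hev] at hk
  -- The first term accounts for the second derivative of γ_k in `lowerCoeff`, the second is the
  -- trace of the primitive W. The terms t(q Sγ_k) cancel.
  refine ⟨(1 / 2 : ℝ) • D (S (γ k)) - (PowerSeries.coeff (2 * k + 1) W 0 0
    + PowerSeries.coeff (2 * k + 1) W 1 1), ?_⟩
  have hk1 : matMap D (PowerSeries.coeff (2 * k + 1) W) 0 0
      + matMap D (PowerSeries.coeff (2 * k + 1) W) 1 1
      = D (PowerSeries.coeff (2 * k + 1) W 0 0 + PowerSeries.coeff (2 * k + 1) W 1 1) :=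
    (map_add D _ _).symm
  rw [hk1] at hk
  simp [laxZero, laxTwo, evenCoeff, lowerCoeff, Matrix.mul_apply, hS] at hk
  rw [map_sub, map_sub, map_smul, map_smul, map_add, map_add, hk, hDS, hDS]
  rw [ht (γ k) (S q), ht (S (γ k)) q]
  module

end Lax

end

noncomputable section

variable {a : ℝ} {N : ℕ}

/-! ### The formal resolvent of the diagonal values -/

/-- The ratio between the diagonal values of the heat kernel and of the resolvent. -/
def resCoeff (k : ℕ) : ℝ :=
  1 / 2 * (-1 / 4) ^ k * ((Nat.factorial (2 * k) : ℝ) / Nat.factorial k)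

theorem factorial_two_mul_succ (k : ℕ) :
    (Nat.factorial (2 * (k + 1)) : ℝ) / Nat.factorial (k + 1)
      = 2 * (2 * k + 1) * ((Nat.factorial (2 * k) : ℝ) / Nat.factorial k) := by
  have h1 : (Nat.factorial k : ℝ) ≠ 0 := by positivity
  rw [show 2 * (k + 1) = 2 * k + 1 + 1 by ring, Nat.factorial_succ, Nat.factorial_succ,
    Nat.factorial_succ]
  push_cast
  field_simp
  ring

/-- The ratio is chosen so that the factors 2k+1 and -1/2 of the heat recursion turn into the
constant 4 of `IsResolventDiag`. -/
theorem resCoeff_succ (k : ℕ) : resCoeff (k + 1) = -(1 / 2) * (2 * k + 1) * resCoeff k := by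
  rw [resCoeff, resCoeff, factorial_two_mul_succ, pow_succ]
  ring

theorem resCoeff_ne_zero (k : ℕ) : resCoeff k ≠ 0 := by
  rw [resCoeff]
  have h1 : (Nat.factorial k : ℝ) ≠ 0 := by positivity
  have h2 : (Nat.factorial (2 * k) : ℝ) ≠ 0 := by positivity
  have h3 : ((-1 : ℝ) / 4) ^ k ≠ 0 := pow_ne_zero _ (by norm_num)
  positivity

/-- The diagonal values of the resolvent. -/
def resDiag (k : ℕ) : regularFields a N := resCoeff k • regDiag k

/-- The skew derivatives of the resolvent on the diagonal. -/
def resSkew (k : ℕ) : regularFields a N := resCoeff k • regSkew k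

theorem regE_smul (c : ℝ) (g ψ : regularFields a N) : regE (c • g) (c • ψ) = c • regE g ψ := by
  simp only [regE, map_smul, mul_smul_comm, smul_mul_assoc]
  module

theorem regD_one : regD (1 : regularFields a N) = 0 := by
  simpa using regD_mul (1 : regularFields a N) 1

theorem isResolventDiag : IsResolventDiag regD (regQ : regularFields a N) resDiag resSkew where
  zero := by rw [resDiag, map_smul, regDiag_zero, regD_one, smul_zero]
  skew k := by
    rw [resSkew, resDiag, map_smul, regD_regSkew, mul_smul_comm, smul_mul_assoc]
    exact smul_sub _ _ _
  succ k := by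
    have h : (4 : ℝ) • regD (resDiag (k + 1) : regularFields a N)
        = regE (resDiag k) (resSkew k) := by
      have h1 := congrArg (fun f => (-2 * resCoeff k) • f) (regD_regDiag_succ (a := a) (N := N) k)
      simp only [smul_smul] at h1
      rw [resDiag, resDiag, resSkew, regE_smul, map_smul, smul_smul, resCoeff_succ]
      convert h1 using 2
      · ring
      · ring
    exact h

theorem evalPot_zeroPot_resSkew (k : ℕ) : evalPot zeroPot (resSkew k : regularFields a N) = 0 := by
  rw [resSkew, map_smul, evalPot_zeroPot_of_mem _ (skewField_mem k), smul_zero]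

theorem evalPot_zeroPot_resDiag (k : ℕ) :
    evalPot zeroPot (resDiag (k + 1) : regularFields a N) = 0 := by
  rw [resDiag, map_smul, evalPot_zeroPot_of_mem _ (diagField_succ_mem k), smul_zero]

theorem regField_resolvent_sq (ha : 0 < a) :
    resolvent regD (regQ : regularFields a N) resDiag resSkew
      * resolvent regD (regQ : regularFields a N) resDiag resSkew = (1 / 4 : ℝ) • 1 := by
  refine resolvent_sq (R := regularFields a N) (R' := smoothAlg ℝ (Mat N)) regD_mul dOne (evalPot zeroPot) (evalPot_regD zeroPot)
    (eq_zero_of_regD_eq_zero ha) isResolventDiag rfl ?_ evalPot_zeroPot_resDiag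
    evalPot_zeroPot_resSkew
  rw [resDiag, regDiag_zero]
  congr 1
  simp [resCoeff]

/-! ### Smooth families -/

variable (a N) in
/-- Smooth functions of two variables that are periodic in the second one. -/
def perAlg : Subalgebra ℝ (smoothAlg (ℝ × ℝ) (Mat N)) where
  carrier := {f | ∀ p : ℝ × ℝ, f.1 (p + (0, 2 * Real.pi * a)) = f.1 p}
  mul_mem' hf hg p := congrArg₂ (· * ·) (hf p) (hg p)
  add_mem' hf hg p := congrArg₂ (· + ·) (hf p) (hg p)
  algebraMap_mem' _ _ := rfl

theorem dirDeriv_mem_perAlg (v : ℝ × ℝ) (f : smoothAlg (ℝ × ℝ) (Mat N)) (hf : f ∈ perAlg a N) :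
    dirDeriv v f ∈ perAlg a N := fun p => by
  have h1 : (fun p => f.1 (p + (0, 2 * Real.pi * a))) = f.1 := funext hf
  rw [dirDeriv_apply, dirDeriv_apply, ← fderiv_comp_add_right, h1]

/-- The directional derivative on periodic functions. -/
def perDeriv (v : ℝ × ℝ) : perAlg a N →ₗ[ℝ] perAlg a N :=
  ((dirDeriv v).comp (perAlg a N).val.toLinearMap).codRestrict
    (Subalgebra.toSubmodule (perAlg a N)) fun f => dirDeriv_mem_perAlg v f.1 f.2

theorem perDeriv_mul (v : ℝ × ℝ) (f g : perAlg a N) :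
    perDeriv v (f * g) = perDeriv v f * g + f * perDeriv v g :=
  Subtype.ext (dirDeriv_mul v f.1 g.1)

theorem perDeriv_comm (v w : ℝ × ℝ) (f : perAlg a N) :
    perDeriv v (perDeriv w f) = perDeriv w (perDeriv v f) :=
  Subtype.ext (dirDeriv_comm v w f.1)

/-- The restriction of a regular field to a smooth family of potentials, as a periodic function. -/
def perEval (γ : ℝ → Potential a N) (hγ : ContDiff ℝ ∞ (fun p : ℝ × ℝ => γ p.1 p.2)) :
    regularFields a N →ₐ[ℝ] perAlg a N :=
  (evalFamily γ hγ).codRestrict (perAlg a N) fun g p => by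
    have h := g.2.2.1 (γ p.1) p.2
    change g.1 (γ (p.1 + 0)) (p.2 + 2 * Real.pi * a) = g.1 (γ p.1) p.2
    rw [add_zero, h]

theorem perEval_regD (γ : ℝ → Potential a N) (hγ : ContDiff ℝ ∞ (fun p : ℝ × ℝ => γ p.1 p.2))
    (g : regularFields a N) : perEval γ hγ (regD g) = perDeriv (0, 1) (perEval γ hγ g) :=
  Subtype.ext (evalFamily_regD γ hγ g)

/-- The trace as a continuous linear map. -/
def traceCLM (N : ℕ) : Mat N →L[ℝ] ℝ :=
  LinearMap.toContinuousLinearMap (Matrix.traceLinearMap (Fin N) ℝ ℝ)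

theorem traceCLM_apply (A : Mat N) : traceCLM N A = A.trace := rfl

/-- The pointwise trace. -/
def perTrace : perAlg a N →ₗ[ℝ] (ℝ × ℝ → ℝ) where
  toFun f p := (f.1.1 p).trace
  map_add' f g := funext fun p => Matrix.trace_add (f.1.1 p) (g.1.1 p)
  map_smul' c f := funext fun p => Matrix.trace_smul c (f.1.1 p)

theorem perTrace_mul (f g : perAlg a N) : perTrace (f * g) = perTrace (g * f) :=
  funext fun p => Matrix.trace_mul_comm (f.1.1 p) (g.1.1 p)

/-- The relation n² = 1/4 is proved for universal fields, where D is injective modulo the value at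
zero; evaluation along a given family loses that injectivity, so the relation is transported by the
homomorphism. -/
theorem map_resolvent {R R' : Type*} [Ring R] [Algebra ℝ R] [Ring R'] [Algebra ℝ R']
    {D : R →ₗ[ℝ] R} {D' : R' →ₗ[ℝ] R'} (f : R →ₐ[ℝ] R') (hf : ∀ r, f (D r) = D' (f r)) {q : R}
    {γ φ : ℕ → R} (hsq : resolvent D q γ φ * resolvent D q γ φ = (1 / 4 : ℝ) • 1) :
    resolvent D' (f q) (fun k => f (γ k)) (fun k => f (φ k))
      * resolvent D' (f q) (fun k => f (γ k)) (fun k => f (φ k)) = (1 / 4 : ℝ) • 1 := by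
  set fM : Matrix (Fin 2) (Fin 2) R →+* Matrix (Fin 2) (Fin 2) R' := (f : R →+* R').mapMatrix
    with hfM
  have h1 : PowerSeries.map fM (resolvent D q γ φ)
      = resolvent D' (f q) (fun k => f (γ k)) (fun k => f (φ k)) := by
    ext1 j
    rw [PowerSeries.coeff_map]
    obtain ⟨k, rfl | rfl⟩ := j.even_or_odd'
    · rw [coeff_resolvent_even, coeff_resolvent_even]
      ext i l
      fin_cases i <;> fin_cases l <;> cases k <;>
        simp [evenCoeff, lowerCoeff, hfM, hf]
    · rw [coeff_resolvent_odd, coeff_resolvent_odd]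
      ext i l
      fin_cases i <;> fin_cases l <;> simp [oddCoeff, hfM, hf]
  rw [← h1, ← map_mul, hsq]
  ext j i l
  by_cases hj : j = 0 <;> by_cases hil : i = l <;> simp [PowerSeries.coeff_one, hfM, hj, hil]

theorem IsResolventDiag.map {R R' : Type*} [Ring R] [Algebra ℝ R] [Ring R'] [Algebra ℝ R']
    {D : R →ₗ[ℝ] R} {D' : R' →ₗ[ℝ] R'} (f : R →ₐ[ℝ] R') (hf : ∀ r, f (D r) = D' (f r)) {q : R}
    {γ φ : ℕ → R} (h : IsResolventDiag D q γ φ) :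
    IsResolventDiag D' (f q) (fun k => f (γ k)) (fun k => f (φ k)) where
  zero := by rw [← hf, h.zero, map_zero]
  skew k := by rw [← hf, h.skew, map_sub, map_mul, map_mul]
  succ k := by
    rw [← hf, ← map_smul, h.succ]
    simp only [map_add, map_sub, map_mul, hf]

/-- This is `resolvent_variation` with S = ∂_s on a smooth family. By `resCoeff_succ` both terms
carry the common factor (2k+1) `resCoeff k`, with opposite signs, which is divided out. -/
theorem trace_deriv_diag (ha : 0 < a) (γ : ℝ → Potential a N)
    (hγ : ContDiff ℝ ∞ (fun p : ℝ × ℝ => γ p.1 p.2)) (k : ℕ) :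
    ∃ w : perAlg a N, perTrace (perDeriv (1, 0) (perEval γ hγ (regDiag (k + 1))))
      = perTrace (perDeriv (1, 0) (perEval γ hγ regQ) * perEval γ hγ (regDiag k))
        + perTrace (perDeriv (0, 1) w) := by
  have hf := perEval_regD γ hγ
  have hdiag : IsResolventDiag (perDeriv (a := a) (N := N) (0, 1)) (perEval γ hγ regQ)
      (fun k => perEval γ hγ (resDiag k)) (fun k => perEval γ hγ (resSkew k)) :=
    IsResolventDiag.map (R := regularFields a N) (R' := perAlg a N) (D := regD)
      (D' := perDeriv (0, 1)) (perEval γ hγ) hf (isResolventDiag (a := a) (N := N))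
  have hsq := map_resolvent (R := regularFields a N) (R' := perAlg a N) (D := regD)
    (D' := perDeriv (a := a) (N := N) (0, 1))
    (perEval γ hγ) hf
    (regField_resolvent_sq ha)
  have hv := resolvent_variation (R := perAlg a N) (S := perDeriv (a := a) (N := N) (1, 0))
    (perDeriv_mul (0, 1))
    (perDeriv_mul (1, 0)) (perDeriv_comm (0, 1) (1, 0)) perTrace perTrace_mul hdiag
  obtain ⟨w, hw⟩ := hv hsq k
  have hc := resCoeff_ne_zero k
  have hk : (2 * (k : ℝ) + 1) ≠ 0 := by positivity
  refine ⟨(-((2 * (k : ℝ) + 1) * resCoeff k)⁻¹) • w, ?_⟩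
  simp only [resDiag, map_smul, mul_smul_comm] at hw
  rw [map_smul, map_smul, ← hw, resCoeff_succ]
  simp only [smul_add, smul_smul]
  have e1 : -((2 * (k : ℝ) + 1) * resCoeff k)⁻¹ * (2 * (-(1 / 2) * (2 * k + 1) * resCoeff k))
      = 1 := by field_simp
  have e2 : -((2 * (k : ℝ) + 1) * resCoeff k)⁻¹ * ((2 * k + 1) * resCoeff k) = -1 := by field_simp
  rw [e1, e2]
  module

end

noncomputable section

variable {a : ℝ} {N : ℕ}

/-! ### Variational derivatives -/

theorem continuous_trace_coe {H : Type} [NormedAddCommGroup H] [NormedSpace ℝ H]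
    (f : smoothAlg H (Mat N)) : Continuous fun p => (f.1 p).trace :=
  (traceCLM N).continuous.comp (smoothAlg_contDiff f).continuous

theorem integral_perTrace_deriv (w : perAlg a N) (s : ℝ) :
    ∫ x in (0 : ℝ)..(2 * Real.pi * a), perTrace (perDeriv (0, 1) w) (s, x) = 0 := by
  have hd : ∀ x ∈ uIcc 0 (2 * Real.pi * a), HasDerivAt (fun x => (w.1.1 (s, x)).trace)
      (perTrace (perDeriv (0, 1) w) (s, x)) x := fun x _ =>
    (traceCLM N).hasFDerivAt.comp_hasDerivAt x (hasDerivAt_slice_snd w.1 s x)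
  have hc : Continuous fun x => perTrace (perDeriv (0, 1) w) (s, x) :=
    (continuous_trace_coe (dirDeriv (0, 1) w.1)).comp (by fun_prop)
  rw [intervalIntegral.integral_eq_sub_of_hasDerivAt hd (hc.intervalIntegrable _ _)]
  have h := w.2 (s, 0)
  simp only [Prod.mk_add_mk, add_zero, zero_add] at h
  rw [h, sub_self]

theorem heatInvariant_succ_eq (k : ℕ) (Q : Potential a N) :
    heatInvariant (k + 1) Q = (Nat.factorial (k + 1) : ℝ) *
      ∫ x in (0 : ℝ)..(2 * Real.pi * a), (diagField (k + 1) Q x).trace := by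
  rw [heatInvariant, heatDiag_eq, ← intervalIntegral.integral_const_mul]
  refine intervalIntegral.integral_congr fun x _ => ?_
  change ((Nat.factorial (k + 1) : ℝ) • diagField (k + 1) Q x).trace = _
  rw [Matrix.trace_smul]
  rfl

/-- After differentiation under the integral, the total derivative from `trace_deriv_diag`
integrates to zero by periodicity, and (k+1)! γ_k is (k+1)[a_k]. -/
theorem hasDerivAt_heatInvariant (ha : 0 < a) (γ : ℝ → Potential a N)
    (hγ : ContDiff ℝ ∞ (fun p : ℝ × ℝ => γ p.1 p.2)) (k : ℕ) (s : ℝ) :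
    HasDerivAt (fun σ => heatInvariant (k + 1) (γ σ))
      (∫ x in (0 : ℝ)..(2 * Real.pi * a),
        (deriv (fun σ => γ σ x) s * (((k : ℝ) + 1) • heatDiag k) (γ s) x).trace) s := by
  simp only [heatInvariant_succ_eq]
  set f := evalFamily γ hγ (regDiag (k + 1)) with hf
  have h1 : HasDerivAt (fun σ => ∫ x in (0 : ℝ)..(2 * Real.pi * a), (f.1 (σ, x)).trace)
      (∫ x in (0 : ℝ)..(2 * Real.pi * a), ((dirDeriv (1, 0) f).1 (s, x)).trace) s := by
    refine hasDerivAt_intervalIntegral_param (F := fun σ x => (f.1 (σ, x)).trace)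
      (F' := fun σ x => ((dirDeriv (1, 0) f).1 (σ, x)).trace) isOpen_univ (mem_univ s) _ _
      (fun σ _ => (continuous_trace_coe f).comp (by fun_prop))
      (continuous_trace_coe (dirDeriv (1, 0) f)).continuousOn (fun σ _ x => ?_)
    exact (traceCLM N).hasFDerivAt.comp_hasDerivAt σ (hasDerivAt_slice_fst f σ x)
  refine (h1.const_mul (Nat.factorial (k + 1) : ℝ)).congr_deriv ?_
  obtain ⟨w, hw⟩ := trace_deriv_diag ha γ hγ k
  have h2 : ∀ x, ((dirDeriv (1, 0) f).1 (s, x)).trace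
      = (deriv (fun σ => γ σ x) s * diagField k (γ s) x).trace
        + perTrace (perDeriv (0, 1) w) (s, x) := by
    intro x
    have h3 := congrFun hw (s, x)
    have h4 : deriv (fun σ => γ σ x) s = (dirDeriv (1, 0) (evalFamily γ hγ regQ)).1 (s, x) :=
      (hasDerivAt_slice_fst (evalFamily γ hγ regQ) s x).deriv
    rw [h4]
    exact h3
  have hc1 : Continuous fun x => ((dirDeriv (1, 0) f).1 (s, x)).trace :=
    (continuous_trace_coe (dirDeriv (1, 0) f)).comp (by fun_prop)
  have hc2 : Continuous fun x => perTrace (perDeriv (0, 1) w) (s, x) :=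
    (continuous_trace_coe (dirDeriv (0, 1) w.1)).comp (by fun_prop)
  have h5 : ∀ x, (deriv (fun σ => γ σ x) s * (((k : ℝ) + 1) • heatDiag k) (γ s) x).trace
      = (Nat.factorial (k + 1) : ℝ) * (((dirDeriv (1, 0) f).1 (s, x)).trace
        - perTrace (perDeriv (0, 1) w) (s, x)) := by
    intro x
    rw [h2, add_sub_cancel_right, heatDiag_eq, smul_smul, Nat.factorial_succ]
    push_cast
    change (_ * ((((k : ℝ) + 1) * (Nat.factorial k : ℝ)) • diagField k (γ s) x)).trace = _
    rw [Matrix.mul_smul, Matrix.trace_smul]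
    rfl
  simp only [h5]
  rw [intervalIntegral.integral_const_mul, intervalIntegral.integral_sub
    (hc1.intervalIntegrable _ _) (hc2.intervalIntegrable _ _), integral_perTrace_deriv, sub_zero]

/-- Near each point of an open set, a smooth family on the set extends to a smooth family on the
line. -/
theorem exists_reparam {S : Set ℝ} (hS : IsOpen S) {s : ℝ} (hs : s ∈ S) :
    ∃ ρ : ℝ → ℝ, ContDiff ℝ ∞ ρ ∧ (∀ σ, ρ σ ∈ S) ∧ ∀ᶠ σ in 𝓝 s, ρ σ = σ := by
  obtain ⟨r, hr, hball⟩ := Metric.isOpen_iff.1 hS s hs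
  let f : ContDiffBump s := ⟨r / 2, r, by positivity, by linarith⟩
  refine ⟨fun σ => s + f σ * (σ - s), ?_, fun σ => hball ?_, ?_⟩
  · have hf : ContDiff ℝ ∞ f := f.contDiff
    fun_prop
  · change s + f σ * (σ - s) ∈ Metric.ball s r
    by_cases hσ : σ ∈ Metric.ball s r
    · rw [Metric.mem_ball, Real.dist_eq, add_sub_cancel_left, abs_mul, abs_of_nonneg f.nonneg]
      rw [Metric.mem_ball, Real.dist_eq] at hσ
      exact (mul_le_of_le_one_left (abs_nonneg _) f.le_one).trans_lt hσ
    · have h0 : f σ = 0 := f.zero_of_le_dist (by simpa using hσ)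
      rw [h0]
      simpa using hr
  · filter_upwards [f.eventuallyEq_one] with σ hσ
    rw [hσ]
    simp

theorem hasVarDeriv_heatInvariant (ha : 0 < a) (Q : Potential a N) (k : ℕ) :
    HasVarDeriv (heatInvariant (k + 1)) Q ((((k : ℝ) + 1) • heatDiag k : FieldMap a N) Q) := by
  have he : ((((k : ℝ) + 1) • heatDiag k : FieldMap a N) Q)
      = (evalPot Q ((((k : ℝ) + 1) * Nat.factorial k) • regDiag k)).1 := by
    rw [heatDiag_eq, smul_smul]
    rfl
  refine ⟨?_, ?_, fun x => (heatDiag_isSymm ha k Q x).smul ((k : ℝ) + 1), ?_⟩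
  · rw [he]
    exact smoothAlg_contDiff _
  · rw [he]
    exact ((((k : ℝ) + 1) * Nat.factorial k) • regDiag k : regularFields a N).2.2.1 Q
  · rintro S γ ⟨hS, hγ⟩ s hs rfl
    -- A family smooth only for parameters in `S` is reparametrised to one smooth on the whole line
    -- and unchanged near s.
    obtain ⟨ρ, hρ, hρS, hρs⟩ := exists_reparam hS hs
    have hγ' : ContDiff ℝ ∞ (fun p : ℝ × ℝ => γ (ρ p.1) p.2) :=
      hγ.comp_contDiff ((hρ.comp contDiff_fst).prodMk contDiff_snd)
        fun p => ⟨hρS p.1, mem_univ _⟩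
    have h := hasDerivAt_heatInvariant ha (fun σ => γ (ρ σ)) hγ' k s
    have hss : ρ s = s := hρs.self_of_nhds
    have hd : ∀ x, deriv (fun σ => γ (ρ σ) x) s = deriv (fun σ => γ σ x) s := fun x =>
      Filter.EventuallyEq.deriv_eq (hρs.mono fun σ hσ => by
        change γ (ρ σ) x = γ σ x
        rw [hσ])
    simp only [hss, hd] at h
    exact h.congr_of_eventuallyEq (hρs.mono fun σ hσ => by
      change heatInvariant (k + 1) (γ σ) = heatInvariant (k + 1) (γ (ρ σ))
      rw [hσ])

theorem hasVarDeriv_heatInvariant_zero (Q : Potential a N) :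
    HasVarDeriv (heatInvariant 0) Q 0 := by
  have h0 : ContDiff ℝ ∞ (0 : ℝ → Mat N) := smoothAlg_contDiff (0 : smoothAlg ℝ (Mat N))
  refine ⟨h0, fun _ => rfl,
    fun _ => Matrix.isSymm_zero, ?_⟩
  intro S γ _ s _ _
  simp only [Pi.zero_apply, mul_zero, Matrix.trace_zero, intervalIntegral.integral_zero]
  exact hasDerivAt_const s (∫ _ in (0 : ℝ)..(2 * Real.pi * a), (1 : Mat N).trace)

/-! ### Uniqueness of variational derivatives -/

theorem trace_mul_self_nonneg {K : Mat N} (hK : K.IsSymm) : 0 ≤ (K * K).trace := by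
  rw [Matrix.trace]
  refine Finset.sum_nonneg fun i _ => ?_
  rw [Matrix.diag_apply, Matrix.mul_apply]
  refine Finset.sum_nonneg fun j _ => ?_
  rw [hK.apply i j]
  exact mul_self_nonneg _

theorem eq_zero_of_trace_mul_self {K : Mat N} (hK : K.IsSymm) (h : (K * K).trace = 0) : K = 0 := by
  have h1 : ∀ i ∈ Finset.univ, 0 ≤ (K * K).diag i := fun i _ => by
    rw [Matrix.diag_apply, Matrix.mul_apply]
    refine Finset.sum_nonneg fun j _ => ?_
    rw [hK.apply i j]
    exact mul_self_nonneg _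
  ext i j
  have h2 := (Finset.sum_eq_zero_iff_of_nonneg h1).1 h i (Finset.mem_univ i)
  rw [Matrix.diag_apply, Matrix.mul_apply, Finset.sum_eq_zero_iff_of_nonneg
    (fun j _ => by rw [hK.apply i j]; exact mul_self_nonneg _)] at h2
  have h3 := h2 j (Finset.mem_univ j)
  rw [hK.apply i j] at h3
  simpa using h3

theorem Potential.ext_toFun {Q Q' : Potential a N} (h : Q.toFun = Q'.toFun) : Q = Q' := by
  cases Q
  cases Q'
  subst h
  rfl

/-- The difference K of two candidates is itself symmetric and periodic, so Q + sK is an admissible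
family. Comparing the two derivatives at s = 0 gives ∫ tr K² = 0, hence K = 0. -/
theorem HasVarDeriv.unique (ha : 0 < a) {H : Potential a N → ℝ} {Q : Potential a N}
    {G G' : ℝ → Mat N} (hG : HasVarDeriv H Q G) (hG' : HasVarDeriv H Q G') : G = G' := by
  have hl : 0 < 2 * Real.pi * a := by positivity
  set g : smoothAlg ℝ (Mat N) := ⟨G, hG.smooth⟩
  set g' : smoothAlg ℝ (Mat N) := ⟨G', hG'.smooth⟩
  set K := g - g' with hK
  have hKs : ∀ x, (K.1 x).IsSymm := fun x => (hG.symm x).sub (hG'.symm x)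
  have hKp : Function.Periodic K.1 (2 * Real.pi * a) := hG.periodic.sub hG'.periodic
  let γ : ℝ → Potential a N := fun s =>
    { toFun := fun x => Q x + s • K.1 x
      smooth := by
        have h := smoothAlg_contDiff (potEl Q + s • K)
        exact h
      periodic := fun x => by
        change Q (x + 2 * Real.pi * a) + s • K.1 (x + 2 * Real.pi * a) = Q x + s • K.1 x
        rw [hKp x, Q.periodic x]
      symm := fun x => (Q.symm x).add ((hKs x).smul s) }
  have hγ : IsSmoothFamily univ γ := by
    refine ⟨isOpen_univ, ContDiff.contDiffOn ?_⟩
    have h : ContDiff ℝ ∞ fun p : ℝ × ℝ => (potEl Q).1 p.2 + p.1 • K.1 p.2 :=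
      ((smoothAlg_contDiff (potEl Q)).comp contDiff_snd).add
        (contDiff_fst.smul ((smoothAlg_contDiff K).comp contDiff_snd))
    exact h
  have h0 : γ 0 = Q := by
    have h : (γ 0).toFun = Q.toFun := by
      funext x
      change Q x + (0 : ℝ) • K.1 x = Q x
      rw [zero_smul, add_zero]
    exact Potential.ext_toFun h
  have hd : ∀ x, deriv (fun σ => γ σ x) 0 = K.1 x := fun x => by
    have h : HasDerivAt (fun σ : ℝ => (potEl Q).1 x + σ • K.1 x) ((1 : ℝ) • K.1 x) 0 :=
      ((hasDerivAt_id (0 : ℝ)).smul_const (K.1 x)).const_add _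
    rw [one_smul] at h
    exact h.deriv
  have e := (hG.hasDerivAt univ γ hγ 0 (mem_univ _) h0).unique
    (hG'.hasDerivAt univ γ hγ 0 (mem_univ _) h0)
  simp only [hd] at e
  have hc : Continuous fun x => (K.1 x * K.1 x).trace := continuous_trace_coe (K * K)
  have hint : ∫ x in (0 : ℝ)..(2 * Real.pi * a), (K.1 x * K.1 x).trace = 0 := by
    have h1 : ∀ x, (K.1 x * K.1 x).trace = (K.1 x * G x).trace - (K.1 x * G' x).trace := by
      intro x
      rw [← Matrix.trace_sub, ← Matrix.mul_sub]
      rfl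
    simp only [h1]
    have c1 : Continuous fun x => (K.1 x * G x).trace := continuous_trace_coe (K * g)
    have c2 : Continuous fun x => (K.1 x * G' x).trace := continuous_trace_coe (K * g')
    rw [intervalIntegral.integral_sub (c1.intervalIntegrable _ _) (c2.intervalIntegrable _ _),
      sub_eq_zero]
    exact e
  have hz : ∀ x ∈ Icc 0 (2 * Real.pi * a), K.1 x = 0 := by
    intro x hx
    refine eq_zero_of_trace_mul_self (hKs x) ?_
    by_contra hne
    have hpos := intervalIntegral.integral_pos hl hc.continuousOn
      (fun x _ => trace_mul_self_nonneg (hKs x))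
      ⟨x, hx, lt_of_le_of_ne (trace_mul_self_nonneg (hKs x)) (Ne.symm hne)⟩
    exact hpos.ne' hint
  funext x
  obtain ⟨y, hy, hxy⟩ := hKp.exists_mem_Ico₀ hl x
  have h1 : K.1 x = 0 := by rw [hxy]; exact hz y ⟨hy.1, hy.2.le⟩
  exact sub_eq_zero.1 h1

theorem varDeriv_eq (ha : 0 < a) {H : Potential a N → ℝ} {Q : Potential a N} {G : ℝ → Mat N}
    (hG : HasVarDeriv H Q G) : varDeriv H Q = G := by
  have hex : ∃ G, HasVarDeriv H Q G := ⟨G, hG⟩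
  have h : varDeriv H Q = hex.choose := dif_pos hex
  rw [h]
  exact hex.choose_spec.unique ha hG

theorem HasVarDeriv.const_mul {H : Potential a N → ℝ} {Q : Potential a N} {G : ℝ → Mat N}
    (hG : HasVarDeriv H Q G) (c : ℝ) : HasVarDeriv (fun Q => c * H Q) Q (c • G) := by
  refine ⟨hG.smooth.const_smul c, fun x => ?_, fun x => (hG.symm x).smul c, ?_⟩
  · change c • G (x + 2 * Real.pi * a) = c • G x
    rw [hG.periodic x]
  · intro S γ hγ s hs h
    refine ((hG.hasDerivAt S γ hγ s hs h).const_mul c).congr_deriv ?_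
    rw [← intervalIntegral.integral_const_mul]
    refine intervalIntegral.integral_congr fun x _ => ?_
    change c * (deriv (fun σ => γ σ x) s * G x).trace
      = (deriv (fun σ => γ σ x) s * c • G x).trace
    rw [Matrix.mul_smul, Matrix.trace_smul]
    rfl

/-! ### The invariants of the hierarchy -/

/-- The ratio between the variational derivatives of `I_k` and the diagonal values. -/
def kdvCoeff (k : ℕ) : ℝ := (-1) ^ k * ((Nat.factorial (2 * k) : ℝ) / Nat.factorial k)

theorem kdvCoeff_succ (k : ℕ) : kdvCoeff (k + 1) = -2 * (2 * k + 1) * kdvCoeff k := by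
  rw [kdvCoeff, kdvCoeff, factorial_two_mul_succ, pow_succ]
  ring

/-- The variational derivatives of the `I_k`. -/
def kdvField (k : ℕ) : regularFields a N := kdvCoeff k • regDiag k

/-- `D⁻¹ Ad_Q` applied to the variational derivatives of the `I_k`. -/
def kdvSkew (k : ℕ) : regularFields a N := kdvCoeff k • regSkew k

theorem hasVarDeriv_kdvInvariant (ha : 0 < a) (k : ℕ) (Q : Potential a N) :
    HasVarDeriv (kdvInvariant k) Q ((kdvField k : regularFields a N).1 Q) := by
  have h := (hasVarDeriv_heatInvariant ha Q k).const_mul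
    ((-1) ^ k * ((Nat.factorial (2 * k) : ℝ) / (Nat.factorial k * Nat.factorial (k + 1))))
  refine (congrArg (HasVarDeriv (kdvInvariant k) Q) ?_).mp h
  rw [heatDiag_eq]
  change _ • ((k : ℝ) + 1) • (Nat.factorial k : ℝ) • diagField k Q = kdvCoeff k • diagField k Q
  rw [smul_smul, smul_smul, kdvCoeff, Nat.factorial_succ]
  congr 1
  have h1 : (Nat.factorial k : ℝ) ≠ 0 := by positivity
  push_cast
  field_simp

theorem varDeriv_kdvInvariant (ha : 0 < a) (k : ℕ) :
    (varDeriv (kdvInvariant k) : FieldMap a N) = (kdvField k).1 :=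
  funext fun Q => varDeriv_eq ha (hasVarDeriv_kdvInvariant ha k Q)

theorem kdvSkew_mem (k : ℕ) : (kdvSkew k : regularFields a N).1 ∈ diffPoly a N :=
  SMulMemClass.smul_mem (kdvCoeff k) (skewField_mem k)

theorem kdvField_succ_mem (k : ℕ) : (kdvField (k + 1) : regularFields a N).1 ∈ diffPoly a N :=
  SMulMemClass.smul_mem (kdvCoeff (k + 1)) (diagField_succ_mem k)

theorem regD_kdvSkew (k : ℕ) :
    regD (kdvSkew k : regularFields a N) = regQ * kdvField k - kdvField k * regQ := by
  rw [kdvSkew, kdvField, map_smul, regD_regSkew, mul_smul_comm, smul_mul_assoc]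
  exact smul_sub _ _ _

theorem regD_kdvField_succ (k : ℕ) :
    regD (kdvField (k + 1) : regularFields a N) = regE (kdvField k) (kdvSkew k) := by
  have h1 := congrArg (fun f => (-2 * kdvCoeff k) • f) (regD_regDiag_succ (a := a) (N := N) k)
  simp only [smul_smul] at h1
  rw [kdvField, kdvField, kdvSkew, regE_smul, map_smul, kdvCoeff_succ]
  convert h1 using 2
  · ring
  · ring

theorem kdvField_zero : (kdvField 0 : regularFields a N) = 1 := by
  rw [kdvField, regDiag_zero]
  simp [kdvCoeff]

/-- The Lenard recursion: φ_k, rescaled, is a differential polynomial whose derivative is Ad_Q of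
δI_k, so it is the value of D⁻¹ occurring in E. -/
theorem opE_kdvField (ha : 0 < a) (k : ℕ) :
    opE (kdvField k : regularFields a N).1 = opD (kdvField (k + 1) : regularFields a N).1 := by
  rw [opE_eq ha (kdvField k) (kdvSkew k) (kdvSkew_mem k) (regD_kdvSkew k), ← regD_kdvField_succ]
  rfl

theorem diagField_one : (diagField 1 : FieldMap a N) = potentialField := by
  funext Q
  have hd1 : dX (1 : smoothAlg (ℝ × ℝ) (Mat N)) = 0 := by
    simpa using dirDeriv_mul (1, 0) (1 : smoothAlg (ℝ × ℝ) (Mat N)) 1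
  have h := congrArg diagEl (normCoeff_transport (potEl Q) 0)
  rw [map_add, diagEl_diffEl_mul, normCoeff_zero, hd1, map_zero, neg_zero, mul_one] at h
  simp only [Nat.cast_zero, zero_add, one_smul, add_zero, diagEl_pullFst] at h
  exact congrArg Subtype.val h

theorem kdvField_one : (kdvField 1 : regularFields a N) = (-2 : ℝ) • regQ := by
  have h : (regDiag 1 : regularFields a N) = regQ := Subtype.ext diagField_one
  rw [kdvField, h]
  congr 1
  simp [kdvCoeff]

theorem opDinv_opE_smul (ha : 0 < a) (c : ℝ) (k : ℕ) :
    opDinv (opE (c • kdvField k : regularFields a N).1)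
      = (c • kdvField (k + 1) : regularFields a N).1 := by
  refine opDinv_eq ha (SMulMemClass.smul_mem c (kdvField_succ_mem k)) ?_
  rw [opE_eq ha (c • kdvField k) (c • kdvSkew k) (SMulMemClass.smul_mem c (kdvSkew_mem k)) ?_,
    regE_smul, ← regD_kdvField_succ, ← map_smul]
  · rfl
  · rw [map_smul, regD_kdvSkew, mul_smul_comm, smul_mul_assoc]
    exact smul_sub _ _ _

theorem iterate_opDinv_opE (ha : 0 < a) (k : ℕ) :
    (fun g : FieldMap a N => opDinv (opE g))^[k] potentialField
      = ((-(1 / 2) : ℝ) • kdvField (k + 1) : regularFields a N).1 := by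
  induction k with
  | zero =>
    -- The iteration starts at Q, which is -1/2 times δI_1 = -2Q; every later step preserves this
    -- factor.
    rw [kdvField_one, smul_smul]
    norm_num
    rfl
  | succ k ih =>
    rw [Function.iterate_succ_apply', ih]
    exact opDinv_opE_smul ha _ _

/-! ### The brackets -/

/-- The primitive of `tr (h E g + g E h)`. -/
def skewPrimitive {R : Type*} [Ring R] [Algebra ℝ R] (D : R → R) (q h g φ ψ : R) : R :=
  h * D (D g) - D h * D g + D (D h) * g - (2 : ℝ) • (h * q * g + g * q * h) - φ * ψ

/-- The operator `E` is skew-symmetric up to total derivatives. -/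
theorem trace_skew {R : Type*} [Ring R] [Algebra ℝ R] (D : R →ₗ[ℝ] R)
    (hD : ∀ f g, D (f * g) = D f * g + f * D g) {B : Type*} [AddCommGroup B] [Module ℝ B]
    (t : R →ₗ[ℝ] B) (ht : ∀ f g, t (f * g) = t (g * f)) (q h g φ ψ : R)
    (hφ : D φ = q * h - h * q) (hψ : D ψ = q * g - g * q) :
    t (h * (D (D (D g)) - D (q * g) - D (g * q) - q * D g - D g * q + q * ψ - ψ * q))
      + t (g * (D (D (D h)) - D (q * h) - D (h * q) - q * D h - D h * q + q * φ - φ * q))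
      = t (D (skewPrimitive D q h g φ ψ)) := by
  have h3 : ∀ x y z, t (x * (y * z)) = t (z * (x * y)) := fun x y z => by
    rw [← mul_assoc, ht]
  simp only [skewPrimitive, map_add, map_sub, map_smul, hD, hφ, hψ, mul_add, mul_sub, sub_mul,
    mul_assoc]
  -- Each triple product is rotated cyclically to a common representative, after which the identity
  -- is linear.
  rw [h3 g (D q) h, h3 g q (D h), h3 g (D h) q, h3 q g (D h), h3 g h (D q), h3 (D q) g h,
    h3 (D g) q h, h3 q h ψ, h3 ψ q h, h3 φ q g, h3 φ g q, h3 q φ g, ht g (D (D (D h)))]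
  module

/-- The integral of the trace over the circle. -/
def circleTrace (Q : Potential a N) : regularFields a N →ₗ[ℝ] ℝ where
  toFun f := ∫ x in (0 : ℝ)..(2 * Real.pi * a), (f.1 Q x).trace
  map_add' f g := by
    have hf : Continuous fun x => (f.1 Q x).trace := continuous_trace_coe (evalPot Q f)
    have hg : Continuous fun x => (g.1 Q x).trace := continuous_trace_coe (evalPot Q g)
    rw [← intervalIntegral.integral_add (hf.intervalIntegrable _ _) (hg.intervalIntegrable _ _)]
    exact intervalIntegral.integral_congr fun x _ => Matrix.trace_add (f.1 Q x) (g.1 Q x)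
  map_smul' c f := by
    rw [RingHom.id_apply, smul_eq_mul, ← intervalIntegral.integral_const_mul]
    exact intervalIntegral.integral_congr fun x _ => Matrix.trace_smul c (f.1 Q x)

theorem circleTrace_mul (Q : Potential a N) (f g : regularFields a N) :
    circleTrace Q (f * g) = circleTrace Q (g * f) :=
  intervalIntegral.integral_congr fun x _ => Matrix.trace_mul_comm (f.1 Q x) (g.1 Q x)

theorem circleTrace_regD (Q : Potential a N) (f : regularFields a N) :
    circleTrace Q (regD f) = 0 := by
  have hd : ∀ x ∈ uIcc 0 (2 * Real.pi * a), HasDerivAt (fun x => ((evalPot Q f).1 x).trace)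
      ((dOne (evalPot Q f)).1 x).trace x := fun x _ =>
    (traceCLM N).hasFDerivAt.comp_hasDerivAt x (smoothAlg_hasDerivAt (evalPot Q f) x)
  have h : circleTrace Q (regD f)
      = ∫ x in (0 : ℝ)..(2 * Real.pi * a), ((dOne (evalPot Q f)).1 x).trace := by
    rw [← evalPot_regD]
    rfl
  rw [h, intervalIntegral.integral_eq_sub_of_hasDerivAt hd
    ((continuous_trace_coe (dOne (evalPot Q f))).intervalIntegrable _ _)]
  have hp := f.2.2.1 Q 0
  rw [zero_add] at hp
  exact sub_eq_zero.2 (congrArg Matrix.trace hp)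

theorem circleTrace_regD_skew (Q : Potential a N) (f g : regularFields a N) :
    circleTrace Q (f * regD g) = -circleTrace Q (g * regD f) := by
  have h := circleTrace_regD Q (f * g)
  rw [regD_mul, map_add, circleTrace_mul Q (regD f) g] at h
  linarith

theorem circleTrace_regE_skew (Q : Potential a N) (n k : ℕ) :
    circleTrace Q (kdvField n * regE (kdvField k) (kdvSkew k))
      = -circleTrace Q (kdvField k * regE (kdvField n) (kdvSkew n)) := by
  have h := trace_skew (R := regularFields a N) regD regD_mul (circleTrace Q) (circleTrace_mul Q)
    regQ (kdvField n) (kdvField k) (kdvSkew n) (kdvSkew k) (regD_kdvSkew n) (regD_kdvSkew k)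
  rw [circleTrace_regD] at h
  exact eq_neg_of_add_eq_zero_left h

/-- The recursion turns D δI_{k+1} into E δI_k, skewness of E exchanges the arguments, the recursion
is undone at index n, and skewness of D exchanges them back; the two signs cancel. -/
theorem circleTrace_kdvField_shift (Q : Potential a N) (n k : ℕ) :
    circleTrace Q (kdvField n * regD (kdvField (k + 1)))
      = circleTrace Q (kdvField (n + 1) * regD (kdvField k)) := by
  rw [regD_kdvField_succ, circleTrace_regE_skew, ← regD_kdvField_succ, circleTrace_regD_skew,
    neg_neg]

/-- Repeated shifts lower the second index to 0, where δI_0 = 1 has zero derivative. -/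
theorem circleTrace_kdvField (Q : Potential a N) (n k : ℕ) :
    circleTrace Q (kdvField n * regD (kdvField k)) = 0 := by
  induction k generalizing n with
  | zero =>
    rw [kdvField_zero, regD_one, mul_zero, map_zero]
  | succ k ih => rw [circleTrace_kdvField_shift, ih]

theorem bracketD_kdvInvariant (ha : 0 < a) (n k : ℕ) (Q : Potential a N) :
    bracketD (kdvInvariant n) (kdvInvariant k) Q = 0 := by
  rw [bracketD, varDeriv_kdvInvariant ha, varDeriv_kdvInvariant ha]
  exact circleTrace_kdvField Q n k

theorem bracketE_kdvInvariant (ha : 0 < a) (n k : ℕ) (Q : Potential a N) :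
    bracketE (kdvInvariant n) (kdvInvariant k) Q = 0 := by
  rw [bracketE, varDeriv_kdvInvariant ha, varDeriv_kdvInvariant ha, opE_kdvField ha]
  exact circleTrace_kdvField Q n (k + 1)

/-- Along the flow the derivative of I_n is ∫ tr(D δI_k · δI_n), the D-bracket up to cyclicity of
the trace. -/
theorem hasDerivAt_kdvInvariant_flow (ha : 0 < a) {k n : ℕ} {S : Set ℝ} {γ : ℝ → Potential a N}
    (hγ : IsKdVFlow k S γ) {s : ℝ} (hs : s ∈ S) :
    HasDerivAt (fun σ => kdvInvariant n (γ σ)) 0 s := by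
  refine ((hasVarDeriv_kdvInvariant ha n (γ s)).hasDerivAt S γ hγ.1 s hs rfl).congr_deriv ?_
  simp only [hγ.2 s hs, varDeriv_kdvInvariant ha]
  refine Eq.trans ?_ (circleTrace_kdvField (γ s) n k)
  rw [circleTrace_mul]
  rfl

end

noncomputable section

variable {V W Z : Type} [NormedAddCommGroup V] [NormedSpace ℝ V] [NormedAddCommGroup W]
  [NormedSpace ℝ W] [NormedAddCommGroup Z] [NormedSpace ℝ Z]

/-! ### Smooth functions of time and space -/

/-- The directional derivative of a function of time and space. -/
def partialDeriv (v : ℝ × ℝ) (F : ℝ × ℝ → V) : ℝ × ℝ → V := fun p => fderiv ℝ F p v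

theorem contDiffOn_partialDeriv {O : Set (ℝ × ℝ)} (hO : IsOpen O) {F : ℝ × ℝ → V}
    (hF : ContDiffOn ℝ ∞ F O) (v : ℝ × ℝ) : ContDiffOn ℝ ∞ (partialDeriv v F) O :=
  (hF.fderiv_of_isOpen hO (m := ∞) (by simp)).clm_apply contDiffOn_const

theorem isOpen_halfPlane : IsOpen (Ioi (0 : ℝ) ×ˢ (univ : Set ℝ)) := isOpen_Ioi.prod isOpen_univ

theorem hasDerivAt_comp_halfPlane {F : ℝ × ℝ → V} (hF : ContDiffOn ℝ ∞ F (Ioi 0 ×ˢ univ))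
    {c : ℝ → ℝ × ℝ} {c' : ℝ × ℝ} {s : ℝ} (hc : HasDerivAt c c' s) (hs : 0 < (c s).1) :
    HasDerivAt (fun s => F (c s)) (partialDeriv c' F (c s)) s :=
  ((hF.contDiffAt (isOpen_halfPlane.mem_nhds ⟨hs, mem_univ _⟩)).differentiableAt
    (by simp)).hasFDerivAt.comp_hasDerivAt s hc

theorem hasDerivAt_time {F : ℝ × ℝ → V} (hF : ContDiffOn ℝ ∞ F (Ioi 0 ×ˢ univ)) {s : ℝ}
    (hs : 0 < s) (z : ℝ) : HasDerivAt (fun s => F (s, z)) (partialDeriv (1, 0) F (s, z)) s :=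
  hasDerivAt_comp_halfPlane hF (c := fun s => (s, z))
    ((hasDerivAt_id s).prodMk (hasDerivAt_const s z)) hs

theorem hasDerivAt_space {F : ℝ × ℝ → V} (hF : ContDiffOn ℝ ∞ F (Ioi 0 ×ˢ univ)) {s : ℝ}
    (hs : 0 < s) (z : ℝ) : HasDerivAt (fun z => F (s, z)) (partialDeriv (0, 1) F (s, z)) z :=
  hasDerivAt_comp_halfPlane hF (c := fun z => (s, z))
    ((hasDerivAt_const z s).prodMk (hasDerivAt_id z)) hs

theorem continuous_space {F : ℝ × ℝ → V} (hF : ContDiffOn ℝ ∞ F (Ioi 0 ×ˢ univ)) {s : ℝ}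
    (hs : 0 < s) : Continuous fun z => F (s, z) :=
  hF.continuousOn.comp_continuous (by fun_prop) fun _ => ⟨hs, mem_univ _⟩

/-- The pairing of a solution of the heat equation with an approximate solution of the backward
adjoint equation changes only by the defect. -/
theorem hasDerivAt_heat_pairing [CompleteSpace Z] (β : V →L[ℝ] W →L[ℝ] Z) {A : ℝ → V → V} {A' : ℝ → W → W}
    (hA : ∀ z v w, β (A z v) w = β v (A' z w)) {p r : ℝ × ℝ → V} {u : ℝ × ℝ → W}
    (hp : ContDiffOn ℝ ∞ p (Ioi 0 ×ˢ univ)) (hu : ContDiffOn ℝ ∞ u (Ioi 0 ×ˢ univ))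
    (hpe : ∀ τ z, 0 < τ → partialDeriv (1, 0) p (τ, z)
      = partialDeriv (0, 1) (partialDeriv (0, 1) p) (τ, z) - A z (p (τ, z)) + r (τ, z))
    (hue : ∀ τ z, 0 < τ → partialDeriv (1, 0) u (τ, z)
      = partialDeriv (0, 1) (partialDeriv (0, 1) u) (τ, z) - A' z (u (τ, z)))
    {α b : ℝ} (hα : ∀ τ, 0 < τ → p (τ, α) = 0 ∧ partialDeriv (0, 1) p (τ, α) = 0)
    (hb : ∀ τ, 0 < τ → p (τ, b) = 0 ∧ partialDeriv (0, 1) p (τ, b) = 0)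
    {t s : ℝ} (hs : s ∈ Ioo 0 t) :
    HasDerivAt (fun s => ∫ z in α..b, β (p (t - s, z)) (u (s, z)))
      (-∫ z in α..b, β (r (t - s, z)) (u (s, z))) s := by
  have hpτ := contDiffOn_partialDeriv isOpen_halfPlane hp (1, 0)
  have hpz := contDiffOn_partialDeriv isOpen_halfPlane hp (0, 1)
  have hpzz := contDiffOn_partialDeriv isOpen_halfPlane hpz (0, 1)
  have hut := contDiffOn_partialDeriv isOpen_halfPlane hu (1, 0)
  have huz := contDiffOn_partialDeriv isOpen_halfPlane hu (0, 1)
  have huzz := contDiffOn_partialDeriv isOpen_halfPlane huz (0, 1)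
  have hback : ∀ {F : ℝ × ℝ → V}, ContDiffOn ℝ ∞ F (Ioi 0 ×ˢ univ) →
      ContinuousOn (fun q : ℝ × ℝ => F (t - q.1, q.2)) (Ioo 0 t ×ˢ univ) := fun hF =>
    hF.continuousOn.comp (by fun_prop) fun q hq => ⟨sub_pos.2 hq.1.2, mem_univ _⟩
  have hforw : ∀ {F : ℝ × ℝ → W}, ContDiffOn ℝ ∞ F (Ioi 0 ×ˢ univ) →
      ContinuousOn F (Ioo 0 t ×ˢ univ) := fun hF =>
    hF.continuousOn.mono (prod_mono Ioo_subset_Ioi_self subset_rfl)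
  have hmain := hasDerivAt_intervalIntegral_param (F := fun s z => β (p (t - s, z)) (u (s, z)))
    (F' := fun s z => β (-partialDeriv (1, 0) p (t - s, z)) (u (s, z))
      + β (p (t - s, z)) (partialDeriv (1, 0) u (s, z))) isOpen_Ioo hs α b ?_ ?_ ?_
  · refine hmain.congr_deriv ?_
    have hts : 0 < t - s := sub_pos.2 hs.2
    -- Green's identity: β(p, u_zz) - β(p_zz, u) is the derivative of β(p, u_z) - β(p_z, u), which
    -- vanishes at both ends because p and p_z do. The potential terms cancel by `hA`.
    have h1 : ∀ z ∈ uIcc α b, HasDerivAt (fun z => β (p (t - s, z)) (partialDeriv (0, 1) u (s, z))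
        - β (partialDeriv (0, 1) p (t - s, z)) (u (s, z)))
        (β (p (t - s, z)) (partialDeriv (0, 1) (partialDeriv (0, 1) u) (s, z))
          - β (partialDeriv (0, 1) (partialDeriv (0, 1) p) (t - s, z)) (u (s, z))) z := by
      intro z _
      refine (((β.hasFDerivAt.comp_hasDerivAt z (hasDerivAt_space hp hts z)).clm_apply
        (hasDerivAt_space huz hs.1 z)).sub
        ((β.hasFDerivAt.comp_hasDerivAt z (hasDerivAt_space hpz hts z)).clm_apply
        (hasDerivAt_space hu hs.1 z))).congr_deriv ?_
      simp only [Function.comp_apply]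
      abel
    have c1 : Continuous fun z => β (p (t - s, z)) (partialDeriv (0, 1) (partialDeriv (0, 1) u) (s, z))
          - β (partialDeriv (0, 1) (partialDeriv (0, 1) p) (t - s, z)) (u (s, z)) :=
      ((β.continuous.comp (continuous_space hp hts)).clm_apply (continuous_space huzz hs.1)).sub
        ((β.continuous.comp (continuous_space hpzz hts)).clm_apply (continuous_space hu hs.1))
    have c2 : Continuous fun z => β (-partialDeriv (1, 0) p (t - s, z)) (u (s, z))
        + β (p (t - s, z)) (partialDeriv (1, 0) u (s, z)) :=
      ((β.continuous.comp (continuous_space hpτ hts).neg).clm_apply (continuous_space hu hs.1)).add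
        ((β.continuous.comp (continuous_space hp hts)).clm_apply (continuous_space hut hs.1))
    have h2 := intervalIntegral.integral_eq_sub_of_hasDerivAt h1 (c1.intervalIntegrable _ _)
    simp only [(hα _ hts).1, (hα _ hts).2, (hb _ hts).1, (hb _ hts).2, map_zero,
      zero_apply, sub_self] at h2
    have h3 : ∀ z, β (r (t - s, z)) (u (s, z))
        = (β (p (t - s, z)) (partialDeriv (0, 1) (partialDeriv (0, 1) u) (s, z))
          - β (partialDeriv (0, 1) (partialDeriv (0, 1) p) (t - s, z)) (u (s, z)))
        - (β (-partialDeriv (1, 0) p (t - s, z)) (u (s, z))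
        + β (p (t - s, z)) (partialDeriv (1, 0) u (s, z))) := by
      intro z
      rw [hpe _ z hts, hue _ z hs.1]
      simp only [map_neg, map_add, map_sub, neg_apply,
        add_apply, sub_apply, hA]
      abel
    simp only [h3]
    rw [intervalIntegral.integral_sub (c1.intervalIntegrable _ _) (c2.intervalIntegrable _ _), h2,
      zero_sub, neg_neg]
  · intro s hs
    exact (β.continuous.comp (continuous_space hp (sub_pos.2 hs.2))).clm_apply
      (continuous_space hu hs.1)
  · exact ((β.continuous.comp_continuousOn (hback hpτ).neg).clm_apply (hforw hu)).add
      ((β.continuous.comp_continuousOn (hback hp)).clm_apply (hforw hut))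
  · intro s hs z
    have h1 : HasDerivAt (fun s => p (t - s, z)) (-partialDeriv (1, 0) p (t - s, z)) s := by
      have h := hasDerivAt_comp_halfPlane hp (c := fun s => (t - s, z)) (c' := (-1, 0))
        (((hasDerivAt_id s).const_sub t).prodMk (hasDerivAt_const s z)) (sub_pos.2 hs.2)
      refine h.congr_deriv ?_
      have h2 : ((-1, 0) : ℝ × ℝ) = -(1, 0) := by simp
      rw [partialDeriv, partialDeriv, h2, map_neg]
    exact (β.hasFDerivAt.comp_hasDerivAt s h1).clm_apply (hasDerivAt_time hu hs.1 z)

/-! ### The `L¹` bound for solutions of the heat equation -/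

theorem bilin_sq_le (B : W →L[ℝ] W →L[ℝ] ℝ) (hsymm : ∀ v w, B v w = B w v)
    (hpos : ∀ v, 0 ≤ B v v) (v w : W) : B v w ^ 2 ≤ B v v * B w w := by
  have h : ∀ x : ℝ, 0 ≤ B w w * (x * x) + 2 * B v w * x + B v v := by
    intro x
    have h1 := hpos (v + x • w)
    simp only [map_add, map_smul, add_apply, smul_apply,
      smul_eq_mul, hsymm w v] at h1
    linarith
  have h2 := discrim_le_zero h
  rw [discrim] at h2
  linarith

variable {B : W →L[ℝ] W →L[ℝ] ℝ}

/-- A Kato type inequality. For S = √(ε + B(u,u)) the equation gives ∂_tS ≤ ∂_z(B(u,u_z)/S) + cS;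
the middle term integrates to zero over a period. The regularisation ε > 0 keeps S smooth where u
vanishes. -/
theorem antitoneOn_integral_sqrt (hsymm : ∀ v w, B v w = B w v) (hpos : ∀ v, 0 ≤ B v v)
    {A' : ℝ → W → W} {c : ℝ} (hc : 0 ≤ c) (hA : ∀ z w, -B w (A' z w) ≤ c * B w w)
    {u : ℝ × ℝ → W} (hu : ContDiffOn ℝ ∞ u (Ioi 0 ×ˢ univ))
    (hue : ∀ τ z, 0 < τ → partialDeriv (1, 0) u (τ, z)
      = partialDeriv (0, 1) (partialDeriv (0, 1) u) (τ, z) - A' z (u (τ, z)))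
    {α b : ℝ} (hle : α ≤ b) (hper : ∀ τ, 0 < τ → u (τ, b) = u (τ, α)
      ∧ partialDeriv (0, 1) u (τ, b) = partialDeriv (0, 1) u (τ, α)) {ε : ℝ} (hε : 0 < ε) :
    AntitoneOn (fun s => Real.exp (-c * s) *
      ∫ z in α..b, Real.sqrt (ε + B (u (s, z)) (u (s, z)))) (Ioi 0) := by
  have hut := contDiffOn_partialDeriv isOpen_halfPlane hu (1, 0)
  have huz := contDiffOn_partialDeriv isOpen_halfPlane hu (0, 1)
  have huzz := contDiffOn_partialDeriv isOpen_halfPlane huz (0, 1)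
  set S : ℝ × ℝ → ℝ := fun q => Real.sqrt (ε + B (u q) (u q)) with hS
  have hSpos : ∀ q, 0 < S q := fun q => Real.sqrt_pos.2 (by linarith [hpos (u q)])
  have hSsq : ∀ q, S q ^ 2 = ε + B (u q) (u q) := fun q =>
    Real.sq_sqrt (by linarith [hpos (u q)])
  have hScont : ContinuousOn S (Ioi 0 ×ˢ univ) :=
    (continuousOn_const.add ((B.continuous.comp_continuousOn hu.continuousOn).clm_apply
      hu.continuousOn)).sqrt
  have hSd : ∀ {c : ℝ → W} {c' : W} {x : ℝ}, HasDerivAt c c' x →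
      HasDerivAt (fun x => Real.sqrt (ε + B (c x) (c x)))
        (B (c x) c' / Real.sqrt (ε + B (c x) (c x))) x := by
    intro c c' x hcd
    have h1 := (((B.hasFDerivAt.comp_hasDerivAt x hcd).clm_apply hcd).const_add ε).sqrt
      (by have := hpos (c x); positivity)
    refine h1.congr_deriv ?_
    simp only [Function.comp_apply]
    rw [hsymm c' (c x), ← two_mul, mul_div_mul_left _ _ two_ne_zero]
  have hI : ∀ s ∈ Ioi (0 : ℝ), HasDerivAt (fun s => ∫ z in α..b, S (s, z))
      (∫ z in α..b, B (u (s, z)) (partialDeriv (1, 0) u (s, z)) / S (s, z)) s := by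
    intro s hs
    refine hasDerivAt_intervalIntegral_param (F := fun s z => S (s, z))
      (F' := fun s z => B (u (s, z)) (partialDeriv (1, 0) u (s, z)) / S (s, z)) isOpen_Ioi hs α b
      (fun s hs => hScont.comp_continuous (by fun_prop) fun _ => ⟨hs, mem_univ _⟩)
      (((B.continuous.comp_continuousOn hu.continuousOn).clm_apply hut.continuousOn).div hScont
        fun q _ => (hSpos q).ne')
      (fun s hs z => hSd (hasDerivAt_time hu hs z))
  have hbound : ∀ s ∈ Ioi (0 : ℝ),
      ∫ z in α..b, B (u (s, z)) (partialDeriv (1, 0) u (s, z)) / S (s, z)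
        ≤ c * ∫ z in α..b, S (s, z) := by
    intro s hs
    have hs' : 0 < s := hs
    have cS : Continuous fun z => S (s, z) :=
      hScont.comp_continuous (by fun_prop) fun _ => ⟨hs, mem_univ _⟩
    have cu := continuous_space hu hs'
    have cut := continuous_space hut hs'
    have cuz := continuous_space huz hs'
    have cuzz := continuous_space huzz hs'
    -- This is the z-derivative of B(u, u_z)/S, written out by the quotient rule.
    set h' : ℝ → ℝ := fun z => ((B (partialDeriv (0, 1) u (s, z)) (partialDeriv (0, 1) u (s, z))
      + B (u (s, z)) (partialDeriv (0, 1) (partialDeriv (0, 1) u) (s, z))) * S (s, z)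
      - B (u (s, z)) (partialDeriv (0, 1) u (s, z))
        * (B (u (s, z)) (partialDeriv (0, 1) u (s, z)) / S (s, z))) / S (s, z) ^ 2 with hh'
    have hd : ∀ z ∈ uIcc α b, HasDerivAt
        (fun z => B (u (s, z)) (partialDeriv (0, 1) u (s, z)) / S (s, z)) (h' z) z := fun z _ =>
      ((B.hasFDerivAt.comp_hasDerivAt z (hasDerivAt_space hu hs' z)).clm_apply
        (hasDerivAt_space huz hs' z)).div (hSd (hasDerivAt_space hu hs' z)) (hSpos _).ne'
    have ch' : Continuous h' := by
      refine Continuous.div ?_ (cS.pow 2) fun z => pow_ne_zero _ (hSpos _).ne'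
      exact ((((B.continuous.comp cuz).clm_apply cuz).add
        ((B.continuous.comp cu).clm_apply cuzz)).mul cS).sub
        (((B.continuous.comp cu).clm_apply cuz).mul
          (((B.continuous.comp cu).clm_apply cuz).div cS fun z => (hSpos _).ne'))
    have h0 : ∫ z in α..b, h' z = 0 := by
      rw [intervalIntegral.integral_eq_sub_of_hasDerivAt hd (ch'.intervalIntegrable _ _), hS]
      simp only [(hper s hs').1, (hper s hs').2, sub_self]
    have hpw : ∀ z, B (u (s, z)) (partialDeriv (1, 0) u (s, z)) / S (s, z)
        ≤ h' z + c * S (s, z) := by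
      intro z
      have hp := hSpos (s, z)
      have hsq := hSsq (s, z)
      have hcs := bilin_sq_le B hsymm hpos (u (s, z)) (partialDeriv (0, 1) u (s, z))
      have hzz := hpos (partialDeriv (0, 1) u (s, z))
      have hAz := hA z (u (s, z))
      rw [hue s z hs', map_sub]
      simp only [hh']
      set b0 := B (u (s, z)) (u (s, z))
      set b1 := B (u (s, z)) (partialDeriv (0, 1) u (s, z))
      set b2 := B (partialDeriv (0, 1) u (s, z)) (partialDeriv (0, 1) u (s, z))
      set b3 := B (u (s, z)) (partialDeriv (0, 1) (partialDeriv (0, 1) u) (s, z))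
      set b4 := B (u (s, z)) (A' z (u (s, z)))
      set σ := S (s, z)
      -- In the numerator b2 σ² - b1² is nonnegative by Cauchy–Schwarz, as σ² = ε + b0 ≥ b0, and c
      -- σ² + b4 is nonnegative by `hA`.
      have e : ((b2 + b3) * σ - b1 * (b1 / σ)) / σ ^ 2 + c * σ - (b3 - b4) / σ
          = (b2 * σ ^ 2 - b1 ^ 2 + (c * σ ^ 2 + b4) * σ ^ 2) / σ ^ 3 := by
        field_simp
        ring
      have : 0 ≤ ((b2 + b3) * σ - b1 * (b1 / σ)) / σ ^ 2 + c * σ - (b3 - b4) / σ := by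
        rw [e]
        have h5 : 0 ≤ b2 * σ ^ 2 - b1 ^ 2 := by
          rw [hsq]
          nlinarith
        have h6 : 0 ≤ c * σ ^ 2 + b4 := by
          rw [hsq]
          nlinarith
        positivity
      linarith
    have c3 : Continuous fun z => B (u (s, z)) (partialDeriv (1, 0) u (s, z)) / S (s, z) :=
      ((B.continuous.comp cu).clm_apply cut).div cS fun z => (hSpos _).ne'
    have c4 : Continuous fun z => h' z + c * S (s, z) := ch'.add (cS.const_mul c)
    have h7 := intervalIntegral.integral_mono_on (μ := MeasureTheory.volume) hle (c3.intervalIntegrable _ _)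
      (c4.intervalIntegrable _ _) fun z _ => hpw z
    have c5 : Continuous fun z => c * S (s, z) := cS.const_mul c
    rwa [intervalIntegral.integral_add (ch'.intervalIntegrable _ _) (c5.intervalIntegrable _ _), h0,
      zero_add, intervalIntegral.integral_const_mul] at h7
  have hD : ∀ s ∈ Ioi (0 : ℝ), HasDerivAt (fun s => Real.exp (-c * s) * ∫ z in α..b, S (s, z))
      (Real.exp (-c * s) * (-c) * (∫ z in α..b, S (s, z)) + Real.exp (-c * s) *
        ∫ z in α..b, B (u (s, z)) (partialDeriv (1, 0) u (s, z)) / S (s, z)) s := by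
    intro s hs
    have h1 : HasDerivAt (fun s => Real.exp (-c * s)) (Real.exp (-c * s) * (-c)) s := by
      simpa using ((hasDerivAt_id s).const_mul (-c)).exp
    exact h1.mul (hI s hs)
  refine antitoneOn_of_deriv_nonpos (convex_Ioi 0)
    (fun s hs => (hD s hs).continuousAt.continuousWithinAt)
    (fun s hs => (hD s (interior_subset hs)).differentiableAt.differentiableWithinAt)
    fun s hs => ?_
  rw [interior_Ioi] at hs
  rw [(hD s hs).deriv]
  have := mul_le_mul_of_nonneg_left (hbound s hs) (Real.exp_pos (-c * s)).le
  linarith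

/-- Uniform convergence eventually confines u to distance 1 from f, which provides the constant
majorant for dominated convergence. -/
theorem tendsto_intervalIntegral_of_uniform {Y : Type} [NormedAddCommGroup Y] {u : ℝ → ℝ → Y}
    {f : ℝ → Y} {l : Filter ℝ} [l.IsCountablyGenerated] (hu : ∀ᶠ s in l, Continuous (u s)) (hlim : TendstoUniformly u f l)
    {g : ℝ → Y → Z} (hg : Continuous fun q : ℝ × Y => g q.1 q.2)
    {α b M : ℝ} (hM : ∀ z ∈ uIcc α b, ∀ w, ‖w‖ ≤ ‖f z‖ + 1 → ‖g z w‖ ≤ M) :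
    Tendsto (fun s => ∫ z in α..b, g z (u s z)) l (𝓝 (∫ z in α..b, g z (f z))) := by
  refine intervalIntegral.tendsto_integral_filter_of_dominated_convergence (fun _ => M) ?_ ?_
    (by simp) ?_
  · filter_upwards [hu] with s hs
    exact (hg.comp (continuous_id.prodMk hs)).aestronglyMeasurable
  · filter_upwards [Metric.tendstoUniformly_iff.1 hlim 1 one_pos] with s hs
    refine Eventually.of_forall fun z hz => hM z (uIoc_subset_uIcc hz) _ ?_
    have h1 := hs z
    rw [dist_comm, dist_eq_norm] at h1
    linarith [norm_sub_norm_le (u s z) (f z)]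
  · refine Eventually.of_forall fun z _ => ?_
    exact ((hg.comp (continuous_const.prodMk continuous_id)).tendsto (f z)).comp
      (hlim.tendsto_at z)

/-- The monotone quantity at time t is at most its limit as s → 0+, computed from the initial
values. Regularising by ε² costs at most ε pointwise, since √(ε² + B) ≤ √B + ε, and ε → 0 removes
it. -/
theorem integral_sqrt_le (hsymm : ∀ v w, B v w = B w v) (hpos : ∀ v, 0 ≤ B v v)
    {A' : ℝ → W → W} {c : ℝ} (hc : 0 ≤ c) (hA : ∀ z w, -B w (A' z w) ≤ c * B w w)
    {u : ℝ × ℝ → W} (hu : ContDiffOn ℝ ∞ u (Ioi 0 ×ˢ univ))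
    (hue : ∀ τ z, 0 < τ → partialDeriv (1, 0) u (τ, z)
      = partialDeriv (0, 1) (partialDeriv (0, 1) u) (τ, z) - A' z (u (τ, z)))
    {α b : ℝ} (hle : α ≤ b) (hper : ∀ τ, 0 < τ → u (τ, b) = u (τ, α)
      ∧ partialDeriv (0, 1) u (τ, b) = partialDeriv (0, 1) u (τ, α))
    {f : ℝ → W} (hf : Continuous f) (hlim : TendstoUniformly (fun s z => u (s, z)) f (𝓝[>] 0))
    {t : ℝ} (ht : 0 < t) :
    ∫ z in α..b, Real.sqrt (B (u (t, z)) (u (t, z)))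
      ≤ Real.exp (c * t) * ∫ z in α..b, Real.sqrt (B (f z) (f z)) := by
  have hcBu : ∀ ε : ℝ, Continuous fun z => Real.sqrt (ε + B (u (t, z)) (u (t, z))) := fun ε =>
    (continuous_const.add ((B.continuous.comp (continuous_space hu ht)).clm_apply
      (continuous_space hu ht))).sqrt
  have hcBf : ∀ ε : ℝ, Continuous fun z => Real.sqrt (ε + B (f z) (f z)) := fun ε =>
    (continuous_const.add ((B.continuous.comp hf).clm_apply hf)).sqrt
  have key : ∀ ε : ℝ, 0 < ε → ∫ z in α..b, Real.sqrt (B (u (t, z)) (u (t, z)))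
      ≤ Real.exp (c * t) * ((∫ z in α..b, Real.sqrt (B (f z) (f z))) + (b - α) * ε) := by
    intro ε hε
    have hε2 : 0 < ε ^ 2 := by positivity
    have hanti := antitoneOn_integral_sqrt hsymm hpos hc hA hu hue hle hper hε2
    obtain ⟨R, hR⟩ := (isCompact_uIcc (a := α) (b := b)).exists_bound_of_continuousOn
      hf.continuousOn
    have hI : Tendsto (fun s => ∫ z in α..b, Real.sqrt (ε ^ 2 + B (u (s, z)) (u (s, z))))
        (𝓝[>] 0) (𝓝 (∫ z in α..b, Real.sqrt (ε ^ 2 + B (f z) (f z)))) := by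
      refine tendsto_intervalIntegral_of_uniform (u := fun s z => u (s, z))
        (l := 𝓝[>] 0) (g := fun _ w => Real.sqrt (ε ^ 2 + B w w))
        (by filter_upwards [self_mem_nhdsWithin] with s hs using continuous_space hu hs) hlim
        (continuous_const.add ((B.continuous.comp continuous_snd).clm_apply continuous_snd)).sqrt
        (M := Real.sqrt (ε ^ 2 + ‖B‖ * (R + 1) * (R + 1))) fun z hz w hw => ?_
      rw [Real.norm_of_nonneg (Real.sqrt_nonneg _)]
      have hw' : ‖w‖ ≤ R + 1 := hw.trans (by linarith [hR z hz])
      have h1 : B w w ≤ ‖B‖ * ‖w‖ * ‖w‖ := (le_abs_self _).trans (B.le_opNorm₂ w w)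
      have hR0 : 0 ≤ R := (norm_nonneg _).trans (hR z hz)
      have h2 : ‖B‖ * ‖w‖ * ‖w‖ ≤ ‖B‖ * (R + 1) * (R + 1) := by gcongr
      exact Real.sqrt_le_sqrt (by linarith)
    have hE : Tendsto (fun s : ℝ => Real.exp (-c * s)) (𝓝[>] 0) (𝓝 1) := by
      have h : Continuous fun s : ℝ => Real.exp (-c * s) := by fun_prop
      simpa using (h.tendsto 0).mono_left nhdsWithin_le_nhds
    have hlim2 := ge_of_tendsto (hE.mul hI) (b := Real.exp (-c * t) *
      ∫ z in α..b, Real.sqrt (ε ^ 2 + B (u (t, z)) (u (t, z))))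
      (by
        filter_upwards [Ioo_mem_nhdsGT ht] with s hs
        exact hanti hs.1 ht hs.2.le)
    rw [one_mul] at hlim2
    have h3 : ∫ z in α..b, Real.sqrt (ε ^ 2 + B (f z) (f z))
        ≤ (∫ z in α..b, Real.sqrt (B (f z) (f z))) + (b - α) * ε := by
      have c0 : Continuous fun z => Real.sqrt (B (f z) (f z)) := by simpa using hcBf 0
      have c1 : Continuous fun z => Real.sqrt (B (f z) (f z)) + ε := c0.add continuous_const
      have h4 := intervalIntegral.integral_mono_on (μ := MeasureTheory.volume) hle ((hcBf (ε ^ 2)).intervalIntegrable _ _)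
        (c1.intervalIntegrable _ _) (fun z _ => by
          refine Real.sqrt_le_iff.2 ⟨by positivity, ?_⟩
          nlinarith [Real.sq_sqrt (hpos (f z)), Real.sqrt_nonneg (B (f z) (f z))])
      rwa [intervalIntegral.integral_add (c0.intervalIntegrable _ _) (by simp),
        intervalIntegral.integral_const, smul_eq_mul] at h4
    have h5 : ∫ z in α..b, Real.sqrt (B (u (t, z)) (u (t, z)))
        ≤ ∫ z in α..b, Real.sqrt (ε ^ 2 + B (u (t, z)) (u (t, z))) := by
      have c0 := hcBu 0
      simp only [zero_add] at c0
      exact intervalIntegral.integral_mono_on hle (c0.intervalIntegrable _ _)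
        ((hcBu _).intervalIntegrable _ _) fun z _ => Real.sqrt_le_sqrt (by linarith)
    have h6 : Real.exp (c * t) * Real.exp (-c * t) = 1 := by
      rw [← Real.exp_add]
      simp
    calc _ ≤ _ := h5
      _ = Real.exp (c * t) * (Real.exp (-c * t) *
          ∫ z in α..b, Real.sqrt (ε ^ 2 + B (u (t, z)) (u (t, z)))) := by
        rw [← mul_assoc, h6, one_mul]
      _ ≤ _ := by
        gcongr
        exact hlim2.trans h3
  have hT : Tendsto (fun ε : ℝ => Real.exp (c * t) *
      ((∫ z in α..b, Real.sqrt (B (f z) (f z))) + (b - α) * ε)) (𝓝[>] 0)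
      (𝓝 (Real.exp (c * t) * ((∫ z in α..b, Real.sqrt (B (f z) (f z))) + (b - α) * 0))) := by
    refine Tendsto.mono_left (Continuous.tendsto ?_ 0) nhdsWithin_le_nhds
    fun_prop
  rw [mul_zero, add_zero] at hT
  exact ge_of_tendsto hT (eventually_mem_nhdsWithin.mono fun ε hε => key ε hε)

end

noncomputable section

/-! ### The Gaussian kernel -/

/-- The heat kernel of `-D²` on the line. -/
def gaussKernel (τ w : ℝ) : ℝ := (Real.sqrt (4 * Real.pi * τ))⁻¹ * Real.exp (-(w ^ 2 / (4 * τ)))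

theorem gaussKernel_nonneg (τ w : ℝ) : 0 ≤ gaussKernel τ w := by
  unfold gaussKernel
  positivity

theorem gaussKernel_zero_right (τ : ℝ) : gaussKernel τ 0 = (Real.sqrt (4 * Real.pi * τ))⁻¹ := by
  simp [gaussKernel]

theorem contDiffOn_gaussKernel (x : ℝ) :
    ContDiffOn ℝ ∞ (fun p : ℝ × ℝ => gaussKernel p.1 (p.2 - x)) (Ioi 0 ×ˢ univ) := by
  have h1 : ContDiffOn ℝ ∞ (fun p : ℝ × ℝ => 4 * Real.pi * p.1) (Ioi 0 ×ˢ univ) := by fun_prop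
  have h2 : ContDiffOn ℝ ∞ (fun p : ℝ × ℝ => 4 * p.1) (Ioi 0 ×ˢ univ) := by fun_prop
  have h3 : ContDiffOn ℝ ∞ (fun p : ℝ × ℝ => (p.2 - x) ^ 2) (Ioi 0 ×ˢ univ) := by fun_prop
  have hpos : ∀ p ∈ Ioi (0 : ℝ) ×ˢ (univ : Set ℝ), 0 < 4 * Real.pi * p.1 := fun p hp => by
    have : 0 < p.1 := hp.1
    positivity
  refine ((h1.sqrt fun p hp => (hpos p hp).ne').inv fun p hp =>
    (Real.sqrt_pos.2 (hpos p hp)).ne').mul ((h3.div h2 fun p hp => ?_).neg.exp)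
  have : 0 < p.1 := hp.1
  positivity

theorem hasDerivAt_gaussKernel_time {τ : ℝ} (hτ : 0 < τ) (w : ℝ) :
    HasDerivAt (fun τ => gaussKernel τ w)
      (gaussKernel τ w * (-(1 / (2 * τ)) + w ^ 2 / (4 * τ ^ 2))) τ := by
  have h0 : 0 < 4 * Real.pi * τ := by positivity
  have h1 : HasDerivAt (fun τ => 4 * Real.pi * τ) (4 * Real.pi) τ := by
    simpa using (hasDerivAt_id τ).const_mul (4 * Real.pi)
  have h2 := (h1.sqrt h0.ne').inv (Real.sqrt_pos.2 h0).ne'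
  have h3 : HasDerivAt (fun τ => -(w ^ 2 / (4 * τ))) (w ^ 2 / (4 * τ ^ 2)) τ := by
    have h := (((hasDerivAt_id τ).const_mul 4).inv (by simpa using hτ.ne')).const_mul (-w ^ 2)
    refine (h.congr_deriv ?_).congr_of_eventuallyEq (Eventually.of_forall fun τ => ?_)
    · simp only [id]
      field_simp
    · simp only [id, Pi.inv_apply]
      ring
  refine (h2.mul h3.exp).congr_deriv ?_
  have hs : Real.sqrt (4 * Real.pi * τ) ≠ 0 := (Real.sqrt_pos.2 h0).ne'
  have hsq : Real.sqrt (4 * Real.pi * τ) ^ 2 = 4 * Real.pi * τ := Real.sq_sqrt h0.le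
  simp only [gaussKernel, Pi.inv_apply]
  rw [hsq]
  have hpi := Real.pi_ne_zero
  field_simp

theorem hasDerivAt_gaussKernel_space {τ : ℝ} (hτ : 0 < τ) (x z : ℝ) :
    HasDerivAt (fun z => gaussKernel τ (z - x))
      (gaussKernel τ (z - x) * (-((z - x) / (2 * τ)))) z := by
  have h1 : HasDerivAt (fun z => -((z - x) ^ 2 / (4 * τ))) (-((z - x) / (2 * τ))) z := by
    refine ((((hasDerivAt_id z).sub_const x).pow 2).div_const (4 * τ)).neg.congr_deriv ?_
    simp only [id]
    field_simp
    norm_num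
    ring
  refine (h1.exp.const_mul _).congr_deriv ?_
  rw [gaussKernel]
  ring

theorem gaussKernel_scale {τ : ℝ} (hτ : 0 < τ) (η : ℝ) :
    Real.sqrt τ * gaussKernel τ (Real.sqrt τ * η) = gaussKernel 1 η := by
  have hs : Real.sqrt τ ≠ 0 := (Real.sqrt_pos.2 hτ).ne'
  rw [gaussKernel, gaussKernel, Real.sqrt_mul (by positivity), mul_pow, Real.sq_sqrt hτ.le, mul_one,
    mul_one, mul_inv]
  have h : τ * η ^ 2 / (4 * τ) = η ^ 2 / 4 := by field_simp
  rw [h]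
  field_simp

theorem integrable_gaussKernel_one : MeasureTheory.Integrable (gaussKernel 1) := by
  have h := (integrable_exp_neg_mul_sq (b := 1 / 4) (by norm_num)).const_mul
    (Real.sqrt (4 * Real.pi * 1))⁻¹
  refine h.congr (Eventually.of_forall fun w => ?_)
  simp only [gaussKernel]
  congr 2
  ring

theorem integral_gaussKernel_one : ∫ w, gaussKernel 1 w = 1 := by
  have h : ∀ w, gaussKernel 1 w = (Real.sqrt (4 * Real.pi))⁻¹ * Real.exp (-(1 / 4) * w ^ 2) := by
    intro w
    simp only [gaussKernel, mul_one]
    congr 2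
    ring
  simp only [h]
  rw [MeasureTheory.integral_const_mul, integral_gaussian]
  have h2 : Real.pi / (1 / 4) = 4 * Real.pi := by ring
  rw [h2]
  exact inv_mul_cancel₀ (Real.sqrt_pos.2 (by positivity)).ne'

/-- The Gaussian kernel is an approximate identity. -/
theorem tendsto_integral_gaussKernel {V : Type} [NormedAddCommGroup V] [NormedSpace ℝ V]
    [CompleteSpace V] {h : ℝ → ℝ → V} {M : ℝ} {v : V}
    (hc : ∀ᶠ τ in 𝓝[>] 0, Continuous (h τ)) (hb : ∀ᶠ τ in 𝓝[>] 0, ∀ w, ‖h τ w‖ ≤ M)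
    (hlim : Tendsto (fun p : ℝ × ℝ => h p.1 p.2) (𝓝[>] 0 ×ˢ 𝓝 0) (𝓝 v)) :
    Tendsto (fun τ => ∫ w, gaussKernel τ w • h τ w) (𝓝[>] 0) (𝓝 v) := by
  -- The substitution w = √τ η moves all dependence on τ from the kernel into h, so the fixed
  -- Gaussian dominates.
  have hscale : ∀ τ ∈ Ioi (0 : ℝ), ∫ η, gaussKernel 1 η • h τ (Real.sqrt τ * η)
      = ∫ w, gaussKernel τ w • h τ w := by
    intro τ hτ
    have hs : 0 < Real.sqrt τ := Real.sqrt_pos.2 hτ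
    have h1 := MeasureTheory.Measure.integral_comp_mul_left
      (fun w => gaussKernel τ w • h τ w) (Real.sqrt τ)
    have h2 : ∀ η, gaussKernel 1 η • h τ (Real.sqrt τ * η)
        = Real.sqrt τ • (gaussKernel τ (Real.sqrt τ * η) • h τ (Real.sqrt τ * η)) := fun η => by
      rw [smul_smul, gaussKernel_scale hτ]
    simp only [h2]
    rw [MeasureTheory.integral_smul, h1, abs_of_pos (inv_pos.2 hs), smul_smul,
      mul_inv_cancel₀ hs.ne', one_smul]
  have hg : Continuous (gaussKernel 1) := by
    unfold gaussKernel
    fun_prop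
  have hT : Tendsto (fun τ => ∫ η, gaussKernel 1 η • h τ (Real.sqrt τ * η)) (𝓝[>] 0)
      (𝓝 (∫ η, gaussKernel 1 η • v)) := by
    refine MeasureTheory.tendsto_integral_filter_of_dominated_convergence
      (fun η => gaussKernel 1 η * M) ?_ ?_ (integrable_gaussKernel_one.mul_const M) ?_
    · filter_upwards [hc] with τ hτ
      exact (hg.smul (hτ.comp (by fun_prop))).aestronglyMeasurable
    · filter_upwards [hb] with τ hτ
      refine Eventually.of_forall fun η => ?_
      rw [norm_smul, Real.norm_of_nonneg (gaussKernel_nonneg _ _)]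
      exact mul_le_mul_of_nonneg_left (hτ _) (gaussKernel_nonneg _ _)
    · refine Eventually.of_forall fun η => Tendsto.const_smul ?_ _
      have h1 : Tendsto (fun τ => Real.sqrt τ * η) (𝓝[>] 0) (𝓝 0) := by
        have h : Continuous fun τ => Real.sqrt τ * η := by fun_prop
        simpa using (h.tendsto 0).mono_left nhdsWithin_le_nhds
      exact hlim.comp (tendsto_id.prodMk h1)
  rw [integral_smul_const, integral_gaussKernel_one, one_smul] at hT
  exact hT.congr' (eventually_mem_nhdsWithin.mono hscale)

/-! ### The parametrix -/

variable {𝔸 : Type} [NormedRing 𝔸] [NormedAlgebra ℝ 𝔸]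

/-- The coefficient `(-τ)^k/k!`. -/
def expCoeff (k : ℕ) (τ : ℝ) : ℝ := (-τ) ^ k / Nat.factorial k

theorem contDiff_expCoeff (k : ℕ) : ContDiff ℝ ∞ (expCoeff k) := by
  unfold expCoeff
  fun_prop

theorem hasDerivAt_expCoeff_zero (τ : ℝ) : HasDerivAt (expCoeff 0) 0 τ := by
  have h : expCoeff 0 = fun _ => 1 := funext fun τ => by simp [expCoeff]
  rw [h]
  exact hasDerivAt_const τ 1

theorem hasDerivAt_expCoeff_succ (k : ℕ) (τ : ℝ) :
    HasDerivAt (expCoeff (k + 1)) (-expCoeff k τ) τ := by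
  have h := (((hasDerivAt_id τ).neg).pow (k + 1)).div_const (Nat.factorial (k + 1) : ℝ)
  refine h.congr_deriv ?_
  have hk : (Nat.factorial k : ℝ) ≠ 0 := by positivity
  rw [expCoeff, Nat.factorial_succ]
  simp only [id, Pi.neg_apply, Nat.add_sub_cancel]
  push_cast
  field_simp

theorem expCoeff_succ_div (k : ℕ) {τ : ℝ} (hτ : τ ≠ 0) :
    expCoeff (k + 1) τ / τ = -(expCoeff k τ / (k + 1)) := by
  have hk : (Nat.factorial k : ℝ) ≠ 0 := by positivity
  rw [expCoeff, expCoeff, Nat.factorial_succ, pow_succ]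
  push_cast
  field_simp

theorem abs_expCoeff_le (k : ℕ) {τ : ℝ} (hτ : 0 ≤ τ) : |expCoeff k τ| ≤ τ ^ k := by
  rw [expCoeff, abs_div, abs_pow, abs_neg, abs_of_nonneg hτ, Nat.abs_cast]
  exact div_le_self (by positivity) (Nat.one_le_cast.2 (Nat.factorial_pos k))

/-- The truncated expansion `∑_{k ≤ M} (-τ)^k/k! f_k(z, x)`. -/
def expSum (f : ℕ → smoothAlg (ℝ × ℝ) 𝔸) (M : ℕ) (τ z x : ℝ) : 𝔸 :=
  ∑ k ∈ Finset.range (M + 1), expCoeff k τ • (f k).1 (z, x)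

theorem contDiff_expSum (f : ℕ → smoothAlg (ℝ × ℝ) 𝔸) (M : ℕ) :
    ContDiff ℝ ∞ (fun p : ℝ × ℝ × ℝ => expSum f M p.1 p.2.1 p.2.2) := by
  unfold expSum
  refine ContDiff.sum fun k _ => ?_
  exact ((contDiff_expCoeff k).comp contDiff_fst).smul
    ((smoothAlg_contDiff (f k)).comp contDiff_snd)

theorem hasDerivAt_expSum_space (f : ℕ → smoothAlg (ℝ × ℝ) 𝔸) (M : ℕ) (τ z x : ℝ) :
    HasDerivAt (fun z => expSum f M τ z x)
      (expSum (fun k => dirDeriv (1, 0) (f k)) M τ z x) z := by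
  unfold expSum
  exact HasDerivAt.fun_sum fun k _ => (hasDerivAt_slice_fst (f k) z x).const_smul (expCoeff k τ)

/-- The heat kernel coefficients solve the transport equations up to a small defect. -/
theorem expSum_transport [CompleteSpace 𝔸] (q : smoothAlg ℝ 𝔸) (M : ℕ) {τ : ℝ} (hτ : τ ≠ 0)
    (z x : ℝ) :
    ∃ b' : 𝔸, HasDerivAt (fun τ => expSum (heatEl q) M τ z x) b' τ ∧
      b' + ((z - x) / τ) • expSum (fun k => dirDeriv (1, 0) (heatEl q k)) M τ z x
        + expSum (fun k => schrodingerFst q (heatEl q k)) M τ z x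
        = expCoeff M τ • (schrodingerFst q (heatEl q M)).1 (z, x) := by
  induction M with
  | zero =>
    refine ⟨(0 : ℝ) • (heatEl q 0).1 (z, x), ?_, ?_⟩
    · simp only [expSum, zero_add, Finset.sum_range_one]
      exact (hasDerivAt_expCoeff_zero τ).smul_const _
    · have h0 : dirDeriv (1, 0) (heatEl q 0) = 0 := by
        refine Subtype.ext (funext fun p => ?_)
        change fderiv ℝ (fun _ => (1 : 𝔸)) p (1, 0) = 0
        simp
      simp only [expSum, zero_add, Finset.sum_range_one, h0, zero_smul]
      change (((z - x) / τ) • expCoeff 0 τ • (0 : 𝔸)) + _ = _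
      rw [smul_zero, smul_zero, zero_add]
  | succ M ih =>
    obtain ⟨b', hb', e⟩ := ih
    -- Adding one more term cancels the old defect: the time derivative and the drift (z-x)/τ of the
    -- new term together give minus (-τ)^M/M! times the left side of the transport equation of order
    -- M+1.
    have h1 : HasDerivAt (fun τ => expCoeff (M + 1) τ • (heatEl q (M + 1)).1 (z, x))
        (-expCoeff M τ • (heatEl q (M + 1)).1 (z, x)) τ :=
      (hasDerivAt_expCoeff_succ M τ).smul_const _
    refine ⟨b' + -expCoeff M τ • (heatEl q (M + 1)).1 (z, x), ?_, ?_⟩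
    · refine (hb'.add h1).congr_of_eventuallyEq (Eventually.of_forall fun τ => ?_)
      exact Finset.sum_range_succ _ _
    · have ht := coeffGen_transport q M z x
      have hd : deriv (fun ξ => coeffGen q.1 (M + 1) ξ x) z
          = (dirDeriv (1, 0) (heatEl q (M + 1))).1 (z, x) :=
        (hasDerivAt_slice_fst (heatEl q (M + 1)) z x).deriv
      rw [hd] at ht
      change (heatEl q (M + 1)).1 (z, x) + _ = _ at ht
      have hs : ∀ f : ℕ → smoothAlg (ℝ × ℝ) 𝔸, expSum f (M + 1) τ z x
          = expSum f M τ z x + expCoeff (M + 1) τ • (f (M + 1)).1 (z, x) := fun f => by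
        rw [expSum, Finset.sum_range_succ]
        rfl
      rw [hs, hs]
      have hc : (z - x) / τ * expCoeff (M + 1) τ = -expCoeff M τ * ((z - x) / ((M : ℝ) + 1)) := by
        rw [div_mul_eq_mul_div, mul_div_assoc, expCoeff_succ_div M hτ]
        ring
      have hc' : ((z - x) / τ) • expCoeff (M + 1) τ
            • (dirDeriv (1, 0) (heatEl q (M + 1))).1 (z, x)
          = -expCoeff M τ • (((z - x) / ((M : ℝ) + 1))
            • (dirDeriv (1, 0) (heatEl q (M + 1))).1 (z, x)) := by
        rw [smul_smul, smul_smul, hc]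
      rw [smul_add, hc']
      linear_combination (norm := module) e - expCoeff M τ • ht

/-- The approximate fundamental solution, centred at `x`. -/
def parametrix (χ : ℝ → ℝ) (q : smoothAlg ℝ 𝔸) (M : ℕ) (x : ℝ) (p : ℝ × ℝ) : 𝔸 :=
  (gaussKernel p.1 (p.2 - x) * χ (p.2 - x)) • expSum (heatEl q) M p.1 p.2 x

/-- The defect of the approximate fundamental solution in the heat equation. -/
def parametrixDefect (χ : ℝ → ℝ) (q : smoothAlg ℝ 𝔸) (M : ℕ) (x : ℝ) (p : ℝ × ℝ) : 𝔸 :=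
  (gaussKernel p.1 (p.2 - x) * (χ (p.2 - x) * expCoeff M p.1))
      • (schrodingerFst q (heatEl q M)).1 (p.2, x)
    + (gaussKernel p.1 (p.2 - x) *
        (deriv χ (p.2 - x) * ((p.2 - x) / p.1) - deriv (deriv χ) (p.2 - x)))
      • expSum (heatEl q) M p.1 p.2 x
    - (gaussKernel p.1 (p.2 - x) * (2 * deriv χ (p.2 - x)))
      • expSum (fun k => dirDeriv (1, 0) (heatEl q k)) M p.1 p.2 x

variable {χ : ℝ → ℝ}

theorem contDiffOn_parametrix (hχ : ContDiff ℝ ∞ χ) (q : smoothAlg ℝ 𝔸) (M : ℕ) (x : ℝ) :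
    ContDiffOn ℝ ∞ (parametrix χ q M x) (Ioi 0 ×ˢ univ) := by
  refine ((contDiffOn_gaussKernel x).mul (ContDiff.contDiffOn ?_)).smul (ContDiff.contDiffOn ?_)
  · exact hχ.comp (by fun_prop)
  · exact (contDiff_expSum (heatEl q) M).comp (f := fun p : ℝ × ℝ => (p.1, p.2, x)) (by fun_prop)

theorem partialDeriv_space_parametrix (hχ : ContDiff ℝ ∞ χ) (q : smoothAlg ℝ 𝔸) (M : ℕ) (x : ℝ)
    {τ : ℝ} (hτ : 0 < τ) (z : ℝ) :
    partialDeriv (0, 1) (parametrix χ q M x) (τ, z)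
      = (gaussKernel τ (z - x) * (deriv χ (z - x) - (z - x) / (2 * τ) * χ (z - x)))
          • expSum (heatEl q) M τ z x
        + (gaussKernel τ (z - x) * χ (z - x))
          • expSum (fun k => dirDeriv (1, 0) (heatEl q k)) M τ z x := by
  have hd : HasDerivAt (fun z => χ (z - x)) (deriv χ (z - x)) z :=
    ((hχ.differentiable (by simp)) (z - x)).hasDerivAt.comp_sub_const z x
  have h := ((hasDerivAt_gaussKernel_space hτ x z).mul hd).smul
    (hasDerivAt_expSum_space (heatEl q) M τ z x)
  refine (hasDerivAt_space (contDiffOn_parametrix hχ q M x) hτ z).unique (h.congr_deriv ?_)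
  simp only [Pi.mul_apply]
  module

/-- The Gaussian solves the free heat equation and its logarithmic derivative supplies the drift in
`expSum_transport`. What remains is the last term of the series and the terms in which the cutoff is
differentiated. -/
theorem parametrix_eq [CompleteSpace 𝔸] (hχ : ContDiff ℝ ∞ χ) (q : smoothAlg ℝ 𝔸) (M : ℕ) (x τ z : ℝ)
    (hτ : 0 < τ) :
    partialDeriv (1, 0) (parametrix χ q M x) (τ, z)
      = partialDeriv (0, 1) (partialDeriv (0, 1) (parametrix χ q M x)) (τ, z)
        - q.1 z * parametrix χ q M x (τ, z) + parametrixDefect χ q M x (τ, z) := by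
  have hp := contDiffOn_parametrix hχ q M x
  have hpz := contDiffOn_partialDeriv isOpen_halfPlane hp (0, 1)
  obtain ⟨b', hb', e⟩ := expSum_transport q M hτ.ne' z x
  have h1 : partialDeriv (1, 0) (parametrix χ q M x) (τ, z) = _ :=
    (hasDerivAt_time hp hτ z).unique
      (((hasDerivAt_gaussKernel_time hτ (z - x)).mul_const (χ (z - x))).smul hb')
  have hd : HasDerivAt (fun z => χ (z - x)) (deriv χ (z - x)) z :=
    ((hχ.differentiable (by simp)) (z - x)).hasDerivAt.comp_sub_const z x
  have hχ' : ContDiff ℝ ∞ (deriv χ) := (contDiff_infty_iff_deriv.1 hχ).2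
  have hd' : HasDerivAt (fun z => deriv χ (z - x)) (deriv (deriv χ) (z - x)) z :=
    ((hχ'.differentiable (by simp)) (z - x)).hasDerivAt.comp_sub_const z x
  have hlin : HasDerivAt (fun z => (z - x) / (2 * τ)) (1 / (2 * τ)) z :=
    ((hasDerivAt_id z).sub_const x).div_const (2 * τ)
  have hG := hasDerivAt_gaussKernel_space hτ x z
  have h2 : partialDeriv (0, 1) (partialDeriv (0, 1) (parametrix χ q M x)) (τ, z) = _ :=
    (hasDerivAt_space hpz hτ z).unique
      ((((hG.mul (hd'.sub (hlin.mul hd))).smul (hasDerivAt_expSum_space (heatEl q) M τ z x)).add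
        ((hG.mul hd).smul (hasDerivAt_expSum_space
          (fun k => dirDeriv (1, 0) (heatEl q k)) M τ z x))).congr_of_eventuallyEq
        (Eventually.of_forall fun z => partialDeriv_space_parametrix hχ q M x hτ z))
  have h3 : expSum (fun k => schrodingerFst q (heatEl q k)) M τ z x
      = q.1 z * expSum (heatEl q) M τ z x
        - expSum (fun k => dirDeriv (1, 0) (dirDeriv (1, 0) (heatEl q k))) M τ z x := by
    simp only [expSum, Finset.mul_sum, ← Finset.sum_sub_distrib]
    refine Finset.sum_congr rfl fun k _ => ?_
    change _ • (-(dirDeriv (1, 0) (dirDeriv (1, 0) (heatEl q k))).1 (z, x)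
      + q.1 z * (heatEl q k).1 (z, x)) = _
    rw [mul_smul_comm]
    module
  rw [h3] at e
  rw [h1, h2, parametrixDefect, parametrix, mul_smul_comm]
  simp only [Pi.mul_apply, Pi.sub_apply]
  have h4 : (gaussKernel τ (z - x) * (χ (z - x) * expCoeff M τ))
      • (schrodingerFst q (heatEl q M)).1 (z, x)
      = (gaussKernel τ (z - x) * χ (z - x)) • (expCoeff M τ
      • (schrodingerFst q (heatEl q M)).1 (z, x)) := by rw [smul_smul, mul_assoc]
  rw [h4, ← e]
  match_scalars
  all_goals ring1

end

noncomputable section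

/-! ### Bounds for the defect -/

/-- The crude factor τ⁻¹ in place of τ^{-1/2} keeps the exponents integral; the lost half power is
regained by extra terms of the series. -/
theorem gaussKernel_le {τ : ℝ} (hτ : 0 < τ) (hτ1 : τ ≤ 1) (w : ℝ) :
    gaussKernel τ w ≤ τ⁻¹ * Real.exp (-(w ^ 2 / (4 * τ))) := by
  have h : τ ≤ Real.sqrt (4 * Real.pi * τ) := by
    refine Real.le_sqrt_of_sq_le ?_
    nlinarith [Real.pi_gt_three]
  exact mul_le_mul_of_nonneg_right (inv_anti₀ hτ h) (Real.exp_pos _).le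

theorem exp_neg_div_le {κ τ : ℝ} (hκ : 0 < κ) (hτ : 0 < τ) (n : ℕ) :
    Real.exp (-(κ / τ)) ≤ Nat.factorial n / κ ^ n * τ ^ n := by
  have h := Real.pow_div_factorial_le_exp (κ / τ) (by positivity) n
  rw [Real.exp_neg]
  refine (inv_anti₀ (by positivity) h).trans (le_of_eq ?_)
  rw [div_pow]
  field_simp

variable {𝔸 : Type} [NormedRing 𝔸] [NormedAlgebra ℝ 𝔸]

/-- The truncation term is of size τ⁻¹ τ^{K+1}. Derivatives of the cutoff live where |z - x| ≥ ρ,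
and there the Gaussian is smaller than any power of τ. -/
theorem parametrixDefect_le {χ : ℝ → ℝ} (hχ : ContDiff ℝ ∞ χ) {ρ : ℝ} (hρ : 0 < ρ)
    (hχ1 : ∀ w, |w| < ρ → χ w = 1) (q : smoothAlg ℝ 𝔸) (K : ℕ) (c d c' d' : ℝ) :
    ∃ C : ℝ, 0 ≤ C ∧ ∀ τ ∈ Ioc (0 : ℝ) 1, ∀ x ∈ Icc c d, ∀ z ∈ Icc c' d',
      ‖parametrixDefect χ q (K + 1) x (τ, z)‖ ≤ C * τ ^ K := by
  have hχ' : ContDiff ℝ ∞ (deriv χ) := (contDiff_infty_iff_deriv.1 hχ).2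
  have hχ'' : ContDiff ℝ ∞ (deriv (deriv χ)) := (contDiff_infty_iff_deriv.1 hχ').2
  have hd1 : ∀ w, |w| < ρ → deriv χ w = 0 := by
    intro w hw
    have h : χ =ᶠ[𝓝 w] fun _ => 1 := by
      filter_upwards [(isOpen_Iio.preimage continuous_abs).mem_nhds hw] with v hv using hχ1 v hv
    rw [h.deriv_eq, deriv_const]
  have hd2 : ∀ w, |w| < ρ → deriv (deriv χ) w = 0 := by
    intro w hw
    have h : deriv χ =ᶠ[𝓝 w] fun _ => 0 := by
      filter_upwards [(isOpen_Iio.preimage continuous_abs).mem_nhds hw] with v hv using hd1 v hv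
    rw [h.deriv_eq, deriv_const]
  have cexp : ∀ f : ℕ → smoothAlg (ℝ × ℝ) 𝔸, Continuous fun p : ℝ × ℝ × ℝ =>
    expSum f (K + 1) p.1 p.2.1 p.2.2 := fun f => (contDiff_expSum f (K + 1)).continuous
  have hcomp : IsCompact (Icc (0 : ℝ) 1 ×ˢ Icc c' d' ×ˢ Icc c d) :=
    isCompact_Icc.prod (isCompact_Icc.prod isCompact_Icc)
  have c0 : Continuous fun p : ℝ × ℝ × ℝ => χ (p.2.1 - p.2.2) :=
    hχ.continuous.comp (by fun_prop)
  have c1 : Continuous fun p : ℝ × ℝ × ℝ => deriv χ (p.2.1 - p.2.2) :=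
    hχ'.continuous.comp (by fun_prop)
  have c2 : Continuous fun p : ℝ × ℝ × ℝ => deriv (deriv χ) (p.2.1 - p.2.2) :=
    hχ''.continuous.comp (by fun_prop)
  have cw : Continuous fun p : ℝ × ℝ × ℝ => p.2.1 - p.2.2 := by fun_prop
  have cL : Continuous fun p : ℝ × ℝ × ℝ => (schrodingerFst q (heatEl q (K + 1))).1 p.2 :=
    (smoothAlg_contDiff _).continuous.comp continuous_snd
  obtain ⟨C₁, hC₁⟩ := hcomp.exists_bound_of_continuousOn (c0.smul cL).continuousOn
  obtain ⟨C₂, hC₂⟩ := hcomp.exists_bound_of_continuousOn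
    ((c1.mul cw).smul (cexp (heatEl q))).continuousOn
  obtain ⟨C₃, hC₃⟩ := hcomp.exists_bound_of_continuousOn
    ((c2.smul (cexp (heatEl q))).add
      ((c1.const_mul 2).smul (cexp fun k => dirDeriv (1, 0) (heatEl q k)))).continuousOn
  set κ := ρ ^ 2 / 4 with hκ
  have hκ0 : 0 < κ := by positivity
  -- The exponent K+2 pays for two inverse powers of τ: one from the Gaussian bound, one from the
  -- drift (z-x)/τ.
  set E := (Nat.factorial (K + 2) : ℝ) / κ ^ (K + 2) with hE
  have hE0 : 0 ≤ E := by positivity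
  refine ⟨|C₁| + E * (|C₂| + |C₃|), by positivity, fun τ hτ x hx z hz => ?_⟩
  have hmem : (τ, z, x) ∈ Icc (0 : ℝ) 1 ×ˢ Icc c' d' ×ˢ Icc c d := ⟨⟨hτ.1.le, hτ.2⟩, hz, hx⟩
  have b1 := (hC₁ _ hmem).trans (le_abs_self C₁)
  have b2 := (hC₂ _ hmem).trans (le_abs_self C₂)
  have b3 := (hC₃ _ hmem).trans (le_abs_self C₃)
  have hτ0 := hτ.1
  set G := gaussKernel τ (z - x) with hG
  have hG0 : 0 ≤ G := gaussKernel_nonneg _ _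
  have e : parametrixDefect χ q (K + 1) x (τ, z)
      = (G * expCoeff (K + 1) τ) • (χ (z - x) • (schrodingerFst q (heatEl q (K + 1))).1 (z, x))
        + ((G * τ⁻¹) • ((deriv χ (z - x) * (z - x)) • expSum (heatEl q) (K + 1) τ z x)
        - G • (deriv (deriv χ) (z - x) • expSum (heatEl q) (K + 1) τ z x
          + (2 * deriv χ (z - x))
            • expSum (fun k => dirDeriv (1, 0) (heatEl q k)) (K + 1) τ z x)) := by
    rw [parametrixDefect]
    simp only [← hG]
    match_scalars
    all_goals ring1
  have hGτ : G ≤ τ⁻¹ := by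
    refine (gaussKernel_le hτ0 hτ.2 _).trans (mul_le_of_le_one_right (by positivity) ?_)
    exact Real.exp_le_one_iff.2 (by simp only [Left.neg_nonpos_iff]; positivity)
  have h1 : ‖(G * expCoeff (K + 1) τ) • (χ (z - x) •
      (schrodingerFst q (heatEl q (K + 1))).1 (z, x))‖ ≤ |C₁| * τ ^ K := by
    rw [norm_smul, norm_mul, Real.norm_of_nonneg hG0, Real.norm_eq_abs, mul_comm]
    refine mul_le_mul b1 ?_ (by positivity) (abs_nonneg _)
    calc G * |expCoeff (K + 1) τ| ≤ τ⁻¹ * τ ^ (K + 1) :=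
          mul_le_mul hGτ (abs_expCoeff_le _ hτ0.le) (abs_nonneg _) (by positivity)
      _ = τ ^ K := by
          rw [pow_succ]
          field_simp
  rw [e]
  refine (norm_add_le _ _).trans ?_
  rw [add_mul]
  refine add_le_add h1 ?_
  by_cases hw : |z - x| < ρ
  · rw [hd1 _ hw, hd2 _ hw]
    simp only [zero_mul, mul_zero, zero_smul, smul_zero, add_zero, sub_zero, norm_zero]
    positivity
  · have hGe : G ≤ τ⁻¹ * (E * τ ^ (K + 2)) := by
      refine (gaussKernel_le hτ0 hτ.2 _).trans ?_
      refine mul_le_mul_of_nonneg_left ?_ (by positivity)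
      refine le_trans (Real.exp_le_exp.2 (neg_le_neg ?_)) (exp_neg_div_le hκ0 hτ0 (K + 2))
      rw [hκ, div_div]
      have : ρ ^ 2 ≤ (z - x) ^ 2 := by
        rw [← sq_abs (z - x)]
        exact pow_le_pow_left₀ hρ.le (not_lt.1 hw) 2
      gcongr
    have hGe' : G * τ⁻¹ ≤ E * τ ^ K := by
      refine (mul_le_mul_of_nonneg_right hGe (by positivity)).trans (le_of_eq ?_)
      rw [pow_add]
      field_simp
    have hGG : G ≤ G * τ⁻¹ := le_mul_of_one_le_right hG0 ((one_le_inv₀ hτ0).2 hτ.2)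
    refine (norm_sub_le _ _).trans ?_
    rw [norm_smul (G * τ⁻¹) _, norm_smul G _, Real.norm_of_nonneg hG0,
      Real.norm_of_nonneg (mul_nonneg hG0 (inv_pos.2 hτ0).le)]
    have h2 := add_le_add (mul_le_mul hGe' b2 (norm_nonneg _) (by positivity))
      (mul_le_mul (hGG.trans hGe') b3 (norm_nonneg _) (by positivity))
    exact h2.trans (le_of_eq (by ring))

/-! ### Concentration at a point -/

variable {V : Type} [NormedAddCommGroup V] [NormedSpace ℝ V]

/-- A cosine of period l decreases with the distance from x over half a period, so it exceeds its
value at distance δ exactly on the δ-neighbourhood of x. -/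
theorem exists_periodic_bump {l δ : ℝ} (hδ : 0 < δ) (hδl : δ < l / 2) (x : ℝ) :
    ∃ φ : ℝ → ℝ, ContDiff ℝ ∞ φ ∧ Function.Periodic φ l ∧ (∀ y, 0 ≤ φ y) ∧ 0 < φ x ∧
      ∀ y ∈ Icc (x - l / 2) (x + l / 2), φ y ≠ 0 → |y - x| < δ := by
  have hl : 0 < l := by linarith
  refine ⟨fun y => Real.smoothTransition
    (Real.cos (2 * Real.pi / l * (y - x)) - Real.cos (2 * Real.pi / l * δ)), ?_, fun y => ?_,
    fun y => Real.smoothTransition.nonneg _, ?_, fun y hy hne => ?_⟩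
  · refine Real.smoothTransition.contDiff.comp (ContDiff.sub (Real.contDiff_cos.comp ?_)
      contDiff_const)
    fun_prop
  · have h : 2 * Real.pi / l * (y + l - x) = 2 * Real.pi / l * (y - x) + 2 * Real.pi := by
      field_simp
      ring
    simp only [h, Real.cos_add_two_pi]
  · refine Real.smoothTransition.pos_of_pos ?_
    rw [sub_self, mul_zero, Real.cos_zero, sub_pos, ← Real.cos_zero]
    refine Real.cos_lt_cos_of_nonneg_of_le_pi le_rfl ?_ (by positivity)
    rw [div_mul_eq_mul_div, div_le_iff₀ hl]
    nlinarith [Real.pi_pos]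
  · by_contra hge
    rw [not_lt] at hge
    refine hne (Real.smoothTransition.zero_of_nonpos ?_)
    have habs : |y - x| ≤ l / 2 := abs_le.2 ⟨by linarith [hy.1], by linarith [hy.2]⟩
    have hc : Real.cos (2 * Real.pi / l * (y - x)) = Real.cos (2 * Real.pi / l * |y - x|) := by
      rw [← Real.cos_abs, abs_mul, abs_of_pos (show 0 < 2 * Real.pi / l by positivity)]
    rw [hc, sub_nonpos]
    refine Real.cos_le_cos_of_nonneg_of_le_pi (by positivity) ?_
      (mul_le_mul_of_nonneg_left hge (by positivity))
    rw [div_mul_eq_mul_div, div_le_iff₀ hl]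
    nlinarith [Real.pi_pos]

/-- Taking φ concentrated where F is within ε of F x, the hypothesis gives (∫φ)‖F x‖ ≤ (∫φ)(D + ε),
and ∫φ is positive. Restricting the tests to nonnegative functions makes their L¹ norm equal to ∫φ.
-/
theorem norm_le_of_integral_le [CompleteSpace V] {l : ℝ} (hl : 0 < l) {F : ℝ → V} (hF : Continuous F) {x D : ℝ}
    (h : ∀ φ : ℝ → ℝ, ContDiff ℝ ∞ φ → Function.Periodic φ l → (∀ y, 0 ≤ φ y) →
      ‖∫ y in (x - l / 2)..(x + l / 2), φ y • F y‖
        ≤ D * ∫ y in (x - l / 2)..(x + l / 2), φ y) : ‖F x‖ ≤ D := by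
  refine le_of_forall_pos_le_add fun ε hε => ?_
  obtain ⟨δ₀, hδ₀, hFδ⟩ := Metric.continuousAt_iff.1 (hF.continuousAt (x := x)) ε hε
  obtain ⟨φ, hφ, hper, hpos, hφx, hsupp⟩ := exists_periodic_bump (l := l)
    (δ := min δ₀ (l / 4)) (by positivity) ((min_le_right _ _).trans_lt (by linarith)) x
  have hle : x - l / 2 ≤ x + l / 2 := by linarith
  have hint : 0 < ∫ y in (x - l / 2)..(x + l / 2), φ y :=
    intervalIntegral.integral_pos (by linarith) hφ.continuous.continuousOn (fun y _ => hpos y)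
      ⟨x, ⟨by linarith, by linarith⟩, hφx⟩
  have h1 := h φ hφ hper hpos
  have c1 : Continuous fun y => φ y • (F x - F y) := hφ.continuous.smul (continuous_const.sub hF)
  have c2 : Continuous fun y => φ y • F y := hφ.continuous.smul hF
  have h2 : ‖∫ y in (x - l / 2)..(x + l / 2), φ y • (F x - F y)‖
      ≤ ∫ y in (x - l / 2)..(x + l / 2), φ y * ε := by
    refine intervalIntegral.norm_integral_le_of_norm_le hle ?_
      ((hφ.continuous.mul continuous_const).intervalIntegrable _ _)
    refine Eventually.of_forall fun y hy => ?_
    rw [norm_smul, Real.norm_of_nonneg (hpos y)]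
    by_cases h0 : φ y = 0
    · rw [h0, zero_mul, zero_mul]
    · refine mul_le_mul_of_nonneg_left ?_ (hpos y)
      have h3 := hFδ ((hsupp y ⟨hy.1.le, hy.2⟩ h0).trans_le (min_le_left _ _))
      rw [dist_comm, dist_eq_norm] at h3
      exact h3.le
  rw [intervalIntegral.integral_mul_const] at h2
  have h4 : (∫ y in (x - l / 2)..(x + l / 2), φ y) • F x
      = (∫ y in (x - l / 2)..(x + l / 2), φ y • (F x - F y))
        + ∫ y in (x - l / 2)..(x + l / 2), φ y • F y := by
    rw [← intervalIntegral.integral_add (c1.intervalIntegrable _ _) (c2.intervalIntegrable _ _),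
      ← intervalIntegral.integral_smul_const]
    refine intervalIntegral.integral_congr fun y _ => ?_
    module
  have h5 : (∫ y in (x - l / 2)..(x + l / 2), φ y) * ‖F x‖
      ≤ (∫ y in (x - l / 2)..(x + l / 2), φ y) * (D + ε) := by
    calc _ = ‖(∫ y in (x - l / 2)..(x + l / 2), φ y) • F x‖ := by
          rw [norm_smul, Real.norm_of_nonneg hint.le]
      _ ≤ _ := by
          rw [h4]
          refine (norm_add_le _ _).trans ?_
          linarith
  exact le_of_mul_le_mul_left h5 hint

/-! ### Smearing the heat kernel -/

/-- The kernel `U`, smeared in its last variable. -/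
def smear (φ : ℝ → ℝ) (l : ℝ) (U : ℝ × ℝ × ℝ → V) (p : ℝ × ℝ) : V :=
  ∫ y in (0 : ℝ)..l, φ y • U (p.1, p.2, y)

theorem isOpen_halfSpace : IsOpen (Ioi (0 : ℝ) ×ˢ (univ : Set (ℝ × ℝ))) :=
  isOpen_Ioi.prod isOpen_univ

variable {φ : ℝ → ℝ} {l : ℝ} {U : ℝ × ℝ × ℝ → V}

theorem contDiffOn_smear (hφ : ContDiff ℝ ∞ φ) (hU : ContDiffOn ℝ ∞ U (Ioi 0 ×ˢ univ)) :
    ContDiffOn ℝ ∞ (smear φ l U) (Ioi 0 ×ˢ univ) := by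
  -- Writing time as an exponential turns the half line into the line, where smoothness of
  -- parametric integrals is known globally; the logarithm undoes this on t > 0.
  have h1 : ContDiff ℝ ∞ fun p : (ℝ × ℝ) × ℝ => φ p.2 • U (Real.exp p.1.1, p.1.2, p.2) := by
    refine (hφ.comp contDiff_snd).smul ?_
    refine hU.comp_contDiff (f := fun p : (ℝ × ℝ) × ℝ => (Real.exp p.1.1, p.1.2, p.2)) ?_
      fun p => ⟨Real.exp_pos _, mem_univ _⟩
    fun_prop
  have h2 := contDiff_intervalIntegral_param h1 0 l
  have h3 : ContDiffOn ℝ ∞ (fun p : ℝ × ℝ => (Real.log p.1, p.2)) (Ioi 0 ×ˢ univ) :=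
    (contDiffOn_fst.log fun p hp => (show (0 : ℝ) < p.1 from hp.1).ne').prodMk contDiffOn_snd
  refine (h2.comp_contDiffOn h3).congr fun p hp => ?_
  simp only [smear, Function.comp_apply, Real.exp_log (show (0 : ℝ) < p.1 from hp.1)]

theorem hasDerivAt_smear (hφ : Continuous φ) (hU : ContDiffOn ℝ ∞ U (Ioi 0 ×ˢ univ))
    {c : ℝ → ℝ × ℝ} {c' : ℝ × ℝ} (hc : ∀ s, HasDerivAt c c' s) {s : ℝ} (hs : 0 < (c s).1) :
    HasDerivAt (fun s => smear φ l U (c s))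
      (smear φ l (fun p => fderiv ℝ U p (c'.1, c'.2, 0)) (c s)) s := by
  have hcc : Continuous c := continuous_iff_continuousAt.2 fun s => (hc s).continuousAt
  have hU' : ContDiffOn ℝ ∞ (fun p => fderiv ℝ U p (c'.1, c'.2, 0)) (Ioi 0 ×ˢ univ) :=
    (hU.fderiv_of_isOpen isOpen_halfSpace (m := ∞) (by simp)).clm_apply contDiffOn_const
  refine hasDerivAt_intervalIntegral_param
    (F := fun s y => φ y • U ((c s).1, (c s).2, y))
    (F' := fun s y => φ y • fderiv ℝ U ((c s).1, (c s).2, y) (c'.1, c'.2, 0))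
    (O := {s | 0 < (c s).1}) (isOpen_lt continuous_const hcc.fst) hs 0 l ?_ ?_ ?_
  · intro s hs
    exact hφ.smul (hU.continuousOn.comp_continuous (by fun_prop) fun y => ⟨hs, mem_univ _⟩)
  · refine (hφ.comp_continuousOn continuousOn_snd).smul ?_
    exact hU'.continuousOn.comp (f := fun q : ℝ × ℝ => ((c q.1).1, (c q.1).2, q.2))
      (by fun_prop) fun q hq => ⟨hq.1, mem_univ _⟩
  · intro s hs y
    have h1 : HasDerivAt (fun s => ((c s).1, (c s).2, y)) (c'.1, c'.2, (0 : ℝ)) s :=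
      (hc s).fst.prodMk ((hc s).snd.prodMk (hasDerivAt_const s y))
    exact (((hU.contDiffAt (x := ((c s).1, (c s).2, y)) (isOpen_halfSpace.mem_nhds ⟨hs, mem_univ _⟩)).differentiableAt
      (by simp)).hasFDerivAt.comp_hasDerivAt s h1).const_smul (φ y)

theorem partialDeriv_time_smear (hφ : ContDiff ℝ ∞ φ) (hU : ContDiffOn ℝ ∞ U (Ioi 0 ×ˢ univ))
    {s : ℝ} (hs : 0 < s) (z : ℝ) :
    partialDeriv (1, 0) (smear φ l U) (s, z)
      = smear φ l (fun p => fderiv ℝ U p (1, 0, 0)) (s, z) :=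
  (hasDerivAt_time (contDiffOn_smear hφ hU) hs z).unique
    (hasDerivAt_smear hφ.continuous hU (c := fun s => (s, z)) (c' := (1, 0))
      (fun s => (hasDerivAt_id s).prodMk (hasDerivAt_const s z)) hs)

theorem partialDeriv_space_smear (hφ : ContDiff ℝ ∞ φ) (hU : ContDiffOn ℝ ∞ U (Ioi 0 ×ˢ univ))
    {s : ℝ} (hs : 0 < s) (z : ℝ) :
    partialDeriv (0, 1) (smear φ l U) (s, z)
      = smear φ l (fun p => fderiv ℝ U p (0, 1, 0)) (s, z) :=
  (hasDerivAt_space (contDiffOn_smear hφ hU) hs z).unique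
    (hasDerivAt_smear hφ.continuous hU (c := fun z => (s, z)) (c' := (0, 1))
      (fun z => (hasDerivAt_const z s).prodMk (hasDerivAt_id z)) hs)

theorem deriv_time_kernel (hU : ContDiffOn ℝ ∞ U (Ioi 0 ×ˢ univ)) {s : ℝ} (hs : 0 < s) (z y : ℝ) :
    deriv (fun s => U (s, z, y)) s = fderiv ℝ U (s, z, y) (1, 0, 0) :=
  (((hU.contDiffAt (x := (s, z, y)) (isOpen_halfSpace.mem_nhds ⟨hs, mem_univ _⟩)).differentiableAt
    (by simp)).hasFDerivAt.comp_hasDerivAt s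
      ((hasDerivAt_id s).prodMk (hasDerivAt_const s (z, y)))).deriv

theorem deriv_space_kernel (hU : ContDiffOn ℝ ∞ U (Ioi 0 ×ˢ univ)) {s : ℝ} (hs : 0 < s) (z y : ℝ) :
    deriv (fun z => U (s, z, y)) z = fderiv ℝ U (s, z, y) (0, 1, 0) :=
  (((hU.contDiffAt (x := (s, z, y)) (isOpen_halfSpace.mem_nhds ⟨hs, mem_univ _⟩)).differentiableAt
    (by simp)).hasFDerivAt.comp_hasDerivAt z
      ((hasDerivAt_const z s).prodMk ((hasDerivAt_id z).prodMk (hasDerivAt_const z y)))).deriv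

theorem iteratedDeriv_space_kernel (hU : ContDiffOn ℝ ∞ U (Ioi 0 ×ˢ univ)) {s : ℝ} (hs : 0 < s)
    (z y : ℝ) : iteratedDeriv 2 (fun z => U (s, z, y)) z
      = fderiv ℝ (fun p => fderiv ℝ U p (0, 1, 0)) (s, z, y) (0, 1, 0) := by
  have hU' : ContDiffOn ℝ ∞ (fun p => fderiv ℝ U p (0, 1, 0)) (Ioi 0 ×ˢ univ) :=
    (hU.fderiv_of_isOpen isOpen_halfSpace (m := ∞) (by simp)).clm_apply contDiffOn_const
  rw [iteratedDeriv_succ, iteratedDeriv_one, ← deriv_space_kernel hU' hs]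
  congr 1
  exact funext fun z => deriv_space_kernel hU hs z y

theorem partialDeriv_space_space_smear (hφ : ContDiff ℝ ∞ φ)
    (hU : ContDiffOn ℝ ∞ U (Ioi 0 ×ˢ univ)) {s : ℝ} (hs : 0 < s) (z : ℝ) :
    partialDeriv (0, 1) (partialDeriv (0, 1) (smear φ l U)) (s, z)
      = smear φ l (fun p => fderiv ℝ (fun p => fderiv ℝ U p (0, 1, 0)) p (0, 1, 0)) (s, z) := by
  have hU' : ContDiffOn ℝ ∞ (fun p => fderiv ℝ U p (0, 1, 0)) (Ioi 0 ×ˢ univ) :=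
    (hU.fderiv_of_isOpen isOpen_halfSpace (m := ∞) (by simp)).clm_apply contDiffOn_const
  rw [← partialDeriv_space_smear hφ hU' hs]
  have h : partialDeriv (0, 1) (smear φ l U)
      =ᶠ[𝓝 (s, z)] smear φ l (fun p => fderiv ℝ U p (0, 1, 0)) := by
    filter_upwards [isOpen_halfPlane.mem_nhds ⟨hs, mem_univ z⟩] with p hp
    exact partialDeriv_space_smear hφ hU hp.1 p.2
  rw [partialDeriv, partialDeriv, h.fderiv_eq]

end

noncomputable section

/-! ### Comparison of a solution with the parametrix -/

variable {𝔸 : Type} [NormedRing 𝔸] [NormedAlgebra ℝ 𝔸] {W : Type} [NormedAddCommGroup W]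
  [NormedSpace ℝ W]

theorem expSum_zero_left (q : smoothAlg ℝ 𝔸) (M : ℕ) (z x : ℝ) :
    expSum (heatEl q) M 0 z x = 1 := by
  rw [expSum, Finset.sum_range_succ', Finset.sum_eq_zero fun k _ => ?_, zero_add]
  · change expCoeff 0 0 • (1 : 𝔸) = 1
    simp [expCoeff]
  · simp [expCoeff]

variable {χ : ℝ → ℝ} {L ρ : ℝ}

theorem parametrix_eq_zero (hχ : ContDiff ℝ ∞ χ) (hρL : ρ < L) (hχ0 : ∀ w, ρ ≤ |w| → χ w = 0)
    (q : smoothAlg ℝ 𝔸) (M : ℕ) (x : ℝ) {τ : ℝ} (hτ : 0 < τ) {z : ℝ} (hz : |z - x| = L) :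
    parametrix χ q M x (τ, z) = 0 ∧ partialDeriv (0, 1) (parametrix χ q M x) (τ, z) = 0 := by
  have h0 : χ (z - x) = 0 := hχ0 _ (hz ▸ hρL.le)
  have h1 : deriv χ (z - x) = 0 := by
    have h : χ =ᶠ[𝓝 (z - x)] fun _ => 0 := by
      filter_upwards [(isOpen_Ioi.preimage continuous_abs).mem_nhds
        (show ρ < |z - x| from hz ▸ hρL)] with v hv using hχ0 v (le_of_lt hv)
    rw [h.deriv_eq, deriv_const]
  constructor
  · simp [parametrix, h0]
  · rw [partialDeriv_space_parametrix hχ q M x hτ, h0, h1]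
    simp

theorem tendsto_pairing_zero [CompleteSpace W] (β : 𝔸 →L[ℝ] W →L[ℝ] W) {p : ℝ × ℝ → 𝔸}
    (hp : ContDiffOn ℝ ∞ p (Ioi 0 ×ˢ univ)) {u : ℝ × ℝ → W}
    (hu : ContDiffOn ℝ ∞ u (Ioi 0 ×ˢ univ)) {f : ℝ → W} (hf : Continuous f)
    (hlim : TendstoUniformly (fun s z => u (s, z)) f (𝓝[>] 0)) (α b : ℝ) {t : ℝ} (ht : 0 < t) :
    Tendsto (fun s => ∫ z in α..b, β (p (t - s, z)) (u (s, z))) (𝓝[>] 0)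
      (𝓝 (∫ z in α..b, β (p (t, z)) (f z))) := by
  have hK : IsCompact (Icc (t / 2) t ×ˢ uIcc α b) := isCompact_Icc.prod isCompact_uIcc
  obtain ⟨P, hP⟩ := hK.exists_bound_of_continuousOn
    (hp.continuousOn.mono (prod_mono (fun s hs => (half_pos ht).trans_le hs.1) (subset_univ _)))
  obtain ⟨R, hR⟩ := (isCompact_uIcc (a := α) (b := b)).exists_bound_of_continuousOn hf.continuousOn
  refine intervalIntegral.tendsto_integral_filter_of_dominated_convergence
    (fun _ => ‖β‖ * |P| * (|R| + 1)) ?_ ?_ (by simp) ?_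
  · filter_upwards [Ioo_mem_nhdsGT ht] with s hs
    exact ((β.continuous.comp (continuous_space hp (sub_pos.2 hs.2))).clm_apply
      (continuous_space hu hs.1)).aestronglyMeasurable
  · filter_upwards [Ioo_mem_nhdsGT (half_pos ht), Metric.tendstoUniformly_iff.1 hlim 1 one_pos]
      with s hs h1
    refine Eventually.of_forall fun z hz => ?_
    have hz' := uIoc_subset_uIcc hz
    have h2 := h1 z
    rw [dist_comm, dist_eq_norm] at h2
    have h3 : ‖u (s, z)‖ ≤ |R| + 1 := by
      linarith [norm_sub_norm_le (u (s, z)) (f z), hR z hz', le_abs_self R]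
    have h4 : ‖p (t - s, z)‖ ≤ |P| :=
      (hP (t - s, z) ⟨⟨by linarith [hs.2], by linarith [hs.1]⟩, hz'⟩).trans (le_abs_self P)
    exact (β.le_opNorm₂ _ _).trans (by gcongr)
  · refine Eventually.of_forall fun z _ => ?_
    have h1 : Tendsto (fun s => p (t - s, z)) (𝓝[>] 0) (𝓝 (p (t, z))) := by
      have h : ContinuousAt p (t, z) :=
        hp.continuousOn.continuousAt (isOpen_halfPlane.mem_nhds ⟨ht, mem_univ _⟩)
      have h2 : Continuous fun s : ℝ => (t - s, z) := by fun_prop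
      have h3 := (h2.tendsto 0).mono_left (nhdsWithin_le_nhds (s := Ioi 0))
      rw [sub_zero] at h3
      exact h.tendsto.comp h3
    have h2 : Continuous fun r : 𝔸 × W => β r.1 r.2 :=
      (β.continuous.comp continuous_fst).clm_apply continuous_snd
    exact (h2.tendsto (p (t, z), f z)).comp (h1.prodMk_nhds (hlim.tendsto_at z))

/-- As the parametrix time τ tends to 0, the Gaussian concentrates at x, where the cutoff and the
series are 1. The integrand keeps the form t - (t - τ) so that it is the pairing at time s = t - τ.
-/
theorem tendsto_pairing_end [CompleteSpace W] (β : 𝔸 →L[ℝ] W →L[ℝ] W) (hβ1 : ∀ w, β 1 w = w)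
    (hχ : ContDiff ℝ ∞ χ) (hρL : ρ < L) (hχ0 : ∀ w, ρ ≤ |w| → χ w = 0)
    (hχ1 : χ 0 = 1) (q : smoothAlg ℝ 𝔸) (M : ℕ) (x : ℝ) {u : ℝ × ℝ → W}
    (hu : ContDiffOn ℝ ∞ u (Ioi 0 ×ˢ univ)) {t : ℝ} (ht : 0 < t) :
    Tendsto (fun τ => ∫ z in (x - L)..(x + L),
        β (parametrix χ q M x (t - (t - τ), z)) (u (t - τ, z))) (𝓝[>] 0) (𝓝 (u (t, x))) := by
  -- H is the pairing without its Gaussian factor, centred at x. It is continuous up to τ = 0, with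
  -- H 0 0 = u(t, x).
  set H : ℝ → ℝ → W := fun τ w =>
    χ w • β (expSum (heatEl q) M τ (x + w) x) (u (t - τ, x + w)) with hH
  have hcont : ContinuousOn (fun p : ℝ × ℝ => H p.1 p.2) (Iio t ×ˢ univ) := by
    have h1 : ContinuousOn (fun p : ℝ × ℝ => u (t - p.1, x + p.2)) (Iio t ×ˢ univ) :=
      hu.continuousOn.comp (f := fun p : ℝ × ℝ => (t - p.1, x + p.2)) (by fun_prop)
        fun p hp => ⟨show (0 : ℝ) < t - p.1 from sub_pos.2 hp.1, mem_univ _⟩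
    have h2 : Continuous fun p : ℝ × ℝ => expSum (heatEl q) M p.1 (x + p.2) x :=
      (contDiff_expSum (heatEl q) M).continuous.comp
        (f := fun p : ℝ × ℝ => (p.1, x + p.2, x)) (by fun_prop)
    exact (hχ.continuous.comp continuous_snd).continuousOn.smul
      ((β.continuous.comp h2).continuousOn.clm_apply h1)
  have hcw : ∀ τ, τ < t → Continuous (H τ) := fun τ hτ =>
    hcont.comp_continuous (f := fun w => (τ, w)) (by fun_prop) fun w => ⟨hτ, mem_univ _⟩
  have hK : IsCompact (Icc (0 : ℝ) (t / 2) ×ˢ Icc (-L) L) := isCompact_Icc.prod isCompact_Icc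
  obtain ⟨P, hP⟩ := hK.exists_bound_of_continuousOn (hcont.mono (prod_mono
    (fun s hs => lt_of_le_of_lt hs.2 (by linarith)) (subset_univ _)))
  have hlim := tendsto_integral_gaussKernel (h := H) (M := |P|) (v := u (t, x)) ?_ ?_ ?_
  · refine hlim.congr' ?_
    filter_upwards [Ioo_mem_nhdsGT ht] with τ hτ
    have hsupp : (Function.support fun w => gaussKernel τ w • H τ w) ⊆ Ioc (-L) L := by
      intro w hw
      by_contra hn
      refine hw ?_
      have : ρ ≤ |w| := by
        by_contra hlt
        rw [not_le] at hlt
        have := abs_lt.1 (hlt.trans hρL)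
        exact hn ⟨this.1, this.2.le⟩
      simp only [hH, hχ0 w this, zero_smul, smul_zero]
    rw [← intervalIntegral.integral_eq_integral_of_support_subset hsupp, sub_sub_cancel,
      show x - L = x + -L by ring, ← intervalIntegral.integral_comp_add_left]
    refine intervalIntegral.integral_congr fun w _ => ?_
    simp only [hH, parametrix, add_sub_cancel_left, map_smul, smul_apply, smul_smul]
  · filter_upwards [Ioo_mem_nhdsGT ht] with τ hτ using hcw τ hτ.2
  · filter_upwards [Ioo_mem_nhdsGT (half_pos ht)] with τ hτ w
    by_cases hw : ρ ≤ |w|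
    · simp only [hH, hχ0 w hw, zero_smul, norm_zero, abs_nonneg]
    · have := abs_lt.1 ((not_le.1 hw).trans hρL)
      exact (hP (τ, w) ⟨⟨hτ.1.le, hτ.2.le⟩, ⟨this.1.le, this.2.le⟩⟩).trans (le_abs_self P)
  · have h0 : H 0 0 = u (t, x) := by
      simp only [hH, add_zero, sub_zero, expSum_zero_left, hβ1, hχ1, one_smul]
    have h1 : ContinuousAt (fun p : ℝ × ℝ => H p.1 p.2) (0, 0) :=
      hcont.continuousAt ((isOpen_Iio.prod isOpen_univ).mem_nhds ⟨ht, mem_univ _⟩)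
    have h2 := h1.tendsto
    simp only [h0, nhds_prod_eq] at h2
    exact h2.mono_left (Filter.prod_mono nhdsWithin_le_nhds le_rfl)

/-- Duhamel's principle: the pairing of the parametrix at time t - s with u at time s has derivative
minus the paired defect, of norm at most b C A t^K. Its limits at s → t and s → 0 are u(t, x) and
the integral against f, and the interval has length t. -/
theorem norm_sub_integral_parametrix_le [CompleteSpace 𝔸] [CompleteSpace W]
    (β : 𝔸 →L[ℝ] W →L[ℝ] W) {b : ℝ} (hb0 : 0 ≤ b)
    (hb : ∀ v w, ‖β v w‖ ≤ b * ‖v‖ * ‖w‖) (hβ1 : ∀ w, β 1 w = w)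
    (hχ : ContDiff ℝ ∞ χ) (hL : 0 < L) (hρL : ρ < L) (hχ0 : ∀ w, ρ ≤ |w| → χ w = 0)
    (hχ1 : χ 0 = 1) (q : smoothAlg ℝ 𝔸) {A' : ℝ → W → W}
    (hA : ∀ z v w, β (q.1 z * v) w = β v (A' z w)) (M : ℕ) (x : ℝ) {u : ℝ × ℝ → W}
    (hu : ContDiffOn ℝ ∞ u (Ioi 0 ×ˢ univ))
    (hue : ∀ τ z, 0 < τ → partialDeriv (1, 0) u (τ, z)
      = partialDeriv (0, 1) (partialDeriv (0, 1) u) (τ, z) - A' z (u (τ, z)))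
    {f : ℝ → W} (hf : Continuous f) (hlim : TendstoUniformly (fun s z => u (s, z)) f (𝓝[>] 0))
    {K : ℕ} {C A : ℝ} (hC0 : 0 ≤ C) (hC : ∀ τ ∈ Ioc (0 : ℝ) 1, ∀ z ∈ Icc (x - L) (x + L),
      ‖parametrixDefect χ q M x (τ, z)‖ ≤ C * τ ^ K)
    (hA1 : ∀ s ∈ Ioc (0 : ℝ) 1, ∫ z in (x - L)..(x + L), ‖u (s, z)‖ ≤ A)
    {t : ℝ} (ht : t ∈ Ioc (0 : ℝ) 1) :
    ‖u (t, x) - ∫ z in (x - L)..(x + L), β (parametrix χ q M x (t, z)) (f z)‖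
      ≤ b * C * A * t ^ (K + 1) := by
  have hp := contDiffOn_parametrix hχ q M x
  have hle : x - L ≤ x + L := by linarith
  set J : ℝ → W := fun s => ∫ z in (x - L)..(x + L), β (parametrix χ q M x (t - s, z)) (u (s, z))
    with hJ
  have hder : ∀ s ∈ Ioo 0 t, HasDerivAt J
      (-∫ z in (x - L)..(x + L), β (parametrixDefect χ q M x (t - s, z)) (u (s, z))) s :=
    fun s hs => hasDerivAt_heat_pairing β (A := fun z v => q.1 z * v) hA hp hu
      (fun τ z hτ => parametrix_eq hχ q M x τ z hτ) hue
      (fun τ hτ => parametrix_eq_zero hχ hρL hχ0 q M x hτ (by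
        rw [sub_sub_cancel_left, abs_neg, abs_of_pos hL]))
      (fun τ hτ => parametrix_eq_zero hχ hρL hχ0 q M x hτ (by
        rw [add_sub_cancel_left, abs_of_pos hL])) hs
  have hbound : ∀ s ∈ Ioo 0 t,
      ‖-∫ z in (x - L)..(x + L), β (parametrixDefect χ q M x (t - s, z)) (u (s, z))‖
        ≤ b * C * A * t ^ K := by
    intro s hs
    rw [norm_neg]
    have cu : Continuous fun z => b * C * t ^ K * ‖u (s, z)‖ :=
      continuous_const.mul (continuous_space hu hs.1).norm
    have h1 : ‖∫ z in (x - L)..(x + L), β (parametrixDefect χ q M x (t - s, z)) (u (s, z))‖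
        ≤ ∫ z in (x - L)..(x + L), b * C * t ^ K * ‖u (s, z)‖ := by
      refine intervalIntegral.norm_integral_le_of_norm_le hle (Eventually.of_forall fun z hz => ?_)
        (cu.intervalIntegrable _ _)
      have h2 := hC (t - s) ⟨sub_pos.2 hs.2, by linarith [hs.1, ht.2]⟩ z ⟨hz.1.le, hz.2⟩
      have h3 : C * (t - s) ^ K ≤ C * t ^ K :=
        mul_le_mul_of_nonneg_left (pow_le_pow_left₀ (sub_nonneg.2 hs.2.le)
          (by linarith [hs.1]) K) hC0
      refine (hb _ _).trans ?_
      rw [mul_assoc b C]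
      gcongr
      exact h2.trans h3
    rw [intervalIntegral.integral_const_mul] at h1
    refine h1.trans ?_
    have h4 := hA1 s ⟨hs.1, hs.2.le.trans ht.2⟩
    calc b * C * t ^ K * ∫ z in (x - L)..(x + L), ‖u (s, z)‖ ≤ b * C * t ^ K * A :=
          mul_le_mul_of_nonneg_left h4 (mul_nonneg (by positivity) (pow_nonneg ht.1.le K))
      _ = _ := by ring
  have hdiff : ∀ s₁ ∈ Ioo 0 t, ∀ s₂ ∈ Ioo 0 t, ‖J s₂ - J s₁‖ ≤ b * C * A * t ^ (K + 1) := by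
    intro s₁ h₁ s₂ h₂
    have h := (convex_Ioo 0 t).norm_image_sub_le_of_norm_hasDerivWithin_le
      (fun s hs => (hder s hs).hasDerivWithinAt) hbound h₁ h₂
    refine h.trans ?_
    rw [pow_succ, ← mul_assoc]
    refine mul_le_mul_of_nonneg_left ?_ ((norm_nonneg _).trans (hbound s₁ h₁))
    rw [Real.norm_eq_abs, abs_le]
    constructor <;> linarith [h₁.1, h₁.2, h₂.1, h₂.2]
  have hend := tendsto_pairing_end β hβ1 hχ hρL hχ0 hχ1 q M x hu ht.1
  have hzero := tendsto_pairing_zero β hp hu hf hlim (x - L) (x + L) ht.1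
  have h1 : ∀ s ∈ Ioo 0 t, ‖u (t, x) - J s‖ ≤ b * C * A * t ^ (K + 1) := by
    intro s hs
    refine le_of_tendsto (hend.sub_const (J s)).norm ?_
    filter_upwards [Ioo_mem_nhdsGT ht.1] with τ hτ
    exact hdiff s hs (t - τ) ⟨sub_pos.2 hτ.2, by linarith [hτ.1]⟩
  refine le_of_tendsto (hzero.const_sub (u (t, x))).norm ?_
  filter_upwards [Ioo_mem_nhdsGT ht.1] with s hs using h1 s hs

end

noncomputable section

/-! ### Smeared heat kernels solve the heat equation -/

section

variable {𝔸 : Type} [NormedRing 𝔸] [NormedAlgebra ℝ 𝔸]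
  {φ : ℝ → ℝ} {l : ℝ} {U : ℝ × ℝ × ℝ → 𝔸}

theorem smear_heat_eq [CompleteSpace 𝔸] (hφ : ContDiff ℝ ∞ φ) (hU : ContDiffOn ℝ ∞ U (Ioi 0 ×ˢ univ)) {q : ℝ → 𝔸}
    (hq : ∀ t, 0 < t → ∀ z y, deriv (fun s => U (s, z, y)) t
      + (-iteratedDeriv 2 (fun z => U (t, z, y)) z + q z * U (t, z, y)) = 0)
    {s : ℝ} (hs : 0 < s) (z : ℝ) :
    partialDeriv (1, 0) (smear φ l U) (s, z)
      = partialDeriv (0, 1) (partialDeriv (0, 1) (smear φ l U)) (s, z)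
        - q z * smear φ l U (s, z) := by
  have hU' : ContDiffOn ℝ ∞ (fun p => fderiv ℝ U p (0, 1, 0)) (Ioi 0 ×ˢ univ) :=
    (hU.fderiv_of_isOpen isOpen_halfSpace (m := ∞) (by simp)).clm_apply contDiffOn_const
  have hU'' : ContDiffOn ℝ ∞ (fun p => fderiv ℝ (fun p => fderiv ℝ U p (0, 1, 0)) p (0, 1, 0))
      (Ioi 0 ×ˢ univ) :=
    (hU'.fderiv_of_isOpen isOpen_halfSpace (m := ∞) (by simp)).clm_apply contDiffOn_const
  have cy : ∀ {F : ℝ × ℝ × ℝ → 𝔸}, ContDiffOn ℝ ∞ F (Ioi 0 ×ˢ univ) →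
      Continuous fun y => φ y • F (s, z, y) := fun hF =>
    hφ.continuous.smul (hF.continuousOn.comp_continuous (f := fun y => (s, z, y)) (by fun_prop)
      fun y => ⟨hs, mem_univ _⟩)
  rw [partialDeriv_time_smear hφ hU hs, partialDeriv_space_space_smear hφ hU hs]
  have h1 : q z * smear φ l U (s, z) = ∫ y in (0 : ℝ)..l, q z * (φ y • U (s, z, y)) :=
    (((ContinuousLinearMap.mul ℝ 𝔸) (q z)).intervalIntegral_comp_comm
      ((cy hU).intervalIntegrable _ _)).symm
  have c1 : Continuous fun y => q z * (φ y • U (s, z, y)) := continuous_const.mul (cy hU)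
  rw [h1]
  refine Eq.trans ?_ (intervalIntegral.integral_sub ((cy hU'').intervalIntegrable _ _)
    (c1.intervalIntegrable _ _))
  refine intervalIntegral.integral_congr fun y _ => ?_
  have h2 := hq s hs z y
  rw [deriv_time_kernel hU hs, iteratedDeriv_space_kernel hU hs] at h2
  simp only [mul_smul_comm]
  linear_combination (norm := module) (φ y) • h2

theorem smear_periodic (hφ : ContDiff ℝ ∞ φ) (hU : ContDiffOn ℝ ∞ U (Ioi 0 ×ˢ univ)) {T : ℝ}
    (hper : ∀ t, 0 < t → ∀ z y, U (t, z + T, y) = U (t, z, y)) {s : ℝ} (hs : 0 < s) (z : ℝ) :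
    smear φ l U (s, z + T) = smear φ l U (s, z)
      ∧ partialDeriv (0, 1) (smear φ l U) (s, z + T) = partialDeriv (0, 1) (smear φ l U) (s, z) := by
  have h0 : ∀ z, smear φ l U (s, z + T) = smear φ l U (s, z) := fun z =>
    intervalIntegral.integral_congr fun y _ => congrArg (φ y • ·) (hper s hs z y)
  refine ⟨h0 z, ?_⟩
  have h1 := (hasDerivAt_space (contDiffOn_smear (l := l) hφ hU) hs (z + T)).comp_add_const z T
  have h2 := hasDerivAt_space (contDiffOn_smear (l := l) hφ hU) hs z
  simp only [h0] at h1
  exact h1.unique h2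

end

/-! ### Matrix norms -/

variable {a : ℝ} {N : ℕ}

theorem abs_entry_le (A : Mat N) (i j : Fin N) : |A i j| ≤ ‖A‖ := by
  rw [Matrix.linfty_opNorm_def]
  have h1 : (∑ k, ‖A i k‖₊ : NNReal) ≤ Finset.univ.sup fun i => ∑ k, ‖A i k‖₊ :=
    Finset.le_sup (f := fun i => ∑ k, ‖A i k‖₊) (Finset.mem_univ i)
  have h2 : ‖A i j‖₊ ≤ ∑ k, ‖A i k‖₊ :=
    Finset.single_le_sum (f := fun k => ‖A i k‖₊) (fun _ _ => zero_le) (Finset.mem_univ j)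
  exact NNReal.coe_le_coe.2 (h2.trans h1)

theorem norm_le_sum_entries (A : Mat N) : ‖A‖ ≤ ∑ i, ∑ j, |A i j| := by
  rw [Matrix.linfty_opNorm_def]
  have h : (Finset.univ.sup fun i => ∑ k, ‖A i k‖₊ : NNReal) ≤ ∑ i, ∑ k, ‖A i k‖₊ :=
    Finset.sup_le fun i _ => Finset.single_le_sum (f := fun i => ∑ k, ‖A i k‖₊)
      (fun _ _ => zero_le) (Finset.mem_univ i)
  have h2 := NNReal.coe_le_coe.2 h
  push_cast at h2
  exact h2

/-- The pairing `(v, w) ↦ vᵀ w` of matrices. -/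
def matPairing (N : ℕ) : Mat N →L[ℝ] Mat N →L[ℝ] Mat N :=
  (ContinuousLinearMap.mul ℝ (Mat N)).comp (transposeCLM N)

theorem matPairing_apply (v w : Mat N) : matPairing N v w = vᵀ * w := rfl

theorem exists_bilin_bound {V W Z : Type} [NormedAddCommGroup V] [NormedSpace ℝ V]
    [NormedAddCommGroup W] [NormedSpace ℝ W] [NormedAddCommGroup Z] [NormedSpace ℝ Z]
    (β : V →L[ℝ] W →L[ℝ] Z) : ∃ b : ℝ, 0 ≤ b ∧ ∀ v w, ‖β v w‖ ≤ b * ‖v‖ * ‖w‖ :=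
  ⟨‖β‖, norm_nonneg β, β.le_opNorm₂⟩

theorem abs_trace_le (A : Mat N) : |A.trace| ≤ N * ‖A‖ := by
  refine (Finset.abs_sum_le_sum_abs _ _).trans
    ((Finset.sum_le_sum fun i _ => abs_entry_le A i i).trans (le_of_eq ?_))
  simp

/-- The inner product `(v, w) ↦ tr (vᵀ w)` of matrices. -/
def matInner (N : ℕ) : Mat N →L[ℝ] Mat N →L[ℝ] ℝ :=
  (ContinuousLinearMap.compL ℝ (Mat N) (Mat N) ℝ (traceCLM N)).comp (matPairing N)

theorem matInner_apply (v w : Mat N) : matInner N v w = ∑ j, ∑ i, v i j * w i j := by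
  change (vᵀ * w).trace = _
  simp only [Matrix.trace, Matrix.diag_apply, Matrix.mul_apply, Matrix.transpose_apply]

theorem matInner_symm (v w : Mat N) : matInner N v w = matInner N w v := by
  simp only [matInner_apply, mul_comm]

theorem matInner_nonneg (v : Mat N) : 0 ≤ matInner N v v := by
  rw [matInner_apply]
  exact Finset.sum_nonneg fun j _ => Finset.sum_nonneg fun i _ => mul_self_nonneg _

theorem norm_le_sqrt_matInner (v : Mat N) : ‖v‖ ≤ (N : ℝ) * (N * Real.sqrt (matInner N v v)) := by
  have h : ∀ i j, |v i j| ≤ Real.sqrt (matInner N v v) := by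
    intro i j
    refine Real.le_sqrt_of_sq_le ?_
    rw [sq_abs, matInner_apply, sq]
    refine le_trans ?_ (Finset.single_le_sum (f := fun j => ∑ i, v i j * v i j)
      (fun j _ => Finset.sum_nonneg fun i _ => mul_self_nonneg _) (Finset.mem_univ j))
    exact Finset.single_le_sum (f := fun i => v i j * v i j)
      (fun i _ => mul_self_nonneg _) (Finset.mem_univ i)
  refine (norm_le_sum_entries v).trans ((Finset.sum_le_sum fun i _ =>
    Finset.sum_le_sum fun j _ => h i j).trans (le_of_eq ?_))
  simp

/-- Entries of q are bounded by R, and 2|w_{ij} w_{kj}| ≤ w_{ij}² + w_{kj}²; the free index in each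
sum produces the factor N. -/
theorem neg_matInner_mul_le {q : Mat N} {R : ℝ} (hq : ‖q‖ ≤ R) (w : Mat N) :
    -matInner N w (q * w) ≤ R * N * matInner N w w := by
  have h1 : -matInner N w (q * w) = ∑ j, ∑ i, ∑ k, -(w i j * (q i k * w k j)) := by
    rw [matInner_apply]
    simp only [Matrix.mul_apply, Finset.mul_sum, Finset.sum_neg_distrib]
  have h2 : ∀ i j k, -(w i j * (q i k * w k j)) ≤ R / 2 * (w i j * w i j + w k j * w k j) := by
    intro i j k
    have h3 := abs_le.1 ((abs_entry_le q i k).trans hq)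
    nlinarith [sq_nonneg (w i j + w k j), sq_nonneg (w i j - w k j), h3.1, h3.2]
  rw [h1]
  refine (Finset.sum_le_sum fun j _ => Finset.sum_le_sum fun i _ => Finset.sum_le_sum fun k _ =>
    h2 i j k).trans (le_of_eq ?_)
  rw [matInner_apply, Finset.mul_sum]
  refine Finset.sum_congr rfl fun j _ => ?_
  simp only [← Finset.mul_sum, Finset.sum_add_distrib, Finset.sum_const, Finset.card_univ,
    Fintype.card_fin, nsmul_eq_mul]
  have h3 : ∑ i, w i j * ((N : ℝ) * w i j) = N * ∑ i, w i j * w i j := by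
    rw [Finset.mul_sum]
    exact Finset.sum_congr rfl fun i _ => by ring
  rw [h3]
  ring

theorem matInner_smul_one (c : ℝ) (hc : 0 ≤ c) :
    Real.sqrt (matInner N (c • 1) (c • 1)) = c * Real.sqrt N := by
  have h : matInner N (c • 1) (c • 1) = c ^ 2 * N := by
    have h1 : matInner N 1 1 = (N : ℝ) := by
      change ((1 : Mat N)ᵀ * 1).trace = (N : ℝ)
      simp
    simp only [map_smul, smul_apply, h1, smul_eq_mul]
    ring
  rw [h, Real.sqrt_mul (by positivity), Real.sqrt_sq hc]

theorem exists_norm_potential_le (ha : 0 < a) (Q : Potential a N) : ∃ R : ℝ, 0 ≤ R ∧ ∀ x, ‖Q x‖ ≤ R := by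
  have hl : 0 < 2 * Real.pi * a := by positivity
  obtain ⟨R, hR⟩ := (isCompact_Icc (a := (0 : ℝ)) (b := 2 * Real.pi * a)).exists_bound_of_continuousOn
    (smoothAlg_contDiff (potEl Q)).continuous.continuousOn
  have h : ∀ x, ‖Q x‖ ≤ R := fun x => by
    obtain ⟨y, hy, hxy⟩ := Q.periodic.exists_mem_Ico₀ hl x
    rw [hxy]
    exact hR y ⟨hy.1, hy.2.le⟩
  exact ⟨R, (norm_nonneg _).trans (h 0), h⟩

/-! ### The initial condition -/

/-- A matrix entry as a continuous linear map. -/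
def entryCLM (i j : Fin N) : Mat N →L[ℝ] ℝ :=
  LinearMap.toContinuousLinearMap (Matrix.entryLinearMap ℝ ℝ i j)

/-- The initial condition concerns vector functions, so it is applied to the columns φ e_j and
reassembled entrywise. -/
theorem tendstoUniformly_smear {Q : Potential a N}
    {U : ℝ → ℝ → ℝ → Matrix (Fin N) (Fin N) ℝ} (hU : IsHeatKernel Q U) {φ : ℝ → ℝ}
    (hφ : Continuous φ) (hper : Function.Periodic φ (2 * Real.pi * a)) :
    TendstoUniformly (fun s z => smear φ (2 * Real.pi * a)
      (fun p : ℝ × ℝ × ℝ => (U p.1 p.2.1 p.2.2 : Mat N)) (s, z)) (fun z => φ z • (1 : Mat N))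
      (𝓝[>] 0) := by
  let f : Fin N → ℝ → Fin N → ℝ := fun j y => φ y • Pi.single j (1 : ℝ)
  have hf : ∀ j, Continuous (f j) := fun j => hφ.smul continuous_const
  have hcol : ∀ j : Fin N, TendstoUniformly (fun t x => ∫ y in (0 : ℝ)..(2 * Real.pi * a),
      U t x y *ᵥ f j y) (f j) (𝓝[>] 0) := fun j =>
    hU.initial (f j) (hf j) fun y => congrArg (fun c : ℝ => c • Pi.single j (1 : ℝ)) (hper y)
  refine Metric.tendstoUniformly_iff.2 fun ε hε => ?_
  -- There are N² entries to sum; the added 1 keeps the final inequality strict and the denominator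
  -- positive when N = 0.
  have hδ : 0 < ε / ((N : ℝ) * N + 1) := by positivity
  filter_upwards [eventually_all.2 fun j => Metric.tendstoUniformly_iff.1 (hcol j) _ hδ,
    self_mem_nhdsWithin] with s hs hs0 z
  have hcU : Continuous fun y => (U s z y : Mat N) :=
    hU.smooth.continuousOn.comp_continuous (f := fun y => (s, z, y)) (by fun_prop)
      fun y => ⟨hs0, mem_univ _⟩
  have hentry : ∀ i j, (smear φ (2 * Real.pi * a)
      (fun p : ℝ × ℝ × ℝ => (U p.1 p.2.1 p.2.2 : Mat N)) (s, z)) i j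
      = (∫ y in (0 : ℝ)..(2 * Real.pi * a), U s z y *ᵥ f j y) i := by
    intro i j
    have c1 : Continuous fun y => φ y • (U s z y : Mat N) := hφ.smul hcU
    have c2 : Continuous fun y => U s z y *ᵥ f j y :=
      hcU.matrix_mulVec (hf j)
    have h1 := (entryCLM i j).intervalIntegral_comp_comm
      (c1.intervalIntegrable (μ := MeasureTheory.volume) 0 (2 * Real.pi * a))
    have h2 := (ContinuousLinearMap.proj (R := ℝ) (φ := fun _ : Fin N => ℝ) i).intervalIntegral_comp_comm
      (c2.intervalIntegrable (μ := MeasureTheory.volume) 0 (2 * Real.pi * a))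
    refine h1.symm.trans (Eq.trans ?_ h2)
    refine intervalIntegral.integral_congr fun y _ => ?_
    change φ y * U s z y i j = (U s z y *ᵥ (φ y • Pi.single j (1 : ℝ))) i
    rw [Matrix.mulVec_smul, Matrix.mulVec_single_one]
    rfl
  rw [dist_eq_norm]
  refine (norm_le_sum_entries _).trans_lt ?_
  have hle : ∀ i j, |(φ z • (1 : Mat N) - smear φ (2 * Real.pi * a)
      (fun p : ℝ × ℝ × ℝ => (U p.1 p.2.1 p.2.2 : Mat N)) (s, z)) i j|
      ≤ ε / ((N : ℝ) * N + 1) := by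
    intro i j
    have h1 := hs j z
    rw [dist_eq_norm] at h1
    refine le_trans (le_of_eq ?_) ((norm_le_pi_norm _ i).trans h1.le)
    change _ = ‖φ z • (Pi.single j (1 : ℝ) : Fin N → ℝ) i - _‖
    rw [Matrix.sub_apply, hentry, Real.norm_eq_abs, Matrix.smul_apply,
      Matrix.one_apply, Pi.single_apply]
  refine (Finset.sum_le_sum fun i _ => Finset.sum_le_sum fun j _ => hle i j).trans_lt ?_
  simp only [Finset.sum_const, Finset.card_univ, Fintype.card_fin, nsmul_eq_mul]
  rw [← mul_assoc, mul_div_assoc', div_lt_iff₀ (by positivity)]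
  nlinarith

end

noncomputable section

variable {a : ℝ} {N : ℕ}

/-! ### The heat kernel on the diagonal -/

/-- The parametrix carries Q on the left, so the pairing vᵀw is used, for which multiplication by
the symmetric Q is self-adjoint; this is why the transpose appears. The smeared kernel has initial
value φ times the identity, and its L¹ bound is proportional to ∫φ, as concentration at y = x
requires. -/
theorem heatKernel_sub_parametrix_le (ha : 0 < a) {Q : Potential a N}
    {U : ℝ → ℝ → ℝ → Matrix (Fin N) (Fin N) ℝ} (hU : IsHeatKernel Q U) {χ : ℝ → ℝ}
    (hχ : ContDiff ℝ ∞ χ) {ρ : ℝ} (hρ : ρ < Real.pi * a) (hχ0 : ∀ w, ρ ≤ |w| → χ w = 0)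
    (hχ1 : χ 0 = 1) {R : ℝ} (hR0 : 0 ≤ R) (hR : ∀ x, ‖Q x‖ ≤ R) {b : ℝ} (hb0 : 0 ≤ b)
    (hb : ∀ v w : Mat N, ‖matPairing N v w‖ ≤ b * ‖v‖ * ‖w‖) {M K : ℕ} {x C : ℝ} (hC0 : 0 ≤ C)
    (hC : ∀ τ ∈ Ioc (0 : ℝ) 1, ∀ z ∈ Icc (x - Real.pi * a) (x + Real.pi * a),
      ‖parametrixDefect χ (potEl Q) M x (τ, z)‖ ≤ C * τ ^ K) {t : ℝ} (ht : t ∈ Ioc (0 : ℝ) 1) :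
    ‖(U t x x : Mat N) - transposeCLM N (parametrix χ (potEl Q) M x (t, x))‖
      ≤ b * C * ((N : ℝ) * (N * (Real.exp (R * N) * Real.sqrt N))) * t ^ (K + 1) := by
  set L := Real.pi * a with hL
  have hL0 : 0 < L := by positivity
  have hl : 2 * Real.pi * a = 2 * L := by rw [hL]; ring
  set V : ℝ × ℝ × ℝ → Mat N := fun p => U p.1 p.2.1 p.2.2 with hV
  have hVs : ContDiffOn ℝ ∞ V (Ioi 0 ×ˢ univ) := hU.smooth
  have hheat : ∀ t, 0 < t → ∀ z y, deriv (fun s => V (s, z, y)) t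
      + (-iteratedDeriv 2 (fun z => V (t, z, y)) z + (potEl Q).1 z * V (t, z, y)) = 0 := hU.heat_eq
  have hp := contDiffOn_parametrix hχ (potEl Q) M x
  have cV : Continuous fun y => V (t, x, y) :=
    hVs.continuousOn.comp_continuous (f := fun y => (t, x, y)) (by fun_prop)
      fun y => ⟨ht.1, mem_univ _⟩
  have cp : Continuous fun y => transposeCLM N (parametrix χ (potEl Q) M x (t, y)) :=
    (transposeCLM N).continuous.comp (continuous_space hp ht.1)
  refine norm_le_of_integral_le (V := Mat N) (l := 2 * L) (by positivity)
    (F := fun y => V (t, x, y) - transposeCLM N (parametrix χ (potEl Q) M x (t, y)))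
    (cV.sub cp) fun φ hφ hper hpos => ?_
  rw [mul_div_cancel_left₀ L two_ne_zero]
  set u := smear φ (2 * L) V with hu
  have hus : ContDiffOn ℝ ∞ u (Ioi 0 ×ˢ univ) := contDiffOn_smear hφ hVs
  have hue : ∀ τ z, 0 < τ → partialDeriv (1, 0) u (τ, z)
      = partialDeriv (0, 1) (partialDeriv (0, 1) u) (τ, z) - (potEl Q).1 z * u (τ, z) :=
    fun τ z hτ => smear_heat_eq hφ hVs hheat hτ z
  have hlim : TendstoUniformly (fun s z => u (s, z)) (fun z => φ z • (1 : Mat N)) (𝓝[>] 0) := by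
    have h := tendstoUniformly_smear hU hφ.continuous (by rwa [hl])
    rw [hl] at h
    exact h
  have hf : Continuous fun z => φ z • (1 : Mat N) := hφ.continuous.smul continuous_const
  have hperu : ∀ τ, 0 < τ → u (τ, x + L) = u (τ, x - L)
      ∧ partialDeriv (0, 1) u (τ, x + L) = partialDeriv (0, 1) u (τ, x - L) := by
    intro τ hτ
    have h := smear_periodic (l := 2 * L) (T := 2 * L) hφ hVs
      (fun t ht z y => by rw [← hl]; exact hU.periodic_left t ht y z) hτ (x - L)
    rw [show x - L + 2 * L = x + L by ring] at h
    exact h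
  have hA1 : ∀ s ∈ Ioc (0 : ℝ) 1, ∫ z in (x - L)..(x + L), ‖u (s, z)‖
      ≤ (N : ℝ) * (N * (Real.exp (R * N) * Real.sqrt N)) * ∫ y in (x - L)..(x + L), φ y := by
    intro s hs
    have h2 : ∫ z in (x - L)..(x + L), Real.sqrt
        (matInner N (φ z • (1 : Mat N)) (φ z • (1 : Mat N)))
        = (∫ y in (x - L)..(x + L), φ y) * Real.sqrt N := by
      rw [← intervalIntegral.integral_mul_const]
      exact intervalIntegral.integral_congr fun z _ => matInner_smul_one (φ z) (hpos z)
    have h1 := integral_sqrt_le (B := matInner N) matInner_symm matInner_nonneg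
      (c := R * N) (by positivity) (A' := fun z w => (potEl Q).1 z * w)
      (fun z w => neg_matInner_mul_le (hR z) w) hus hue (α := x - L) (b := x + L) (by linarith)
      hperu hf hlim hs.1
    replace h1 := h1.trans (le_of_eq (congrArg (Real.exp (R * N * s) * ·) h2))
    have cu := continuous_space hus hs.1
    have cB : Continuous fun z => (N : ℝ) * (N * Real.sqrt (matInner N (u (s, z)) (u (s, z)))) :=
      continuous_const.mul (continuous_const.mul
        (((matInner N).continuous.comp cu).clm_apply cu).sqrt)
    have h3 := intervalIntegral.integral_mono_on (μ := MeasureTheory.volume)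
      (show x - L ≤ x + L by linarith) (cu.norm.intervalIntegrable _ _)
      (cB.intervalIntegrable _ _) fun z _ => norm_le_sqrt_matInner (u (s, z))
    rw [intervalIntegral.integral_const_mul, intervalIntegral.integral_const_mul] at h3
    refine h3.trans ?_
    have hint : 0 ≤ ∫ y in (x - L)..(x + L), φ y :=
      intervalIntegral.integral_nonneg (by linarith) fun y _ => hpos y
    have h4 : Real.exp (R * N * s) ≤ Real.exp (R * N) :=
      Real.exp_le_exp.2 (mul_le_of_le_one_right (by positivity) hs.2)
    have h5 := h1.trans (mul_le_mul_of_nonneg_right h4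
      (mul_nonneg hint (Real.sqrt_nonneg _)))
    calc _ ≤ (N : ℝ) * (N * (Real.exp (R * N)
          * ((∫ y in (x - L)..(x + L), φ y) * Real.sqrt N))) := by
          gcongr
          exact h5
      _ = _ := by ring
  have hβ : ∀ w : Mat N, matPairing N 1 w = w := fun w => by
    rw [matPairing_apply, Matrix.transpose_one, one_mul]
  have hA : ∀ (z : ℝ) (v w : Mat N), matPairing N ((potEl Q).1 z * v) w
      = matPairing N v ((potEl Q).1 z * w) := fun z v w => by
    have hs : ((potEl Q).1 z)ᵀ = (potEl Q).1 z := Q.symm z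
    rw [matPairing_apply, matPairing_apply, Matrix.transpose_mul, hs, mul_assoc]
  have hmain := norm_sub_integral_parametrix_le (matPairing N) hb0 hb hβ hχ hL0 hρ hχ0 hχ1 (potEl Q)
    (A' := fun z w => (potEl Q).1 z * w) hA M x hus hue hf hlim hC0 hC hA1 ht
  refine (le_of_eq (congrArg norm ?_)).trans (hmain.trans (le_of_eq ?_))
  swap
  · ring
  have c1 : Continuous fun y => φ y • V (t, x, y) := hφ.continuous.smul cV
  have c2 : Continuous fun y => φ y • transposeCLM N (parametrix χ (potEl Q) M x (t, y)) :=
    hφ.continuous.smul cp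
  -- Periodicity in y moves the smearing integral to the period centred at x, where the parametrix
  -- lives.
  have h1 : u (t, x) = ∫ y in (x - L)..(x + L), φ y • V (t, x, y) := by
    have hVper : Function.Periodic (fun y => φ y • V (t, x, y)) (2 * L) := fun y => by
      have h2 : V (t, x, y + 2 * L) = V (t, x, y) := by
        rw [← hl]
        exact hU.periodic_right t ht.1 x y
      change φ (y + 2 * L) • V (t, x, y + 2 * L) = φ y • V (t, x, y)
      rw [hper y, h2]
    have h3 := hVper.intervalIntegral_add_eq 0 (x - L)
    rw [zero_add, show x - L + 2 * L = x + L by ring] at h3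
    exact h3
  rw [h1]
  refine Eq.trans ?_ (congrArg (fun v => (∫ y in (x - L)..(x + L), φ y • V (t, x, y)) - v)
    (intervalIntegral.integral_congr
      (f := fun y => φ y • transposeCLM N (parametrix χ (potEl Q) M x (t, y))) (g := fun y => matPairing N
      (parametrix χ (potEl Q) M x (t, y)) (φ y • (1 : Mat N))) fun y _ => ?_))
  · rw [← intervalIntegral.integral_sub (c1.intervalIntegrable _ _) (c2.intervalIntegrable _ _)]
    refine intervalIntegral.integral_congr fun y _ => ?_
    exact smul_sub _ _ _
  · change φ y • (parametrix χ (potEl Q) M x (t, y))ᵀ =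
      (parametrix χ (potEl Q) M x (t, y))ᵀ * (φ y • (1 : Mat N))
    rw [Matrix.mul_smul, Matrix.mul_one]

theorem heatDiag_apply_eq (k : ℕ) (Q : Potential a N) (x : ℝ) :
    heatDiag k Q x = (heatEl (potEl Q) k).1 (x, x) := by
  rw [heatDiag, heatCoeff_eq]
  rfl

theorem continuous_heatDiag (k : ℕ) (Q : Potential a N) :
    Continuous fun x => (heatDiag k Q x : Mat N) := by
  simp only [heatDiag_apply_eq]
  exact (smoothAlg_contDiff (heatEl (potEl Q) k)).continuous.comp (by fun_prop)

theorem heatDiag_periodic (k : ℕ) (Q : Potential a N) :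
    Function.Periodic (heatDiag k Q) (2 * Real.pi * a) := fun x => by
  rw [heatDiag_eq]
  exact congrArg ((Nat.factorial k : ℝ) • ·) ((regDiag k).2.2.1 Q x)

theorem transpose_parametrix_diag (ha : 0 < a) {χ : ℝ → ℝ} (hχ1 : χ 0 = 1) (Q : Potential a N)
    (M : ℕ) (x t : ℝ) : transposeCLM N (parametrix χ (potEl Q) M x (t, x))
      = (Real.sqrt (4 * Real.pi * t))⁻¹ •
        ∑ k ∈ Finset.range (M + 1), expCoeff k t • (heatDiag k Q x : Mat N) := by
  rw [parametrix, expSum]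
  simp only [sub_self, hχ1, mul_one, gaussKernel_zero_right, map_smul, map_sum]
  congr 1
  refine Finset.sum_congr rfl fun k _ => ?_
  rw [heatDiag_apply_eq]
  congr 1
  have h := heatDiag_isSymm ha k Q x
  rw [heatDiag_apply_eq] at h
  exact h

theorem heatKernel_diag_le (ha : 0 < a) {Q : Potential a N}
    {U : ℝ → ℝ → ℝ → Matrix (Fin N) (Fin N) ℝ} (hU : IsHeatKernel Q U) (K : ℕ) :
    ∃ C : ℝ, 0 ≤ C ∧ ∀ t ∈ Ioc (0 : ℝ) 1, ∀ x ∈ Icc 0 (2 * Real.pi * a),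
      ‖(U t x x : Mat N) - (Real.sqrt (4 * Real.pi * t))⁻¹ •
        ∑ k ∈ Finset.range (K + 2), expCoeff k t • (heatDiag k Q x : Mat N)‖ ≤ C * t ^ (K + 1) := by
  set L := Real.pi * a with hL
  have hL0 : 0 < L := by positivity
  -- With L half the circumference, the cutoff is supported well inside the period x - L to x + L,
  -- so the parametrix vanishes with its derivative at both ends.
  let χ : ContDiffBump (0 : ℝ) := ⟨L / 4, L / 2, by positivity, by linarith⟩
  have hχ : ContDiff ℝ ∞ χ := χ.contDiff
  have hχ1 : ∀ w, |w| < L / 4 → χ w = 1 := fun w hw =>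
    χ.one_of_mem_closedBall (by simpa using hw.le)
  have hχ0 : ∀ w, L / 2 ≤ |w| → χ w = 0 := fun w hw => χ.zero_of_le_dist (by simpa using hw)
  obtain ⟨R, hR0, hR⟩ := exists_norm_potential_le ha Q
  obtain ⟨b, hb0, hb⟩ := exists_bilin_bound (matPairing N)
  -- The range from -L to 3L contains every window centred at a point of one period, which makes the
  -- constant uniform in x.
  obtain ⟨C, hC0, hC⟩ := parametrixDefect_le hχ (ρ := L / 4) (by positivity) hχ1 (potEl Q) K
    0 (2 * L) (-L) (3 * L)
  refine ⟨b * C * ((N : ℝ) * (N * (Real.exp (R * N) * Real.sqrt N))), by positivity,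
    fun t ht x hx => ?_⟩
  rw [show 2 * Real.pi * a = 2 * L by rw [hL]; ring] at hx
  have h0 : χ (0 : ℝ) = 1 := hχ1 0 (by rw [abs_zero]; positivity)
  have h := heatKernel_sub_parametrix_le ha hU hχ (ρ := L / 2) (by linarith) hχ0 h0 hR0 hR hb0 hb
    (M := K + 1) (K := K) (x := x) hC0 (fun τ hτ z hz => hC τ hτ x hx z
      ⟨by linarith [hz.1, hx.1], by linarith [hz.2, hx.2]⟩) ht
  rwa [transpose_parametrix_diag ha h0] at h

/-- The comparison keeps K+2 terms; those of order K and K+1 are O(t^K) by boundedness of the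
coefficients on the circle and join the error. Periodicity extends the bound from one period to the
line. -/
theorem norm_sqrt_smul_heatKernel_le (ha : 0 < a) {Q : Potential a N}
    {U : ℝ → ℝ → ℝ → Matrix (Fin N) (Fin N) ℝ} (hU : IsHeatKernel Q U) (K : ℕ) :
    ∃ C : ℝ, 0 ≤ C ∧ ∀ t ∈ Ioo (0 : ℝ) 1, ∀ x : ℝ,
      ‖Real.sqrt (4 * Real.pi * t) • (U t x x : Mat N)
        - ∑ k ∈ Finset.range K, expCoeff k t • (heatDiag k Q x : Mat N)‖ ≤ C * t ^ K := by
  have hl : 0 < 2 * Real.pi * a := by positivity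
  obtain ⟨C, hC0, hC⟩ := heatKernel_diag_le ha hU K
  have hbd : ∀ k, ∃ c, ∀ x ∈ Icc 0 (2 * Real.pi * a), ‖(heatDiag k Q x : Mat N)‖ ≤ c := fun k =>
    isCompact_Icc.exists_bound_of_continuousOn (continuous_heatDiag k Q).continuousOn
  obtain ⟨c₀, hc₀⟩ := hbd K
  obtain ⟨c₁, hc₁⟩ := hbd (K + 1)
  refine ⟨C * Real.sqrt (4 * Real.pi) + |c₀| + |c₁|, by positivity, fun t ht x => ?_⟩
  have ht1 : t ∈ Ioc (0 : ℝ) 1 := ⟨ht.1, ht.2.le⟩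
  have key : ∀ x ∈ Icc 0 (2 * Real.pi * a), ‖Real.sqrt (4 * Real.pi * t) • (U t x x : Mat N)
        - ∑ k ∈ Finset.range K, expCoeff k t • (heatDiag k Q x : Mat N)‖
        ≤ (C * Real.sqrt (4 * Real.pi) + |c₀| + |c₁|) * t ^ K := by
    intro x hx
    set σ := Real.sqrt (4 * Real.pi * t) with hσ
    have hσ0 : 0 < σ := Real.sqrt_pos.2 (by have := ht.1; positivity)
    have hσle : σ ≤ Real.sqrt (4 * Real.pi) :=
      Real.sqrt_le_sqrt (mul_le_of_le_one_right (by positivity) ht.2.le)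
    have htK : t ^ (K + 1) ≤ t ^ K := pow_le_pow_of_le_one ht.1.le ht.2.le (Nat.le_succ K)
    have e : σ • (U t x x : Mat N) - ∑ k ∈ Finset.range K, expCoeff k t • (heatDiag k Q x : Mat N)
        = σ • ((U t x x : Mat N) - σ⁻¹ •
          ∑ k ∈ Finset.range (K + 2), expCoeff k t • (heatDiag k Q x : Mat N))
          + expCoeff K t • (heatDiag K Q x : Mat N)
          + expCoeff (K + 1) t • (heatDiag (K + 1) Q x : Mat N) := by
      rw [Finset.sum_range_succ, Finset.sum_range_succ, smul_sub, smul_smul,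
        mul_inv_cancel₀ hσ0.ne', one_smul]
      abel
    rw [e]
    have h1 : ‖σ • ((U t x x : Mat N) - σ⁻¹ •
          ∑ k ∈ Finset.range (K + 2), expCoeff k t • (heatDiag k Q x : Mat N))‖
        ≤ C * Real.sqrt (4 * Real.pi) * t ^ K := by
      rw [norm_smul, Real.norm_of_nonneg hσ0.le]
      calc _ ≤ Real.sqrt (4 * Real.pi) * (C * t ^ (K + 1)) :=
            mul_le_mul hσle (hC t ht1 x hx) (norm_nonneg _) (Real.sqrt_nonneg _)
        _ ≤ Real.sqrt (4 * Real.pi) * (C * t ^ K) := by gcongr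
        _ = _ := by ring
    have h2 : ‖expCoeff K t • (heatDiag K Q x : Mat N)‖ ≤ |c₀| * t ^ K := by
      rw [norm_smul, Real.norm_eq_abs, mul_comm]
      exact mul_le_mul ((hc₀ x hx).trans (le_abs_self _)) (abs_expCoeff_le _ ht.1.le)
        (abs_nonneg _) (abs_nonneg _)
    have h3 : ‖expCoeff (K + 1) t • (heatDiag (K + 1) Q x : Mat N)‖ ≤ |c₁| * t ^ K := by
      rw [norm_smul, Real.norm_eq_abs, mul_comm]
      exact mul_le_mul ((hc₁ x hx).trans (le_abs_self _)) ((abs_expCoeff_le _ ht.1.le).trans htK)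
        (abs_nonneg _) (abs_nonneg _)
    refine (norm_add₃_le).trans ?_
    rw [add_mul, add_mul]
    exact add_le_add (add_le_add h1 h2) h3
  have hper : Function.Periodic (fun x => Real.sqrt (4 * Real.pi * t) • (U t x x : Mat N)
      - ∑ k ∈ Finset.range K, expCoeff k t • (heatDiag k Q x : Mat N)) (2 * Real.pi * a) := by
    intro x
    have h1 : U t (x + 2 * Real.pi * a) (x + 2 * Real.pi * a) = U t x x :=
      (hU.periodic_left t ht.1 _ x).trans (hU.periodic_right t ht.1 x x)
    simp only [h1, heatDiag_periodic _ Q x]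
  obtain ⟨y, hy, hxy⟩ := hper.exists_mem_Ico₀ hl x
  exact (le_of_eq (congrArg norm hxy)).trans (key y ⟨hy.1, hy.2.le⟩)

theorem heatKernel_expansion (ha : 0 < a) {Q : Potential a N}
    {U : ℝ → ℝ → ℝ → Matrix (Fin N) (Fin N) ℝ} (hU : IsHeatKernel Q U) (K : ℕ) :
    (∃ C δ : ℝ, 0 < δ ∧ ∀ t ∈ Set.Ioo 0 δ, ∀ x : ℝ,
      ‖Real.sqrt (4 * Real.pi * t) • U t x x
        - ∑ k ∈ Finset.range K, ((-t) ^ k / (Nat.factorial k : ℝ)) • heatDiag k Q x‖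
        ≤ C * t ^ K) ∧
    (fun t : ℝ => Real.sqrt (4 * Real.pi * t)
          * (∫ x in (0 : ℝ)..(2 * Real.pi * a), (U t x x).trace)
        - ∑ k ∈ Finset.range K, ((-t) ^ k / (Nat.factorial k : ℝ)) * heatInvariant k Q)
      =O[𝓝[>] 0] (fun t : ℝ => t ^ K) := by
  have hl : 0 < 2 * Real.pi * a := by positivity
  obtain ⟨C, hC0, hC⟩ := norm_sqrt_smul_heatKernel_le ha hU K
  refine ⟨⟨C, 1, one_pos, hC⟩, ?_⟩
  refine Asymptotics.IsBigO.of_bound (N * C * |2 * Real.pi * a - 0|) ?_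
  filter_upwards [Ioo_mem_nhdsGT one_pos] with t ht
  have cU : Continuous fun x => (U t x x : Mat N) :=
    hU.smooth.continuousOn.comp_continuous (f := fun x => (t, x, x)) (by fun_prop)
      fun x => ⟨ht.1, mem_univ _⟩
  have ctU : Continuous fun x => (U t x x).trace := (traceCLM N).continuous.comp cU
  have ctd : ∀ k, Continuous fun x => (heatDiag k Q x).trace := fun k =>
    (traceCLM N).continuous.comp (continuous_heatDiag k Q)
  have e : Real.sqrt (4 * Real.pi * t) * (∫ x in (0 : ℝ)..(2 * Real.pi * a), (U t x x).trace)
      - ∑ k ∈ Finset.range K, ((-t) ^ k / (Nat.factorial k : ℝ)) * heatInvariant k Q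
      = ∫ x in (0 : ℝ)..(2 * Real.pi * a), traceCLM N
        (Real.sqrt (4 * Real.pi * t) • (U t x x : Mat N)
          - ∑ k ∈ Finset.range K, expCoeff k t • (heatDiag k Q x : Mat N)) := by
    have h1 : ∀ x, traceCLM N (Real.sqrt (4 * Real.pi * t) • (U t x x : Mat N)
          - ∑ k ∈ Finset.range K, expCoeff k t • (heatDiag k Q x : Mat N))
        = Real.sqrt (4 * Real.pi * t) * (U t x x).trace
          - ∑ k ∈ Finset.range K, expCoeff k t * (heatDiag k Q x).trace := by
      intro x
      rw [map_sub, map_smul, map_sum]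
      simp only [map_smul, traceCLM_apply, smul_eq_mul]
    have c1 : Continuous fun x => Real.sqrt (4 * Real.pi * t) * (U t x x).trace :=
      continuous_const.mul ctU
    have c2 : ∀ k, Continuous fun x => expCoeff k t * (heatDiag k Q x).trace := fun k =>
      continuous_const.mul (ctd k)
    have c3 : Continuous fun x => ∑ k ∈ Finset.range K, expCoeff k t * (heatDiag k Q x).trace :=
      continuous_finsetSum _ fun k _ => c2 k
    simp only [h1]
    rw [intervalIntegral.integral_sub (c1.intervalIntegrable _ _) (c3.intervalIntegrable _ _),
      intervalIntegral.integral_const_mul, intervalIntegral.integral_finsetSum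
        fun k _ => (c2 k).intervalIntegrable _ _]
    simp only [intervalIntegral.integral_const_mul]
    rfl
  rw [e]
  have h2 := intervalIntegral.norm_integral_le_of_norm_le_const (a := 0) (b := 2 * Real.pi * a)
    (C := N * (C * t ^ K)) (f := fun x => traceCLM N
        (Real.sqrt (4 * Real.pi * t) • (U t x x : Mat N)
          - ∑ k ∈ Finset.range K, expCoeff k t • (heatDiag k Q x : Mat N)))
    fun x _ => (abs_trace_le _).trans
      (mul_le_mul_of_nonneg_left (hC t ht x) (Nat.cast_nonneg N))
  refine h2.trans (le_of_eq ?_)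
  rw [Real.norm_of_nonneg (pow_nonneg ht.1.le K)]
  ring

theorem heatCoeff_transport (Q : Potential a N) (k : ℕ) (x y : ℝ) :
    heatCoeff Q (k + 1) x y
        + ((x - y) / ((k : ℝ) + 1)) • deriv (fun ξ => heatCoeff Q (k + 1) ξ y) x
      = schrodinger Q (fun ξ => heatCoeff Q k ξ y) x := by
  rw [heatCoeff_eq, heatCoeff_eq]
  refine (coeffGen_transport (potEl Q) k x y).trans ?_
  rw [← schrodinger_slice]
  rfl

end

end HeatKdV

theorem mainTheorem8 (a : ℝ) (ha : 0 < a) (N : ℕ) :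
    -- the two-point coefficients are smooth and satisfy the transport recursion
    (∀ (Q : HeatKdV.Potential a N) (k : ℕ),
      ContDiff ℝ ∞ (fun p : ℝ × ℝ => HeatKdV.heatCoeff Q k p.1 p.2) ∧
      ∀ x y : ℝ, HeatKdV.heatCoeff Q (k + 1) x y
          + ((x - y) / ((k : ℝ) + 1)) • deriv (fun ξ => HeatKdV.heatCoeff Q (k + 1) ξ y) x
        = HeatKdV.schrodinger Q (fun ξ => HeatKdV.heatCoeff Q k ξ y) x) ∧
    -- they are the coefficients of the small time expansions of the heat kernel diagonal,
    -- uniformly on the circle, and of the heat trace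
    (∀ (Q : HeatKdV.Potential a N) (U : ℝ → ℝ → ℝ → Matrix (Fin N) (Fin N) ℝ),
      HeatKdV.IsHeatKernel Q U → ∀ K : ℕ,
      (∃ C δ : ℝ, 0 < δ ∧ ∀ t ∈ Set.Ioo 0 δ, ∀ x : ℝ,
        ‖Real.sqrt (4 * Real.pi * t) • U t x x
          - ∑ k ∈ Finset.range K, ((-t) ^ k / (Nat.factorial k : ℝ)) • HeatKdV.heatDiag k Q x‖
          ≤ C * t ^ K) ∧
      (fun t : ℝ => Real.sqrt (4 * Real.pi * t)
            * (∫ x in (0 : ℝ)..(2 * Real.pi * a), (U t x x).trace)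
          - ∑ k ∈ Finset.range K, ((-t) ^ k / (Nat.factorial k : ℝ)) * HeatKdV.heatInvariant k Q)
        =O[𝓝[>] 0] (fun t : ℝ => t ^ K)) ∧
    -- `δA_k/δQ = k [a_{k-1}]`
    (∀ Q : HeatKdV.Potential a N,
      HeatKdV.HasVarDeriv (HeatKdV.heatInvariant 0) Q 0 ∧
      ∀ k : ℕ, HeatKdV.HasVarDeriv (HeatKdV.heatInvariant (k + 1)) Q
        (((k : ℝ) + 1) • HeatKdV.heatDiag k Q)) ∧
    -- `D⁻¹ Ad_Q` is defined on `δI_k/δQ`, so that `E` is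
    (∀ k : ℕ, ∃ W ∈ HeatKdV.diffPoly a N,
      HeatKdV.opD W = HeatKdV.adQ (HeatKdV.varDeriv (HeatKdV.kdvInvariant k))) ∧
    -- `δI_k/δQ = -2 (D⁻¹ E)^(k-1) Q`, a differential polynomial, for `k ≥ 1`
    (∀ k : ℕ, HeatKdV.varDeriv (HeatKdV.kdvInvariant (k + 1)) ∈ HeatKdV.diffPoly a N ∧
      HeatKdV.varDeriv (HeatKdV.kdvInvariant (k + 1))
        = (-2 : ℝ) • (fun g : HeatKdV.FieldMap a N => HeatKdV.opDinv (HeatKdV.opE g))^[k]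
            HeatKdV.potentialField) ∧
    -- `D δI_k/δQ = E δI_{k-1}/δQ` for `k ≥ 1`
    (∀ k : ℕ, HeatKdV.opD (HeatKdV.varDeriv (HeatKdV.kdvInvariant (k + 1)) : HeatKdV.FieldMap a N)
      = HeatKdV.opE (HeatKdV.varDeriv (HeatKdV.kdvInvariant k))) ∧
    -- the two brackets are related, and all `I_k` are in involution for both of them
    (∀ (Q : HeatKdV.Potential a N) (n k : ℕ),
      HeatKdV.bracketD (HeatKdV.kdvInvariant n) (HeatKdV.kdvInvariant (k + 1)) Q
        = HeatKdV.bracketE (HeatKdV.kdvInvariant n) (HeatKdV.kdvInvariant k) Q ∧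
      HeatKdV.bracketD (HeatKdV.kdvInvariant n) (HeatKdV.kdvInvariant k) Q = 0 ∧
      HeatKdV.bracketE (HeatKdV.kdvInvariant n) (HeatKdV.kdvInvariant k) Q = 0) ∧
    -- all `I_n` are conserved by all the flows
    (∀ (k n : ℕ) (S : Set ℝ) (γ : ℝ → HeatKdV.Potential a N), HeatKdV.IsKdVFlow k S γ →
      ∀ s ∈ S, HasDerivAt (fun σ => HeatKdV.kdvInvariant n (γ σ)) 0 s) := by
  refine ⟨fun Q k => ⟨?_, fun x y => ?_⟩, fun Q U hU K => HeatKdV.heatKernel_expansion ha hU K,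
    fun Q => ⟨HeatKdV.hasVarDeriv_heatInvariant_zero Q,
      fun k => HeatKdV.hasVarDeriv_heatInvariant ha Q k⟩,
    fun k => ⟨(HeatKdV.kdvSkew k).1, HeatKdV.kdvSkew_mem k, ?_⟩, fun k => ⟨?_, ?_⟩, fun k => ?_,
    fun Q n k => ⟨?_, HeatKdV.bracketD_kdvInvariant ha n k Q,
      HeatKdV.bracketE_kdvInvariant ha n k Q⟩,
    fun k n S γ hγ s hs => HeatKdV.hasDerivAt_kdvInvariant_flow ha hγ hs⟩
  · rw [HeatKdV.heatCoeff_eq]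
    exact HeatKdV.coeffGen_contDiff (HeatKdV.potEl Q) k
  · exact HeatKdV.heatCoeff_transport Q k x y
  · rw [HeatKdV.varDeriv_kdvInvariant ha]
    exact congrArg Subtype.val (HeatKdV.regD_kdvSkew k)
  · rw [HeatKdV.varDeriv_kdvInvariant ha]
    exact HeatKdV.kdvField_succ_mem k
  · rw [HeatKdV.varDeriv_kdvInvariant ha, HeatKdV.iterate_opDinv_opE ha]
    change _ = (-2 : ℝ) • (-(1 / 2) : ℝ) • (HeatKdV.kdvField (k + 1)).1
    rw [smul_smul]
    norm_num
  · rw [HeatKdV.varDeriv_kdvInvariant ha, HeatKdV.varDeriv_kdvInvariant ha,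
      HeatKdV.opE_kdvField ha]
  · rw [HeatKdV.bracketD, HeatKdV.bracketE, HeatKdV.varDeriv_kdvInvariant ha,
      HeatKdV.varDeriv_kdvInvariant ha, HeatKdV.varDeriv_kdvInvariant ha, HeatKdV.opE_kdvField ha]
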